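/- **The Tracy–Widom system.** For real $N\neq0$ consider unknown functions of $(a_1,a_2)$: complex valued $q_1,q_2,p_1,p_2,u,v,w$ and a positive $\tilde J$. Put $R_{jk}=\frac{q_jp_k-p_jq_k}{e^{ia_j}-e^{ia_k}}$ ($j\ne k$) and $R_{jj}=-ie^{-ia_j}\bigl(p_j\frac{\partial q_j}{\partial a_j}-q_j\frac{\partial p_j}{\partial a_j}\bigr)$. The TW system is, for $(j,k)=(1,2),(2,1)$, $$i(1-e^{ia_j})\tfrac{\partial q_j}{\partial a_j}=-\bigl\{\tfrac{N+1}2(1-e^{ia_j})+v-\tfrac1N\bigr\}q_j+(N+1)(u-\tfrac1N)p_j-(-1)^ki(1-e^{ia_k})R_{jk}q_k,$$ $$i(1-e^{ia_j})\tfrac{\partial p_j}{\partial a_j}=\bigl\{\tfrac{N-1}2(1-e^{ia_j})+v-\tfrac1N\bigr\}p_j+(N-1)(w-\tfrac1N)q_j-(-1)^ki(1-e^{ia_k})R_{jk}p_k,$$ $$\tfrac{\partial q_j}{\partial a_k}=(-1)^kR_{jk}q_k,\quad \tfrac{\partial p_j}{\partial a_k}=(-1)^kR_{jk}p_k,\quad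 \tfrac{\partial u}{\partial a_j}=(-1)^jq_j^2,\quad \tfrac{\partial w}{\partial a_j}=(-1)^jp_j^2,\quad \tfrac{\partial v}{\partial a_j}=(-1)^jq_jp_j,\quad \tfrac{\partial}{\partial a_j}\log\tilde J=-(-1)^jR_{jj},$$ and its boundary conditions are, as $a_1,a_2\to0$ and up to terms $O(\|(a_1,a_2)\|^4)$, $$q_j=i\tfrac{N+1}{2\sqrt{2\pi}}a_j-\tfrac{(N+1)(N+2)}{12\sqrt{2\pi}}a_j^2-i\tfrac{(N+1)^3}{48\sqrt{2\pi}}a_j^3,\qquad p_j=-i\tfrac{N-1}{2\sqrt{2\pi}}a_j-\tfrac{(N-1)(N-2)}{12\sqrt{2\pi}}a_j^2+i\tfrac{(N-1)^3}{48\sqrt{2\pi}}a_j^3,$$ $$u=\tfrac{(N+1)^2}{24\pi}(a_1^3-a_2^3),\quad w=\tfrac{(N-1)^2}{24\pi}(a_1^3-a_2^3),\quad v=-\tfrac{N^2-1}{24\pi}(a_1^3-a_2^3),\quad \log\tilde J=\tfrac{N(N^2-1)}{72\pi}(a_1^3-a_2^3).$$ Unfolding means regarding the unknowns as functions of $A_j$,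 where $a_j=(2/N)A_j$, $A_1<0<A_2$, $A_2-A_1<\pi|N|$. **The distributions.** Let $K_N(x,y)=\frac1{2\pi}\frac{\sin(N(x-y)/2)}{\sin((x-y)/2)}$ (with $K_N(x,x)=\frac N{2\pi}$) be the CUE$_N$ kernel, $\tilde K_N(x,y)=K_N(x,y)-K_N(x,0)K_N(0,0)^{-1}K_N(0,y)$, and let $\tilde J_1(0;[a_1,a_2])=\det(1-\tilde K_N)_{L^2[a_1,a_2]}$ (Fredholm determinant) be the conditional Jánossy density and $J_1=K_N(0,0)\tilde J_1$ the Jánossy density; these formulas are read for all real $N\ne0$ (with oriented integrals if $N<0$). Let $$P_{\rm nn}(t)=-\tfrac{d}{dt}\tilde J_1(0;[-t,t]),\qquad P_{\rm c}(a_1,a_2)=-\tfrac{\partial^2}{\partial a_1\partial a_2}\tilde J_1(0;[a_1,a_2]),\qquad P_{\rm r}(r)=\int_0^{2\pi/(1+r)}b\,P_{\rm c}(-rb,b)\,db .$$ In the unfolded variables, $\tilde J_1$ becomes $\tilde J_1(0;[\frac2NA_1,\frac2NA_2])$, $J_1$ becomes $\frac2NJ_1(0;[\frac2NA_1,\frac2NA_2])$,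 $P_{\rm nn}$ becomes $\frac2NP_{\rm nn}(\frac2NT)$, and $P_{\rm c}$ becomes $P_{\rm c}^{\rm unf}(A_1,A_2)=(\frac2N)^2P_{\rm c}(\frac2NA_1,\frac2NA_2)$. **Claim.** 1. On every set of unfolded endpoints, $(q_j,p_j,u,v,w,\tilde J)$ satisfies the unfolded TW system with parameter $N$ if and only if $(\overline{p_j},\overline{q_j},-\overline w,-\overline v,-\overline u,\tilde J)$ satisfies the unfolded TW system with parameter $-N$; the same equivalence holds for the unfolded boundary conditions. 2. $\tilde J_1(0;[a_1,a_2])$ is twice continuously differentiable in the endpoints (on the domain that corresponds to $A_1<0<A_2$, $A_2-A_1<\pi|N|$). For fixed $A_1<0<A_2$ and $T>0$, the unfolded $\tilde J_1$, $J_1$, $P_{\rm nn}$ and $P_{\rm c}$ at $(A_1,A_2)$, respectively $T$, are functions of $1/N^2$ that are analytic at $1/N^2=0$: there is a function $F$, analytic at $0$, such that the quantity equals $F(1/N^2)$ for all real $N\neq0$ with $A_2-A_1<\pi|N|$ (respectively $2T<\pi|N|$). 3. Let $r>0$. For every $B>0$ the integral $\int_0^{B}b\,P_{\rm c}^{\rm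 unf}(-rb,b)\,db$, i.e. the gap-ratio density restricted to unfolded spacings $A_2\le B$, converges for real $N\ne0$ with $(1+r)B<\pi|N|$ and is there a function of $1/N^2$ that is analytic at $1/N^2=0$. The full gap-ratio density, whose unfolded range of integration $0<b<\pi N/(1+r)$ grows with $N$, is a convergent integral for every integer $N\geq1$ and has a complete asymptotic expansion in powers of $1/N^2$ that is obtained term by term: if $P_{\rm c}^{(2k)}$ denotes the $k$-th Taylor coefficient of $P_{\rm c}^{\rm unf}$ in $1/N^2$ at $1/N^2=0$, then $b\,P_{\rm c}^{(2k)}(-rb,b)$ is integrable on $(0,\infty)$ for all $k\ge0$ and, for every $m\geq0$, as $N\to\infty$ through the integers, $$P_{\rm r}(r)=\sum_{k<m}\frac1{N^{2k}}\int_0^\infty b\,P_{\rm c}^{(2k)}(-rb,b)\,db+O\bigl(N^{-2m}\bigr).$$ -/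

import Mathlib

noncomputable section

namespace CUEJanossy

/-! ### The Tracy-Widom system in the endpoints `a 0 = a₁`, `a 1 = a₂` -/

/-- The unknowns `q_j, p_j` (the indices `j = 0, 1` stand for the endpoints `a₁, a₂`), `u`, `v`, `w`
and the (real valued) conditional Jánossy density `J`, as functions of the endpoints. -/
structure TWFields where
  q : Fin 2 → (Fin 2 → ℝ) → ℂ
  p : Fin 2 → (Fin 2 → ℝ) → ℂ
  u : (Fin 2 → ℝ) → ℂ
  v : (Fin 2 → ℝ) → ℂ
  w : (Fin 2 → ℝ) → ℂ
  J : (Fin 2 → ℝ) → ℝ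

/-- The partial derivative `∂f/∂a_k` at `a`. -/
def pderiv (k : Fin 2) (f : (Fin 2 → ℝ) → ℂ) (a : Fin 2 → ℝ) : ℂ :=
  deriv (fun t : ℝ => f (Function.update a k t)) (a k)

/-- The sign `(-1)^j` for `j = 1, 2`; the index `j = 1` is `0 : Fin 2`. -/
def sgn (j : Fin 2) : ℂ := (-1) ^ (j.val + 1)

/-- `e^{i x}`. -/
def expI (x : ℝ) : ℂ := Complex.exp (Complex.I * (x : ℂ))

namespace TWFields

/-- `R_{jk} = (q_j p_k - p_j q_k) / (e^{i a_j} - e^{i a_k})` for `j ≠ k`. -/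
def Roff (X : TWFields) (j k : Fin 2) (a : Fin 2 → ℝ) : ℂ :=
  (X.q j a * X.p k a - X.p j a * X.q k a) / (expI (a j) - expI (a k))

/-- `R_{jj} = -i e^{-i a_j} (p_j ∂q_j/∂a_j - q_j ∂p_j/∂a_j)`. -/
def Rdiag (X : TWFields) (j : Fin 2) (a : Fin 2 → ℝ) : ℂ :=
  -Complex.I * expI (-(a j)) *
    (X.p j a * pderiv j (X.q j) a - X.q j a * pderiv j (X.p j) a)

/-- The fields read at the rescaled endpoints `c a`. -/
def rescale (c : ℝ) (X : TWFields) : TWFields where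
  q := fun j a => X.q j (c • a)
  p := fun j a => X.p j (c • a)
  u := fun a => X.u (c • a)
  v := fun a => X.v (c • a)
  w := fun a => X.w (c • a)
  J := fun a => X.J (c • a)

/-- The change of notation `q_j ↔ conj p_j`, `u ↔ -conj w`, `v ↦ -conj v`, with `J` unchanged. -/
def flip (X : TWFields) : TWFields where
  q := fun j a => (starRingEnd ℂ) (X.p j a)
  p := fun j a => (starRingEnd ℂ) (X.q j a)
  u := fun a => -(starRingEnd ℂ) (X.w a)
  v := fun a => -(starRingEnd ℂ) (X.v a)
  w := fun a => -(starRingEnd ℂ) (X.u a)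
  J := X.J

end TWFields

/-- The Tracy-Widom system with parameter `N` (original variables), imposed at all points of `D`. -/
def TWSystem (N : ℝ) (D : Set (Fin 2 → ℝ)) (X : TWFields) : Prop :=
  ∀ a ∈ D,
    ((∀ j, DifferentiableAt ℝ (X.q j) a) ∧ (∀ j, DifferentiableAt ℝ (X.p j) a) ∧
      DifferentiableAt ℝ X.u a ∧ DifferentiableAt ℝ X.v a ∧ DifferentiableAt ℝ X.w a ∧
      DifferentiableAt ℝ X.J a ∧ 0 < X.J a) ∧
    (∀ j k : Fin 2, j ≠ k →
      Complex.I * (1 - expI (a j)) * pderiv j (X.q j) a =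
          -(((N : ℂ) + 1) / 2 * (1 - expI (a j)) + X.v a - 1 / (N : ℂ)) * X.q j a
          + ((N : ℂ) + 1) * (X.u a - 1 / (N : ℂ)) * X.p j a
          - sgn k * Complex.I * (1 - expI (a k)) * X.Roff j k a * X.q k a ∧
      Complex.I * (1 - expI (a j)) * pderiv j (X.p j) a =
          (((N : ℂ) - 1) / 2 * (1 - expI (a j)) + X.v a - 1 / (N : ℂ)) * X.p j a
          + ((N : ℂ) - 1) * (X.w a - 1 / (N : ℂ)) * X.q j a
          - sgn k * Complex.I * (1 - expI (a k)) * X.Roff j k a * X.p k a ∧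
      pderiv k (X.q j) a = sgn k * X.Roff j k a * X.q k a ∧
      pderiv k (X.p j) a = sgn k * X.Roff j k a * X.p k a) ∧
    (∀ j : Fin 2,
      pderiv j X.u a = sgn j * X.q j a ^ 2 ∧
      pderiv j X.w a = sgn j * X.p j a ^ 2 ∧
      pderiv j X.v a = sgn j * (X.q j a * X.p j a) ∧
      pderiv j (fun b => ((Real.log (X.J b) : ℝ) : ℂ)) a = -(sgn j) * X.Rdiag j a)

/-- `f = g` up to terms of fourth order in the endpoints, as the endpoints tend to `0` in `D`. -/
def EqUpToFourth (D : Set (Fin 2 → ℝ)) (f g : (Fin 2 → ℝ) → ℂ) : Prop :=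
  Asymptotics.IsBigO (nhdsWithin 0 D) (fun a => f a - g a) (fun a => ‖a‖ ^ 4)

/-- The boundary conditions with parameter `N` (original variables) as `a₁, a₂ → 0` in `D`. -/
def TWBoundary (N : ℝ) (D : Set (Fin 2 → ℝ)) (X : TWFields) : Prop :=
  (∀ j : Fin 2,
    EqUpToFourth D (X.q j) (fun a =>
      Complex.I * (((N + 1) / (2 * Real.sqrt (2 * Real.pi)) * a j : ℝ) : ℂ)
      - (((N + 1) * (N + 2) / (12 * Real.sqrt (2 * Real.pi)) * a j ^ 2 : ℝ) : ℂ)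
      - Complex.I * (((N + 1) ^ 3 / (48 * Real.sqrt (2 * Real.pi)) * a j ^ 3 : ℝ) : ℂ))) ∧
  (∀ j : Fin 2,
    EqUpToFourth D (X.p j) (fun a =>
      -Complex.I * (((N - 1) / (2 * Real.sqrt (2 * Real.pi)) * a j : ℝ) : ℂ)
      - (((N - 1) * (N - 2) / (12 * Real.sqrt (2 * Real.pi)) * a j ^ 2 : ℝ) : ℂ)
      + Complex.I * (((N - 1) ^ 3 / (48 * Real.sqrt (2 * Real.pi)) * a j ^ 3 : ℝ) : ℂ))) ∧
  EqUpToFourth D X.u (fun a =>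
    (((N + 1) ^ 2 / (24 * Real.pi) * (a 0 ^ 3 - a 1 ^ 3) : ℝ) : ℂ)) ∧
  EqUpToFourth D X.w (fun a =>
    (((N - 1) ^ 2 / (24 * Real.pi) * (a 0 ^ 3 - a 1 ^ 3) : ℝ) : ℂ)) ∧
  EqUpToFourth D X.v (fun a =>
    ((-((N ^ 2 - 1) / (24 * Real.pi)) * (a 0 ^ 3 - a 1 ^ 3) : ℝ) : ℂ)) ∧
  EqUpToFourth D (fun a => ((Real.log (X.J a) : ℝ) : ℂ)) (fun a =>
    ((N * (N ^ 2 - 1) / (72 * Real.pi) * (a 0 ^ 3 - a 1 ^ 3) : ℝ) : ℂ))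

/-- The unfolded endpoints: `A₁ < 0 < A₂` and `A₂ - A₁ < π |N|`. -/
def unfoldedEndpoints (N : ℝ) : Set (Fin 2 → ℝ) :=
  {A | A 0 < 0 ∧ 0 < A 1 ∧ A 1 - A 0 < Real.pi * |N|}

/-- The Tracy-Widom system after unfolding: the unknowns `X` are functions of the unfolded
endpoints `A ∈ D`, and the original system is imposed at `a = (2/N) A`. -/
def UnfoldedTWSystem (N : ℝ) (D : Set (Fin 2 → ℝ)) (X : TWFields) : Prop :=
  TWSystem N {a | (N / 2) • a ∈ D} (X.rescale (N / 2))

/-- The boundary conditions after unfolding. -/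
def UnfoldedTWBoundary (N : ℝ) (D : Set (Fin 2 → ℝ)) (X : TWFields) : Prop :=
  TWBoundary N {a | (N / 2) • a ∈ D} (X.rescale (N / 2))

/-! ### The Jánossy density as a Fredholm determinant, and the distributions derived from it -/

/-- The CUE kernel `sin (N (x - y) / 2) / (2 π sin ((x - y) / 2))`, with its limiting value
`N / (2 π)` on the diagonal. -/
def cueKernel (N x y : ℝ) : ℝ :=
  if x = y then N / (2 * Real.pi)
  else 1 / (2 * Real.pi) * (Real.sin (N * (x - y) / 2) / Real.sin ((x - y) / 2))

/-- The kernel conditioned on an eigenphase at the origin. -/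
def condKernel (N x y : ℝ) : ℝ :=
  cueKernel N x y - cueKernel N x 0 * (cueKernel N 0 0)⁻¹ * cueKernel N 0 y

/-- The Fredholm determinant `det (1 - K)` on the interval with endpoints `a`, `b`, by its Fredholm
series. As for `∫ x in a..b`, the integrals are oriented, which only matters if `b < a`. -/
def fredholmDet (K : ℝ → ℝ → ℝ) (a b : ℝ) : ℝ :=
  ∑' n : ℕ, (-(if a ≤ b then (1 : ℝ) else -1)) ^ n / (n.factorial : ℝ) *
    ∫ x in Set.univ.pi (fun _ : Fin n => Set.uIcc a b),
      (Matrix.of fun i j : Fin n => K (x i) (x j)).det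

/-- The conditional Jánossy density `J̃₁(0; [a₁, a₂])`. -/
def condJanossy (N a₁ a₂ : ℝ) : ℝ := fredholmDet (condKernel N) a₁ a₂

/-- The Jánossy density `J₁(0; [a₁, a₂])`. -/
def janossy (N a₁ a₂ : ℝ) : ℝ := cueKernel N 0 0 * condJanossy N a₁ a₂

/-- The nearest-neighbour spacing density. -/
def Pnn (N t : ℝ) : ℝ := -deriv (fun s => condJanossy N (-s) s) t

/-- The joint density of the two consecutive spacings `-a₁` and `a₂`. -/
def Pc (N a₁ a₂ : ℝ) : ℝ :=
  -deriv (fun x => deriv (fun y => condJanossy N x y) a₂) a₁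

/-- The density of the gap ratio `r = |a₁| / a₂`. -/
def Pr (N r : ℝ) : ℝ :=
  ∫ b in (0 : ℝ)..(2 * Real.pi / (1 + r)), b * Pc N (-(r * b)) b

/-- The conditional Jánossy density in the unfolded variables `A = (N/2) a`. Below, densities carry
a Jacobian `2/N`
for each variable in which they are densities. -/
def condJanossyUnf (N A₁ A₂ : ℝ) : ℝ := condJanossy N (2 / N * A₁) (2 / N * A₂)

/-- The unfolded Jánossy density (a density in the position of the eigenphase at `0`). -/
def janossyUnf (N A₁ A₂ : ℝ) : ℝ := 2 / N * janossy N (2 / N * A₁) (2 / N * A₂)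

/-- The unfolded nearest-neighbour spacing density. -/
def PnnUnf (N T : ℝ) : ℝ := 2 / N * Pnn N (2 / N * T)

/-- The unfolded joint density of consecutive spacings. -/
def PcUnf (N A₁ A₂ : ℝ) : ℝ := (2 / N) ^ 2 * Pc N (2 / N * A₁) (2 / N * A₂)

/-- `g`, as a function of the nonzero real numbers `N` with `L < π |N|`, is a function of `1 / N²`
that is analytic at `1 / N² = 0`. -/
def AnalyticInInvSq (L : ℝ) (g : ℝ → ℝ) : Prop :=
  ∃ F : ℝ → ℝ, AnalyticAt ℝ F 0 ∧
    ∀ N : ℝ, N ≠ 0 → L < Real.pi * |N| → g N = F (1 / N ^ 2)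

end CUEJanossy

end

open MeasureTheory Filter Topology Matrix

namespace CUEJanossy

/-! ### The Tracy-Widom system under `N ↦ -N` -/

/-! Symmetry. Since `a = (2/N) A`, unfolding with `-N` reads the fields at reflected endpoints.
Conjugation undoes the reflection inside every `e^{ia}`, and exchanging `q` with `p` turns the
coefficients for `N` into those for `-N`. Conjugating the system at `-a` therefore gives the flipped
system at `a` (`TWSystem.reflect`, `TWBoundary.reflect`, `TWFields.rescale_flip`).

Analyticity. With `ε = 1/N²` the unfolded kernel is built from `S_ε(z) = (sin z / z) / (π sin(√ε
z)/(√ε z))`. Because `sin z / z` is an entire function of `z²`, only `ε` enters, and it enters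
analytically. By Hadamard's inequality the Fredholm series converges everywhere on the Banach space
of continuous kernels on the unit square, so the determinant is an entire function of the kernel
(`analyticAt_fredholmC`). Composition gives `janossyC`, jointly analytic in `ε` and in both
endpoints wherever the denominator has no zero (`analyticAt_janossyC`, `condJanossyUnf_eq`). The
spacing densities are derivatives of it.

Gap ratio. The range of `b` grows with `N`, while the disc of analyticity in `ε` shrinks as `b`
grows. What is needed is decay in `b` faster than any power, uniformly on complex polydiscs of
radius about `(1+b)^(-4)`.

The decay comes from projections. For integer `N` the conditioned kernel is a symmetric reproducing
kernel over a period `πN`. If `S_N(c) = 0`, then `√π S_N(· - c)` is a unit vector in its range,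
concentrated near `c`. Truncated to disjoint windows, several such vectors are almost fixed by the
operator on the interval, so `1 - K` is nearly degenerate. The inequality `|det B|² ≤ exp(‖B‖² -
n)`, applied to `(1 - K)(1 + s F F*)` for Riemann-sum matrices and passed to the limit, makes this
quantitative (`normSq_det_mul_le`, `normSq_fredholmC_mul_le`). With `M` windows of width
proportional to `b` and `s` of order `√b`, the squared determinant gains a factor `b^(-M)`
(`exists_norm_fredholmC_le`).

This estimate tolerates kernel perturbations of size `1/(1+b)`. It thus extends to complex
endpoints, and to complex `ε` by comparison with a large auxiliary integer
(`exists_norm_janossyC_le`). For integer `N`, the kernel is a finite sum of exponentials, hence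
entire in the endpoints, which controls the density up to the edge of its range
(`exists_abs_PcUnf_le`). Cauchy estimates then bound the Taylor coefficients and remainders. Where
`1/N²` exceeds half the polydisc radius, all terms are bounded separately. Each inverse power of the
radius costs `(1+b)^4`, which the decay absorbs (`exists_abs_cutoff_sub_taylor_le`), and integration
over `b` gives the expansion. -/

theorem expI_neg (x : ℝ) : expI (-x) = (starRingEnd ℂ) (expI x) := by
  simp [expI, ← Complex.exp_conj]

theorem sgn_conj (j : Fin 2) : (starRingEnd ℂ) (sgn j) = sgn j := by
  simp [sgn]

theorem pderiv_conj_comp_neg (k : Fin 2) (f : (Fin 2 → ℝ) → ℂ) (a : Fin 2 → ℝ) :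
    pderiv k (fun b => (starRingEnd ℂ) (f (-b))) a = -(starRingEnd ℂ) (pderiv k f (-a)) := by
  have h : ∀ t : ℝ, -(Function.update a k t) = Function.update (-a) k (-t) := by
    intro t; ext i
    rcases eq_or_ne i k with rfl | hi
    · simp
    · simp [hi]
  simp only [pderiv, h]
  have h2 := deriv_comp_neg (fun t : ℝ => (starRingEnd ℂ) (f (Function.update (-a) k t))) (a k)
  have h3 := deriv.star (f := fun t : ℝ => f (Function.update (-a) k t)) (x := -(a k))
  rw [h2, Pi.neg_apply]
  exact congrArg Neg.neg h3

theorem pderiv_neg_fun (k : Fin 2) (f : (Fin 2 → ℝ) → ℂ) (a : Fin 2 → ℝ) :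
    pderiv k (fun b => -f b) a = -pderiv k f a := by
  simp only [pderiv, deriv.fun_neg]

/-- The fields of `X.flip`, read at the reflected endpoints `-a`. -/
def TWFields.reflect (X : TWFields) : TWFields where
  q := fun j a => (starRingEnd ℂ) (X.p j (-a))
  p := fun j a => (starRingEnd ℂ) (X.q j (-a))
  u := fun a => -(starRingEnd ℂ) (X.w (-a))
  v := fun a => -(starRingEnd ℂ) (X.v (-a))
  w := fun a => -(starRingEnd ℂ) (X.u (-a))
  J := fun a => X.J (-a)

/-- Conjugation restores the denominator at `-a` to the one at `a`. The numerator is antisymmetric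
under exchanging `q` with `p`, whence the sign. -/
theorem TWFields.Roff_reflect (X : TWFields) (j k : Fin 2) (a : Fin 2 → ℝ) :
    X.reflect.Roff j k a = -(starRingEnd ℂ) (X.Roff j k (-a)) := by
  simp only [TWFields.Roff, TWFields.reflect, map_div₀, map_sub, map_mul, Pi.neg_apply, expI_neg,
    Complex.conj_conj]
  rw [← neg_div]
  congr 1
  ring

/-- Each equation at `a` is the conjugate of an equation of the original system at `-a`. The chain
rule for `a ↦ -a` supplies a sign, which is matched by the signs in `u`, `v`, `w`, in `R_{jk}` and
in `N`. -/
theorem TWSystem.reflect {N : ℝ} {D : Set (Fin 2 → ℝ)} {X : TWFields} (h : TWSystem N D X) :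
    TWSystem (-N) {a | -a ∈ D} X.reflect := by
  intro a ha
  obtain ⟨⟨hq, hp, hu, hv, hw, hJ, hJ0⟩, h2, h3⟩ := h (-a) ha
  have hconj : ∀ f : (Fin 2 → ℝ) → ℂ, DifferentiableAt ℝ f (-a) →
      DifferentiableAt ℝ (fun b => (starRingEnd ℂ) (f (-b))) a := by
    intro f hf
    have h1 : DifferentiableAt ℝ (fun b : Fin 2 → ℝ => f (-b)) a :=
      DifferentiableAt.comp (g := f) (f := fun b : Fin 2 → ℝ => -b) a hf
        differentiableAt_id.neg
    exact h1.star
  refine ⟨⟨fun j => hconj _ (hp j), fun j => hconj _ (hq j), (hconj _ hw).neg, (hconj _ hv).neg,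
    (hconj _ hu).neg, ?_, hJ0⟩, ?_, ?_⟩
  · exact DifferentiableAt.comp (g := X.J) (f := fun b : Fin 2 → ℝ => -b) a hJ
        differentiableAt_id.neg
  · intro j k hjk
    obtain ⟨e1, e2, e3, e4⟩ := h2 j k hjk
    have e1' := congrArg (starRingEnd ℂ) e1
    have e2' := congrArg (starRingEnd ℂ) e2
    have e3' := congrArg (starRingEnd ℂ) e3
    have e4' := congrArg (starRingEnd ℂ) e4
    rw [TWFields.Roff_reflect]
    simp only [TWFields.reflect, pderiv_conj_comp_neg]
    simp only [map_sub, map_mul, map_add, map_neg, map_div₀, sgn_conj, Complex.conj_I, map_one,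
      Complex.conj_ofReal, Pi.neg_apply, expI_neg, Complex.conj_conj, map_ofNat] at e1' e2' e3' e4'
    push_cast
    refine ⟨?_, ?_, ?_, ?_⟩
    -- The roles of `q` and `p` are exchanged: the equation for `q` comes from the one for `p`, and
    -- conversely.
    · linear_combination e2'
    · linear_combination e1'
    · linear_combination -e4'
    · linear_combination -e3'
  · intro j
    obtain ⟨e1, e2, e3, e4⟩ := h3 j
    have e1' := congrArg (starRingEnd ℂ) e1
    have e2' := congrArg (starRingEnd ℂ) e2
    have e3' := congrArg (starRingEnd ℂ) e3
    have e4' := congrArg (starRingEnd ℂ) e4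
    -- `log J` is real valued, so its partial derivative is fixed by conjugation.
    have hreal : (starRingEnd ℂ) (pderiv j (fun b => ((Real.log (X.J b) : ℝ) : ℂ)) (-a)) =
        pderiv j (fun b => ((Real.log (X.J b) : ℝ) : ℂ)) (-a) := by
      simp only [pderiv]
      have h3 := deriv.star (f := fun t : ℝ =>
        ((Real.log (X.J (Function.update (-a) j t)) : ℝ) : ℂ)) (x := (-a) j)
      simp only [Complex.star_def, Complex.conj_ofReal] at h3
      exact h3.symm
    have hJ' : pderiv j (fun b => ((Real.log (X.reflect.J b) : ℝ) : ℂ)) a =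
        -pderiv j (fun b => ((Real.log (X.J b) : ℝ) : ℂ)) (-a) := by
      rw [← hreal, ← pderiv_conj_comp_neg]
      simp [TWFields.reflect]
    rw [hJ']
    simp only [TWFields.reflect, pderiv_conj_comp_neg, pderiv_neg_fun, TWFields.Rdiag]
    rw [hreal] at e4'
    simp only [TWFields.Rdiag, map_sub, map_mul, map_neg, map_pow, sgn_conj, Complex.conj_I,
      Pi.neg_apply, neg_neg] at e1' e2' e3' e4'
    refine ⟨?_, ?_, ?_, ?_⟩
    · linear_combination e2'
    · linear_combination e1'
    · linear_combination e3'
    · rw [expI_neg]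
      linear_combination -e4'

/-- Only norms of the error are compared, so that the conjugations and global signs in the reflected
fields need no separate treatment. -/
theorem EqUpToFourth.reflect {D : Set (Fin 2 → ℝ)} {f g f' g' : (Fin 2 → ℝ) → ℂ}
    (h : EqUpToFourth D f g)
    (h' : ∀ a, ‖f' a - g' a‖ = ‖f (-a) - g (-a)‖) : EqUpToFourth {a | -a ∈ D} f' g' := by
  have ht : Tendsto (fun a : Fin 2 → ℝ => -a) (nhdsWithin 0 {a | -a ∈ D}) (nhdsWithin 0 D) := by
    refine tendsto_nhdsWithin_of_tendsto_nhds_of_eventually_within _ ?_ ?_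
    · have : Tendsto (fun a : Fin 2 → ℝ => -a) (nhds 0) (nhds 0) := by
        simpa using (continuous_neg (G := Fin 2 → ℝ)).tendsto 0
      exact this.mono_left nhdsWithin_le_nhds
    · exact eventually_mem_nhdsWithin
  have := Asymptotics.IsBigO.comp_tendsto h ht
  refine (this.norm_left.congr (fun a => ?_) fun a => ?_).of_norm_left (f' := fun a => f' a - g' a)
  · exact (h' a).symm
  · simp

theorem TWBoundary.reflect {N : ℝ} {D : Set (Fin 2 → ℝ)} {X : TWFields} (h : TWBoundary N D X) :
    TWBoundary (-N) {a | -a ∈ D} X.reflect := by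
  obtain ⟨hq, hp, hu, hw, hv, hJ⟩ := h
  refine ⟨fun j => (hp j).reflect fun a => ?_, fun j => (hq j).reflect fun a => ?_,
    hw.reflect fun a => ?_, hu.reflect fun a => ?_, hv.reflect fun a => ?_,
    hJ.reflect fun a => ?_⟩
  · rw [← Complex.norm_conj (X.p j (-a) - _)]
    congr 1
    simp only [TWFields.reflect, map_sub, map_add, map_mul, map_neg, Complex.conj_I,
      Complex.conj_ofReal, Pi.neg_apply]
    push_cast; ring
  · rw [← Complex.norm_conj (X.q j (-a) - _)]
    congr 1
    simp only [TWFields.reflect, map_sub, map_mul, Complex.conj_I,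
      Complex.conj_ofReal, Pi.neg_apply]
    push_cast; ring
  · rw [← Complex.norm_conj (X.w (-a) - _), ← norm_neg]
    congr 1
    simp only [TWFields.reflect, map_sub, Complex.conj_ofReal, Pi.neg_apply]
    push_cast; ring
  · rw [← Complex.norm_conj (X.u (-a) - _), ← norm_neg]
    congr 1
    simp only [TWFields.reflect, map_sub, Complex.conj_ofReal, Pi.neg_apply]
    push_cast; ring
  · rw [← Complex.norm_conj (X.v (-a) - _), ← norm_neg]
    congr 1
    simp only [TWFields.reflect, map_sub, Complex.conj_ofReal, Pi.neg_apply]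
    push_cast; ring
  · congr 1
    simp only [TWFields.reflect, Pi.neg_apply]
    push_cast; ring

/-- This is where the sign of `N` becomes a reflection: flipping is pointwise in the unfolded
variables, and a negative scale moves the evaluation point to the opposite side. -/
theorem TWFields.rescale_flip (X : TWFields) (c : ℝ) :
    X.flip.rescale (-c) = (X.rescale c).reflect := by
  simp only [TWFields.rescale, TWFields.flip, TWFields.reflect, smul_neg, neg_smul]

theorem TWFields.flip_flip (X : TWFields) : X.flip.flip = X := by
  simp [TWFields.flip]

/-- Flipping and `N ↦ -N` are involutions, so one implication yields the equivalence. -/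
theorem unfoldedTWSystem_iff_flip (N : ℝ) (D : Set (Fin 2 → ℝ)) (X : TWFields) :
    UnfoldedTWSystem N D X ↔ UnfoldedTWSystem (-N) D X.flip := by
  have key : ∀ (N : ℝ) (X : TWFields), UnfoldedTWSystem N D X →
      UnfoldedTWSystem (-N) D X.flip := by
    intro N X h
    have := TWSystem.reflect h
    simpa only [UnfoldedTWSystem, neg_div, X.rescale_flip, Set.mem_ofPred_eq, smul_neg, neg_smul] using this
  refine ⟨key N X, fun h => ?_⟩
  simpa [TWFields.flip_flip] using key _ _ h

theorem unfoldedTWBoundary_iff_flip (N : ℝ) (D : Set (Fin 2 → ℝ)) (X : TWFields) :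
    UnfoldedTWBoundary N D X ↔ UnfoldedTWBoundary (-N) D X.flip := by
  have key : ∀ (N : ℝ) (X : TWFields), UnfoldedTWBoundary N D X →
      UnfoldedTWBoundary (-N) D X.flip := by
    intro N X h
    have := TWBoundary.reflect h
    simpa only [UnfoldedTWBoundary, neg_div, X.rescale_flip, Set.mem_ofPred_eq, smul_neg, neg_smul] using this
  refine ⟨key N X, fun h => ?_⟩
  simpa [TWFields.flip_flip] using key _ _ h

/-! ### Determinants of matrices -/

/-- A non-injective `f` repeats a row and contributes zero. The injective ones are grouped by their
image, and each `k`-subset is the image of `k!` of them, all giving the same principal minor. -/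
theorem sum_det_submatrix_fun {R n : Type*} [CommRing R] [Fintype n] [DecidableEq n]
    (M : Matrix n n R) (k : ℕ) :
    ∑ f : Fin k → n, (M.submatrix f f).det =
      (k.factorial : R) * ∑ s ∈ Finset.univ.powersetCard k,
        (M.submatrix (Subtype.val : s → n) (Subtype.val : s → n)).det := by
  classical
  have h0 : ∑ f : Fin k → n, (M.submatrix f f).det =
      ∑ f ∈ Finset.univ.filter (fun f : Fin k → n => Function.Injective f),
        (M.submatrix f f).det := by
    rw [Finset.sum_filter]
    refine Finset.sum_congr rfl fun f _ => ?_
    split_ifs with hf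
    · rfl
    · obtain ⟨i, j, hij, hne⟩ : ∃ i j, f i = f j ∧ i ≠ j := by
        simpa [Function.Injective] using hf
      refine Matrix.det_zero_of_row_eq hne ?_
      ext l
      simp [hij]
  rw [h0, ← Finset.sum_fiberwise_of_maps_to (t := Finset.univ.powersetCard k)
    (g := fun f : Fin k → n => Finset.univ.image f), Finset.mul_sum]
  · refine Finset.sum_congr rfl fun s hs => ?_
    have hcard : s.card = k := (Finset.mem_powersetCard.mp hs).2
    have hterm : ∀ f ∈ (Finset.univ.filter (fun f : Fin k → n => Function.Injective f)).filter
        (fun f => Finset.univ.image f = s),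
        (M.submatrix f f).det =
          (M.submatrix (Subtype.val : s → n) (Subtype.val : s → n)).det := by
      intro f hf
      simp only [Finset.mem_filter, Finset.mem_univ, true_and] at hf
      have hmem : ∀ i, f i ∈ s := fun i => by
        rw [← hf.2]; exact Finset.mem_image_of_mem _ (Finset.mem_univ i)
      have hbij : Function.Bijective (fun i => (⟨f i, hmem i⟩ : s)) := by
        rw [Fintype.bijective_iff_injective_and_card]
        exact ⟨fun i j h => hf.1 (congrArg Subtype.val h), by simp [hcard]⟩
      have := Matrix.det_submatrix_equiv_self (Equiv.ofBijective _ hbij)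
        (M.submatrix (Subtype.val : s → n) (Subtype.val : s → n))
      rw [← this]
      rfl
    rw [Finset.sum_congr rfl hterm, Finset.sum_const, nsmul_eq_mul]
    congr 2
    have : Fintype.card (Fin k ≃ s) = k.factorial := by
      rw [Fintype.card_equiv (Fintype.equivOfCardEq (by simp [hcard]))]
      simp
    rw [← this, ← Finset.card_univ]
    symm
    refine Finset.card_bij (fun e _ => fun i => (e i : n)) ?_ ?_ ?_
    · intro e _
      simp only [Finset.mem_filter, Finset.mem_univ, true_and]
      refine ⟨Subtype.val_injective.comp e.injective, ?_⟩
      ext x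
      simp only [Finset.mem_image, Finset.mem_univ, true_and]
      exact ⟨fun ⟨i, hi⟩ => hi ▸ (e i).2, fun hx => ⟨e.symm ⟨x, hx⟩, by simp⟩⟩
    · intro e _ e' _ h
      ext i
      exact congrFun h i
    · intro f hf
      simp only [Finset.mem_filter, Finset.mem_univ, true_and] at hf
      have hmem : ∀ i, f i ∈ s := fun i => by
        rw [← hf.2]; exact Finset.mem_image_of_mem _ (Finset.mem_univ i)
      have hbij : Function.Bijective (fun i => (⟨f i, hmem i⟩ : s)) := by
        rw [Fintype.bijective_iff_injective_and_card]
        exact ⟨fun i j h => hf.1 (congrArg Subtype.val h), by simp [hcard]⟩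
      exact ⟨Equiv.ofBijective _ hbij, Finset.mem_univ _, rfl⟩
  · intro f hf
    simp only [Finset.mem_filter, Finset.mem_univ, true_and] at hf
    simp [Finset.mem_powersetCard, Finset.card_image_of_injective _ hf]

/-- The Fredholm expansion of a finite determinant. -/
theorem hasSum_det_one_sub {n : Type*} [Fintype n] [DecidableEq n] (M : Matrix n n ℂ) :
    HasSum (fun k : ℕ => (-1 : ℂ) ^ k / (k.factorial : ℂ) *
      ∑ f : Fin k → n, (M.submatrix f f).det) (1 - M).det := by
  -- The reversed characteristic polynomial is `det (1 - X M)`. Its coefficients are signed sums of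
  -- principal minors, which the preceding count turns into sums over all index maps.
  have h1 : (1 - M).det = M.charpolyRev.eval 1 := by
    rw [Matrix.charpolyRev, ← Polynomial.coe_evalRingHom, RingHom.map_det]
    congr 1
    ext i j
    rcases eq_or_ne i j with rfl | hij
    · simp
    · simp [Matrix.one_apply_ne hij]
  have h2 : ∀ k, M.charpolyRev.coeff k = (-1 : ℂ) ^ k / (k.factorial : ℂ) *
      ∑ f : Fin k → n, (M.submatrix f f).det := by
    intro k
    have h3 : M.charpolyRev = det (1 + (Polynomial.X : Polynomial ℂ) • (-M).map Polynomial.C) := by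
      simp only [Matrix.charpolyRev, sub_eq_add_neg]
      congr 2
      rw [Matrix.map_neg Polynomial.C (map_neg Polynomial.C) M, smul_neg]
    rw [h3, coeff_det_one_add_X_smul_eq_sum_minors, sum_det_submatrix_fun]
    have hk : (k.factorial : ℂ) ≠ 0 := by exact_mod_cast k.factorial_ne_zero
    rw [div_mul_eq_mul_div, mul_left_comm, mul_div_cancel_left₀ _ hk, Finset.mul_sum]
    refine Finset.sum_congr rfl fun s hs => ?_
    rw [Matrix.submatrix_neg]
    simp [Matrix.det_neg, (Finset.mem_powersetCard.mp hs).2]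
  rw [h1, Polynomial.eval_eq_sum_range]
  simp only [one_pow, mul_one, ← h2]
  refine hasSum_sum_of_ne_finset_zero fun k hk => ?_
  refine Polynomial.coeff_eq_zero_of_natDegree_lt ?_
  simpa using hk

open scoped ComplexOrder in
/-- `|det B|² ≤ exp (‖B‖² - n)` for the Frobenius norm of an `n × n` matrix. -/
theorem normSq_det_le_exp {n : Type*} [Fintype n] [DecidableEq n] (B : Matrix n n ℂ) :
    ‖B.det‖ ^ 2 ≤ Real.exp ((Bᴴ * B).trace.re - Fintype.card n) := by
  have hA := Matrix.isHermitian_conjTranspose_mul_self B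
  have hps := Matrix.posSemidef_conjTranspose_mul_self B
  have h1 : ((‖B.det‖ ^ 2 : ℝ) : ℂ) = (Bᴴ * B).det := by
    rw [Matrix.det_mul, Matrix.det_conjTranspose]
    rw [Complex.star_def, Complex.conj_mul']; norm_cast
  have h2 : ‖B.det‖ ^ 2 = ∏ i, hA.eigenvalues i := by
    have := hA.det_eq_prod_eigenvalues
    rw [← h1] at this
    simp only [Complex.coe_algebraMap] at this
    exact_mod_cast this
  have h3 : (Bᴴ * B).trace.re = ∑ i, hA.eigenvalues i := by
    have := hA.trace_eq_sum_eigenvalues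
    rw [this]
    simp
  rw [h2, h3]
  -- Each eigenvalue `λ ≥ 0` of `Bᴴ B` satisfies `λ ≤ exp (λ - 1)`; the product of these bounds is
  -- an exponential of the trace.
  calc ∏ i, hA.eigenvalues i ≤ ∏ i, Real.exp (hA.eigenvalues i - 1) := by
        refine Finset.prod_le_prod (fun i _ => hps.eigenvalues_nonneg i) fun i _ => ?_
        have := Real.add_one_le_exp (hA.eigenvalues i - 1)
        linarith
    _ = _ := by
        rw [← Real.exp_sum]
        simp [Finset.sum_sub_distrib]

theorem trace_conjTranspose_mul_self_re {m n : Type*} [Fintype m] [Fintype n]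
    (B : Matrix m n ℂ) : (Bᴴ * B).trace.re = ∑ j, ∑ i, ‖B i j‖ ^ 2 := by
  simp only [Matrix.trace, Matrix.diag_apply, Matrix.mul_apply, Matrix.conjTranspose_apply,
    Complex.re_sum]
  refine Finset.sum_congr rfl fun j _ => Finset.sum_congr rfl fun i _ => ?_
  have : star (B i j) * B i j = ((‖B i j‖ ^ 2 : ℝ) : ℂ) := by
    rw [Complex.star_def, Complex.conj_mul']; norm_cast
  rw [this, Complex.ofReal_re]

/-- Hadamard's inequality for rows bounded in the supremum norm. -/
theorem norm_det_le_prod {n : ℕ} (A : Matrix (Fin n) (Fin n) ℂ) (c : Fin n → ℝ)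
    (hA : ∀ i j, ‖A i j‖ ≤ c i) : ‖A.det‖ ≤ (Real.sqrt n) ^ n * ∏ i, c i := by
  rcases Nat.eq_zero_or_pos n with rfl | hn
  · simp
  by_cases hc : ∃ i, c i = 0
  · obtain ⟨i, hi⟩ := hc
    have : A.det = 0 := Matrix.det_eq_zero_of_row_eq_zero i fun j =>
      norm_le_zero_iff.mp (hi ▸ hA i j)
    rw [this, Finset.prod_eq_zero (Finset.mem_univ i) hi]
    simp
  push Not at hc
  have hpos : ∀ i, 0 < c i := fun i =>
    lt_of_le_of_ne ((norm_nonneg _).trans (hA i ⟨0, hn⟩)) (Ne.symm (hc i))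
  have hs : 0 < Real.sqrt n := Real.sqrt_pos.mpr (by exact_mod_cast hn)
  -- Dividing row `i` by `√n c_i` makes every entry at most `1/√n`, so the squared Frobenius norm is
  -- at most `n` and the exponential bound gives `|det A'| ≤ 1`.
  set A' : Matrix (Fin n) (Fin n) ℂ := Matrix.of fun i j => ((Real.sqrt n * c i : ℝ) : ℂ)⁻¹ * A i j
  have hne : ∀ i, ((Real.sqrt n * c i : ℝ) : ℂ) ≠ 0 := fun i => by
    exact_mod_cast (mul_pos hs (hpos i)).ne'
  have hAA : A = Matrix.of fun i j => ((Real.sqrt n * c i : ℝ) : ℂ) * A' i j := by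
    ext i j
    simp only [A', Matrix.of_apply]
    rw [mul_inv_cancel_left₀ (hne i)]
  have hdet : ‖A'.det‖ ^ 2 ≤ 1 := by
    refine (normSq_det_le_exp A').trans ?_
    rw [Real.exp_le_one_iff, trace_conjTranspose_mul_self_re, sub_nonpos]
    calc ∑ j, ∑ i, ‖A' i j‖ ^ 2 ≤ ∑ j : Fin n, ∑ i : Fin n, (1 / n : ℝ) := by
          refine Finset.sum_le_sum fun j _ => Finset.sum_le_sum fun i _ => ?_
          simp only [A', Matrix.of_apply, norm_mul, norm_inv, Complex.norm_real, Real.norm_eq_abs,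
            abs_of_pos hs, abs_of_pos (hpos i), mul_pow, inv_pow]
          rw [Real.sq_sqrt (by positivity), mul_inv, mul_assoc, one_div]
          refine mul_le_of_le_one_right (by positivity) ?_
          rw [inv_mul_le_iff₀ (by have := hpos i; positivity), mul_one]
          exact pow_le_pow_left₀ (norm_nonneg _) (hA i j) 2
      _ = Fintype.card (Fin n) := by
          simp
          field_simp
  have hdet' : ‖A'.det‖ ≤ 1 := by
    have := norm_nonneg A'.det
    nlinarith
  rw [hAA, Matrix.det_mul_column, norm_mul, norm_prod]
  have : ∏ i, ‖((Real.sqrt n * c i : ℝ) : ℂ)‖ = (Real.sqrt n) ^ n * ∏ i, c i := by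
    simp only [Complex.norm_real, Real.norm_eq_abs]
    rw [Finset.prod_congr rfl fun i _ => abs_of_pos (mul_pos hs (hpos i)),
      Finset.prod_mul_distrib]
    simp
  rw [this]
  exact mul_le_of_le_one_right (mul_nonneg (by positivity) (Finset.prod_nonneg fun i _ => (hpos i).le)) hdet'

/-- A determinant `det (1 - K)` that is nearly degenerate along the columns of `F`. -/
theorem normSq_det_mul_le {n m : Type*} [Fintype n] [DecidableEq n] [Fintype m] [DecidableEq m]
    (K : Matrix n n ℂ) (F : Matrix n m ℂ) (s : ℝ) :
    ‖(1 - K).det‖ ^ 2 * ‖(1 + (s : ℂ) • (Fᴴ * F)).det‖ ^ 2 ≤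
      Real.exp ((Kᴴ * K).trace.re - 2 * K.trace.re +
        2 * s * ((F - K * F)ᴴ * (F - K * F)).trace.re +
        s ^ 2 * (((F - K * F)ᴴ * (F - K * F)) * (Fᴴ * F)).trace.re) := by
  -- Sylvester's identity moves the small Gram determinant to size `n`, where it multiplies `det (1
  -- - K)`. The exponential bound is then applied to the product matrix `(1 - K)(1 + s F Fᴴ)`.
  have h1 : (1 + (s : ℂ) • (Fᴴ * F)).det = (1 + (s : ℂ) • (F * Fᴴ)).det := by
    have := Matrix.det_one_add_mul_comm Fᴴ ((s : ℂ) • F)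
    rw [Matrix.mul_smul, Matrix.smul_mul] at this
    exact this
  rw [h1, ← mul_pow, ← norm_mul, ← Matrix.det_mul]
  refine (normSq_det_le_exp _).trans (Real.exp_le_exp.mpr (le_of_eq ?_))
  set B := 1 - K with hB
  have hBF : F - K * F = B * F := by rw [hB, Matrix.sub_mul, Matrix.one_mul]
  rw [hBF]
  have hexp : (B * (1 + (s : ℂ) • (F * Fᴴ)))ᴴ * (B * (1 + (s : ℂ) • (F * Fᴴ))) =
      Bᴴ * B + (s : ℂ) • (Bᴴ * B * F * Fᴴ) + (s : ℂ) • (F * Fᴴ * Bᴴ * B)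
        + ((s : ℂ) ^ 2) • (F * (Fᴴ * Bᴴ * B * F * Fᴴ)) := by
    simp only [Matrix.conjTranspose_mul, Matrix.conjTranspose_add,
      Matrix.conjTranspose_smul, Matrix.conjTranspose_conjTranspose, Matrix.mul_add, Matrix.add_mul,
      Matrix.mul_one, Matrix.smul_mul, Matrix.mul_smul, Matrix.mul_assoc,
      Complex.star_def, Complex.conj_ofReal, smul_add, smul_smul, sq]
    abel
  have t1 : (Bᴴ * B * F * Fᴴ).trace = ((B * F)ᴴ * (B * F)).trace := by
    rw [Matrix.trace_mul_comm, Matrix.conjTranspose_mul]; simp only [Matrix.mul_assoc]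
  have t2 : (F * Fᴴ * Bᴴ * B).trace = ((B * F)ᴴ * (B * F)).trace := by
    rw [Matrix.conjTranspose_mul, Matrix.mul_assoc, Matrix.mul_assoc, Matrix.trace_mul_comm]
    simp only [Matrix.mul_assoc]
  have t3 : (F * (Fᴴ * Bᴴ * B * F * Fᴴ)).trace = (((B * F)ᴴ * (B * F)) * (Fᴴ * F)).trace := by
    rw [Matrix.trace_mul_comm, Matrix.conjTranspose_mul]
    simp only [Matrix.mul_assoc]
  have t4 : (Bᴴ * B).trace.re = Fintype.card n + ((Kᴴ * K).trace.re - 2 * K.trace.re) := by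
    rw [hB]
    simp only [Matrix.conjTranspose_sub, Matrix.conjTranspose_one, Matrix.sub_mul, Matrix.mul_sub,
      Matrix.one_mul, Matrix.mul_one, Matrix.trace_sub, Matrix.trace_one,
      Matrix.trace_conjTranspose, Complex.sub_re, Complex.natCast_re, Complex.star_def,
      Complex.conj_re]
    ring
  rw [hexp]
  simp only [Matrix.trace_add, Matrix.trace_smul, t1, t2, t3, Complex.add_re, t4, smul_eq_mul,
    Complex.re_ofReal_mul]
  have : ((s : ℂ) ^ 2) = ((s ^ 2 : ℝ) : ℂ) := by push_cast; rfl
  rw [this, Complex.re_ofReal_mul]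
  ring

noncomputable section

/-! ### The Fredholm determinant of a continuous kernel on the unit square -/

/-- Continuous kernels on the unit square. -/
abbrev KernelSpace := C(unitInterval × unitInterval, ℂ)

theorem continuous_det_kernel {n : ℕ} (k : Fin n → KernelSpace) :
    Continuous fun x : Fin n → unitInterval =>
      (Matrix.of fun i j : Fin n => k i (x i, x j)).det := by
  refine Continuous.matrix_det ?_
  refine continuous_matrix fun i j => ?_
  simp only [Matrix.of_apply]
  fun_prop

theorem integrable_det_kernel {n : ℕ} (k : Fin n → KernelSpace) :
    Integrable fun x : Fin n → unitInterval =>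
      (Matrix.of fun i j : Fin n => k i (x i, x j)).det :=
  (continuous_det_kernel k).integrable_of_hasCompactSupport
    (HasCompactSupport.of_compactSpace _)

/-- The polarized `n`-th term of the Fredholm series. -/
def fredholmMultilinear (n : ℕ) :
    MultilinearMap ℂ (fun _ : Fin n => KernelSpace) ℂ where
  toFun k := (-1 : ℂ) ^ n / (n.factorial : ℂ) * ∫ x : Fin n → unitInterval,
    (Matrix.of fun i j : Fin n => k i (x i, x j)).det
  map_update_add' := by
    intro inst k i u v
    -- The field is required for an arbitrary decidability instance; it is identified with the
    -- standard one before rows are updated.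
    obtain rfl : inst = instDecidableEqFin n := Subsingleton.elim _ _
    have h : ∀ (w : KernelSpace) (x : Fin n → unitInterval),
        (Matrix.of fun a b : Fin n => Function.update k i w a (x a, x b)) =
        (Matrix.of fun a b : Fin n => k a (x a, x b)).updateRow i (fun b => w (x i, x b)) := by
      intro w x
      ext a b
      rcases eq_or_ne a i with rfl | ha
      · simp
      · simp [Matrix.updateRow_ne ha, Function.update_of_ne ha]
    have hd : ∀ x : Fin n → unitInterval,
        (Matrix.of fun a b : Fin n => Function.update k i (u + v) a (x a, x b)).det =
        (Matrix.of fun a b : Fin n => Function.update k i u a (x a, x b)).det +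
        (Matrix.of fun a b : Fin n => Function.update k i v a (x a, x b)).det := by
      intro x
      rw [h, h, h, ← Matrix.det_updateRow_add]
      rfl
    simp only [hd]
    rw [integral_add (integrable_det_kernel _) (integrable_det_kernel _), mul_add]
  map_update_smul' := by
    intro inst k i c u
    obtain rfl : inst = instDecidableEqFin n := Subsingleton.elim _ _
    have h : ∀ (w : KernelSpace) (x : Fin n → unitInterval),
        (Matrix.of fun a b : Fin n => Function.update k i w a (x a, x b)) =
        (Matrix.of fun a b : Fin n => k a (x a, x b)).updateRow i (fun b => w (x i, x b)) := by
      intro w x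
      ext a b
      rcases eq_or_ne a i with rfl | ha
      · simp
      · simp [Matrix.updateRow_ne ha, Function.update_of_ne ha]
    have hd : ∀ x : Fin n → unitInterval,
        (Matrix.of fun a b : Fin n => Function.update k i (c • u) a (x a, x b)).det =
        c * (Matrix.of fun a b : Fin n => Function.update k i u a (x a, x b)).det := by
      intro x
      rw [h, h, ← Matrix.det_updateRow_smul]
      rfl
    simp only [hd]
    rw [integral_const_mul, smul_eq_mul]
    ring

theorem norm_integral_det_le {n : ℕ} (k : Fin n → KernelSpace) :
    ‖∫ x : Fin n → unitInterval, (Matrix.of fun i j : Fin n => k i (x i, x j)).det‖ ≤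
      (Real.sqrt n) ^ n * ∏ i, ‖k i‖ := by
  refine (norm_integral_le_of_norm_le_const (C := (Real.sqrt n) ^ n * ∏ i, ‖k i‖)
    (Eventually.of_forall fun x => ?_)).trans (by simp)
  exact norm_det_le_prod _ _ fun i j => (k i).norm_coe_le_norm _

theorem norm_fredholmMultilinear_le {n : ℕ} (k : Fin n → KernelSpace) :
    ‖fredholmMultilinear n k‖ ≤ (Real.sqrt n) ^ n / (n.factorial : ℝ) * ∏ i, ‖k i‖ := by
  have := norm_integral_det_le k
  simp only [fredholmMultilinear, MultilinearMap.coe_mk, norm_mul, norm_div, norm_pow, norm_neg,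
    norm_one, one_pow, Complex.norm_natCast]
  rw [div_mul_eq_mul_div, div_mul_eq_mul_div, one_mul]
  gcongr

/-- The Fredholm series as a formal power series on the space of kernels. -/
def fredholmSeries : FormalMultilinearSeries ℂ KernelSpace ℂ := fun n =>
  (fredholmMultilinear n).mkContinuous _ norm_fredholmMultilinear_le

/-- From `n^n / n! ≤ e^n` one gets `√n^n ≤ e^n √(n!)`. Half of the factorial therefore survives
Hadamard's loss and beats every geometric growth. -/
theorem summable_sqrt_pow_div_factorial (r : ℝ) (hr : 0 ≤ r) :
    Summable fun n : ℕ => (Real.sqrt n) ^ n / (n.factorial : ℝ) * r ^ n := by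
  have hmain : Summable fun n : ℕ => (r * Real.exp 1 + 1) ^ n / Real.sqrt (n.factorial : ℝ) := by
    have hC : 0 < r * Real.exp 1 + 1 := by positivity
    refine summable_of_ratio_test_tendsto_lt_one (l := 0) zero_lt_one
      (Eventually.of_forall fun n => ?_) ?_
    · have : (0 : ℝ) < n.factorial := by exact_mod_cast n.factorial_pos
      positivity
    · have h1 : ∀ n : ℕ, ‖(r * Real.exp 1 + 1) ^ (n + 1) / Real.sqrt ((n + 1).factorial : ℝ)‖ /
          ‖(r * Real.exp 1 + 1) ^ n / Real.sqrt (n.factorial : ℝ)‖ =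
          (r * Real.exp 1 + 1) / Real.sqrt ((n + 1 : ℕ) : ℝ) := by
        intro n
        have hf : (0 : ℝ) < n.factorial := by exact_mod_cast n.factorial_pos
        have h2 : 0 < Real.sqrt (n.factorial : ℝ) := Real.sqrt_pos.mpr hf
        have h3 : 0 < Real.sqrt ((n + 1 : ℕ) : ℝ) := Real.sqrt_pos.mpr (by positivity)
        rw [Nat.factorial_succ, Nat.cast_mul, Real.sqrt_mul (by positivity),
          Real.norm_of_nonneg (by positivity), Real.norm_of_nonneg (by positivity)]
        field_simp
        ring
      simp only [h1]
      refine Tendsto.div_atTop tendsto_const_nhds ?_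
      exact (Real.tendsto_sqrt_atTop.comp tendsto_natCast_atTop_atTop).comp (tendsto_add_atTop_nat 1)
  refine Summable.of_nonneg_of_le (fun n => by positivity) (fun n => ?_) hmain
  have hf : (0 : ℝ) < n.factorial := by exact_mod_cast n.factorial_pos
  have h2 : 0 < Real.sqrt (n.factorial : ℝ) := Real.sqrt_pos.mpr hf
  have h3 : (Real.sqrt n) ^ n ≤ Real.exp 1 ^ n * Real.sqrt (n.factorial : ℝ) := by
    refine (sq_le_sq₀ (by positivity) (by positivity)).mp ?_
    rw [← pow_mul, mul_comm n 2, pow_mul, Real.sq_sqrt (by positivity), mul_pow,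
      Real.sq_sqrt hf.le]
    have := Real.pow_div_factorial_le_exp (x := (n : ℝ)) (by positivity) n
    rw [div_le_iff₀ hf] at this
    have h4 : Real.exp n ≤ (Real.exp 1 ^ n) ^ 2 := by
      rw [← Real.exp_nat_mul, mul_one, sq]
      exact le_mul_of_one_le_left (Real.exp_pos _).le (Real.one_le_exp (by positivity))
    nlinarith
  have h5 : (n.factorial : ℝ) = Real.sqrt n.factorial * Real.sqrt n.factorial :=
    (Real.mul_self_sqrt hf.le).symm
  rw [div_mul_eq_mul_div, div_le_div_iff₀ hf h2]
  calc (Real.sqrt n) ^ n * r ^ n * Real.sqrt n.factorial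
      ≤ (Real.exp 1 ^ n * Real.sqrt (n.factorial : ℝ)) * r ^ n * Real.sqrt n.factorial := by gcongr
    _ = (r * Real.exp 1) ^ n * n.factorial := by
        rw [mul_pow]; nth_rewrite 3 [h5]; ring
    _ ≤ _ := by gcongr; linarith

theorem fredholmSeries_radius : fredholmSeries.radius = ⊤ := by
  refine FormalMultilinearSeries.radius_eq_top_of_summable_norm _ fun r => ?_
  refine Summable.of_nonneg_of_le (fun n => by positivity) (fun n => ?_)
    (summable_sqrt_pow_div_factorial r r.2)
  gcongr
  exact MultilinearMap.mkContinuous_norm_le _ (by positivity) _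

/-- The Fredholm determinant of a continuous kernel on the unit square. -/
def fredholmC (k : KernelSpace) : ℂ :=
  ∑' n : ℕ, (-1 : ℂ) ^ n / (n.factorial : ℂ) * ∫ x : Fin n → unitInterval,
    (Matrix.of fun i j : Fin n => k (x i, x j)).det

/-- The series is a power series in the kernel itself, with infinite radius. All later analyticity
is obtained by composing with analytic families of kernels. -/
theorem analyticAt_fredholmC (k : KernelSpace) : AnalyticAt ℂ fredholmC k := by
  have h : fredholmC = fredholmSeries.sum := by
    ext k
    rfl
  rw [h]
  have := fredholmSeries.hasFPowerSeriesOnBall (by rw [fredholmSeries_radius]; exact ENNReal.zero_lt_top)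
  refine this.analyticAt_of_mem ?_
  rw [fredholmSeries_radius]
  simp [Metric.eball]

/-! ### Discretization -/

/-- The `i`-th left endpoint of the partition of the unit interval into `n + 1` intervals. -/
def gridPt (n : ℕ) (i : Fin (n + 1)) : unitInterval :=
  ⟨(i : ℝ) / ((n + 1 : ℕ) : ℝ), by positivity, by
    rw [div_le_one (by positivity)]; exact_mod_cast i.2.le⟩

/-- The index of the interval of the partition that contains a given point. -/
def gridIdx (n : ℕ) (x : unitInterval) : Fin (n + 1) := Fin.ofNat (n + 1) ⌊((n + 1 : ℕ) : ℝ) * x⌋₊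

theorem measurable_gridIdx (n : ℕ) : Measurable (gridIdx n) := by
  have h1 : Measurable fun x : unitInterval => ⌊((n + 1 : ℕ) : ℝ) * x⌋₊ := by fun_prop
  exact (measurable_of_countable (Fin.ofNat (n + 1))).comp h1

theorem gridIdx_val {n : ℕ} {x : unitInterval} (hx : (x : ℝ) < 1) :
    ((gridIdx n x : Fin (n + 1)) : ℕ) = ⌊((n + 1 : ℕ) : ℝ) * x⌋₊ := by
  simp only [gridIdx, Fin.val_ofNat]
  refine Nat.mod_eq_of_lt ?_
  rw [Nat.floor_lt (mul_nonneg (by positivity) x.2.1)]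
  exact mul_lt_of_lt_one_right (by positivity) hx

theorem ae_lt_one : ∀ᵐ x : unitInterval, (x : ℝ) < 1 := by
  have : ∀ᵐ x : unitInterval, x ≠ 1 := by
    simp [ae_iff]
  filter_upwards [this] with x hx
  exact lt_of_le_of_ne x.2.2 fun h => hx (Subtype.ext h)

theorem volume_gridIdx_preimage (n : ℕ) (i : Fin (n + 1)) :
    (volume : Measure unitInterval) (gridIdx n ⁻¹' {i}) = ((n + 1 : ℕ) : ENNReal)⁻¹ := by
  have hn : (0 : ℝ) < ((n + 1 : ℕ) : ℝ) := by positivity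
  have hi : ((i : ℕ) : ℝ) + 1 ≤ ((n + 1 : ℕ) : ℝ) := by exact_mod_cast i.2
  let y : unitInterval := ⟨((i : ℕ) + 1 : ℝ) / ((n + 1 : ℕ) : ℝ), by positivity, by
    rw [div_le_one hn]; exact hi⟩
  -- Equality holds only almost everywhere: at `x = 1` the index wraps around to `0`.
  have h : (gridIdx n ⁻¹' {i} : Set unitInterval) =ᵐ[volume] Set.Ico (gridPt n i) y := by
    filter_upwards [ae_lt_one] with x hx
    refine propext ?_
    change gridIdx n x = i ↔ x ∈ Set.Ico (gridPt n i) y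
    rw [Fin.ext_iff, gridIdx_val hx, Nat.floor_eq_iff (mul_nonneg hn.le x.2.1)]
    simp only [Set.mem_Ico, ← Subtype.coe_le_coe, ← Subtype.coe_lt_coe, gridPt, y]
    rw [div_le_iff₀ hn, lt_div_iff₀ hn, mul_comm (x : ℝ)]
  rw [measure_congr h, unitInterval.volume_Ico]
  simp only [gridPt, y]
  rw [← sub_div, add_sub_cancel_left, one_div, ENNReal.ofReal_inv_of_pos hn, ENNReal.ofReal_natCast]

/-- The normalized counting measure on `n + 1` points. -/
def gridMeasure (n : ℕ) : Measure (Fin (n + 1)) := (volume : Measure unitInterval).map (gridIdx n)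

instance (n : ℕ) : IsProbabilityMeasure (gridMeasure n) :=
  Measure.isProbabilityMeasure_map (measurable_gridIdx n).aemeasurable

theorem gridMeasure_singleton (n : ℕ) (i : Fin (n + 1)) :
    gridMeasure n {i} = ((n + 1 : ℕ) : ENNReal)⁻¹ := by
  rw [gridMeasure, Measure.map_apply (measurable_gridIdx n) (measurableSet_singleton i),
    volume_gridIdx_preimage]

/-- Writing a grid average as an integral of a step function makes Riemann sums accessible to
dominated convergence. -/
theorem integral_comp_gridIdx (n m : ℕ) (g : (Fin m → Fin (n + 1)) → ℂ) :
    ∫ x : Fin m → unitInterval, g (fun i => gridIdx n (x i)) =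
      ((n + 1 : ℕ) : ℂ)⁻¹ ^ m * ∑ f : Fin m → Fin (n + 1), g f := by
  have hmp : MeasurePreserving (fun (x : Fin m → unitInterval) i => gridIdx n (x i))
      volume (Measure.pi fun _ => gridMeasure n) :=
    measurePreserving_pi (fun _ => (volume : Measure unitInterval)) (fun _ => gridMeasure n)
      fun _ => ⟨measurable_gridIdx n, rfl⟩
  have h1 : ∫ x : Fin m → unitInterval, g (fun i => gridIdx n (x i)) =
      ∫ f, g f ∂(Measure.pi fun _ => gridMeasure n) := by
    rw [← hmp.map_eq, integral_map hmp.measurable.aemeasurable]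
    exact (measurable_of_finite g).aestronglyMeasurable
  rw [h1, integral_fintype .of_finite, Finset.mul_sum]
  refine Finset.sum_congr rfl fun f _ => ?_
  rw [Measure.real, Measure.pi_singleton]
  simp only [gridMeasure_singleton, Finset.prod_const, Finset.card_univ, Fintype.card_fin,
    ENNReal.toReal_pow, ENNReal.toReal_inv, ENNReal.toReal_natCast, Complex.real_smul]
  push_cast
  rfl

theorem integral_comp_gridIdx_one (n : ℕ) (g : Fin (n + 1) → ℂ) :
    ∫ x : unitInterval, g (gridIdx n x) = ((n + 1 : ℕ) : ℂ)⁻¹ * ∑ i, g i := by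
  have h1 : ∫ x : unitInterval, g (gridIdx n x) = ∫ f, g f ∂(gridMeasure n) := by
    rw [gridMeasure, integral_map (measurable_gridIdx n).aemeasurable]
    exact (measurable_of_finite g).aestronglyMeasurable
  rw [h1, integral_fintype .of_finite, Finset.mul_sum]
  refine Finset.sum_congr rfl fun f _ => ?_
  rw [Measure.real, gridMeasure_singleton]
  simp only [ENNReal.toReal_inv, ENNReal.toReal_natCast, Complex.real_smul]
  push_cast
  rfl

/-- The left endpoint of the interval of the partition that contains `x`. -/
def gridRound (n : ℕ) (x : unitInterval) : unitInterval := gridPt n (gridIdx n x)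

theorem tendsto_gridRound {x : unitInterval} (hx : (x : ℝ) < 1) :
    Tendsto (fun n => gridRound n x) atTop (𝓝 x) := by
  rw [tendsto_subtype_rng]
  have h1 : Tendsto (fun n : ℕ => (⌊(x : ℝ) * ((n + 1 : ℕ) : ℝ)⌋₊ : ℝ) / ((n + 1 : ℕ) : ℝ))
      atTop (𝓝 (x : ℝ)) :=
    (tendsto_nat_floor_mul_div_atTop (R := ℝ) x.2.1).comp
      (tendsto_natCast_atTop_atTop.comp (tendsto_add_atTop_nat 1))
  refine h1.congr fun n => ?_
  simp only [gridRound, gridPt]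
  rw [gridIdx_val hx, mul_comm]

/-- Riemann sums of uniformly bounded functions. -/
theorem tendsto_average_grid {g : ℕ → unitInterval → ℂ} {g' : unitInterval → ℂ} {C : ℝ}
    (hC : ∀ n x, ‖g n x‖ ≤ C)
    (hg : ∀ᵐ x : unitInterval, Tendsto (fun n => g n (gridRound n x)) atTop (𝓝 (g' x))) :
    Tendsto (fun n => ((n + 1 : ℕ) : ℂ)⁻¹ * ∑ i, g n (gridPt n i)) atTop
      (𝓝 (∫ x, g' x)) := by
  simp only [← integral_comp_gridIdx_one]
  refine tendsto_integral_of_dominated_convergence (fun _ => C) (fun n => ?_)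
    (integrable_const C) (fun n => Eventually.of_forall fun x => hC n _) hg
  exact ((measurable_of_finite fun i => g n (gridPt n i)).comp
    (measurable_gridIdx n)).aestronglyMeasurable

/-- The matrix of a discretized kernel. -/
def gridMatrix (n : ℕ) (k : KernelSpace) : Matrix (Fin (n + 1)) (Fin (n + 1)) ℂ :=
  Matrix.of fun i j => ((n + 1 : ℕ) : ℂ)⁻¹ * k (gridPt n i, gridPt n j)

theorem ae_lt_one_pi (m : ℕ) : ∀ᵐ x : Fin m → unitInterval, ∀ i, ((x i : unitInterval) : ℝ) < 1 := by
  rw [ae_all_iff]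
  intro i
  exact (measurePreserving_eval (fun _ : Fin m => (volume : Measure unitInterval)) i).quasiMeasurePreserving.ae
    ae_lt_one

/-- Both determinants have Fredholm expansions, the discrete one being a sum of integrals of step
functions. Hadamard's inequality dominates the integrands and, uniformly in the mesh, the series, so
the limit passes through both. -/
theorem tendsto_det_gridMatrix (k : KernelSpace) :
    Tendsto (fun n => (1 - gridMatrix n k).det) atTop (𝓝 (fredholmC k)) := by
  have h1 : ∀ n, (1 - gridMatrix n k).det = ∑' m : ℕ, (-1 : ℂ) ^ m / (m.factorial : ℂ) *
      ∫ x : Fin m → unitInterval,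
        (Matrix.of fun i j : Fin m => k (gridRound n (x i), gridRound n (x j))).det := by
    intro n
    rw [← (hasSum_det_one_sub (gridMatrix n k)).tsum_eq]
    refine tsum_congr fun m => ?_
    congr 1
    have := integral_comp_gridIdx n m (fun f => (Matrix.of fun i j : Fin m =>
      k (gridPt n (f i), gridPt n (f j))).det)
    simp only [gridRound]
    rw [this, Finset.mul_sum]
    refine Finset.sum_congr rfl fun f _ => ?_
    have h2 : (gridMatrix n k).submatrix f f = ((n + 1 : ℕ) : ℂ)⁻¹ •
        (Matrix.of fun i j : Fin m => k (gridPt n (f i), gridPt n (f j))) := by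
      ext i j
      simp [gridMatrix]
    rw [h2, Matrix.det_smul, Fintype.card_fin]
  simp only [h1]
  have hint : ∀ (n m : ℕ), ‖∫ x : Fin m → unitInterval,
      (Matrix.of fun i j : Fin m => k (gridRound n (x i), gridRound n (x j))).det‖ ≤
      (Real.sqrt m) ^ m * ‖k‖ ^ m := by
    intro n m
    refine (norm_integral_le_of_norm_le_const (C := (Real.sqrt m) ^ m * ‖k‖ ^ m)
      (Eventually.of_forall fun x => ?_)).trans (by simp)
    have := norm_det_le_prod (Matrix.of fun i j : Fin m => k (gridRound n (x i), gridRound n (x j)))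
      (fun _ => ‖k‖) fun i j => k.norm_coe_le_norm _
    simpa using this
  refine tendsto_tsum_of_dominated_convergence
    (summable_sqrt_pow_div_factorial ‖k‖ (norm_nonneg _)) (fun m => ?_)
    (Eventually.of_forall fun n m => ?_)
  · refine Tendsto.const_mul _ ?_
    refine tendsto_integral_of_dominated_convergence (fun _ => (Real.sqrt m) ^ m * ‖k‖ ^ m)
      (fun n => ?_) (integrable_const _) (fun n => Eventually.of_forall fun x => ?_) ?_
    · have : Measurable fun x : Fin m → unitInterval => fun i => gridIdx n (x i) :=
        measurable_pi_lambda _ fun i => (measurable_gridIdx n).comp (measurable_pi_apply i)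
      exact ((measurable_of_finite fun f : Fin m → Fin (n + 1) => (Matrix.of fun i j : Fin m =>
        k (gridPt n (f i), gridPt n (f j))).det).comp this).aestronglyMeasurable
    · have := norm_det_le_prod
        (Matrix.of fun i j : Fin m => k (gridRound n (x i), gridRound n (x j)))
        (fun _ => ‖k‖) fun i j => k.norm_coe_le_norm _
      simpa using this
    · filter_upwards [ae_lt_one_pi m] with x hx
      have h3 : Tendsto (fun n => fun i => gridRound n (x i)) atTop (𝓝 x) :=
        tendsto_pi_nhds.mpr fun i => tendsto_gridRound (hx i)
      exact ((continuous_det_kernel fun _ : Fin m => k).tendsto x).comp h3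
  · rw [norm_mul, norm_div, norm_pow, norm_neg, norm_one, one_pow, Complex.norm_natCast,
      div_mul_eq_mul_div, div_mul_eq_mul_div, one_mul]
    have := hint n m
    gcongr

end

noncomputable section

/-! ### An upper bound for Fredholm determinants that are nearly degenerate -/

/-- The defect `φ - K φ` of a function under the integral operator with kernel `k`. -/
def defect (k : KernelSpace) (φ : unitInterval → ℝ) (x : unitInterval) : ℂ :=
  (φ x : ℂ) - ∫ y, k (x, y) * (φ y : ℂ)

/-- The discretized defect. -/
def gridDefect (n : ℕ) (k : KernelSpace) (φ : unitInterval → ℝ) (x : unitInterval) : ℂ :=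
  (φ x : ℂ) - ((n + 1 : ℕ) : ℂ)⁻¹ * ∑ j, k (x, gridPt n j) * (φ (gridPt n j) : ℂ)

theorem norm_gridDefect_le {k : KernelSpace} {φ : unitInterval → ℝ} {C : ℝ}
    (hC : ∀ x, |φ x| ≤ C) (n : ℕ) (x : unitInterval) :
    ‖gridDefect n k φ x‖ ≤ C + ‖k‖ * C := by
  have hC0 : 0 ≤ C := (abs_nonneg _).trans (hC 0)
  refine (norm_sub_le _ _).trans (add_le_add ?_ ?_)
  · simpa using hC x
  · rw [norm_mul, norm_inv, Complex.norm_natCast, inv_mul_le_iff₀ (by positivity)]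
    refine (norm_sum_le _ _).trans ?_
    refine (Finset.sum_le_card_nsmul _ _ (‖k‖ * C) fun i _ => ?_).trans ?_
    · rw [norm_mul]
      refine mul_le_mul (k.norm_coe_le_norm _) ?_ (norm_nonneg _) (norm_nonneg _)
      simpa using hC _
    · simp

/-- Almost everywhere continuity of `φ` suffices for the Riemann sums, which admits functions
truncated to a window. -/
theorem tendsto_gridDefect {k : KernelSpace} {φ : unitInterval → ℝ} {C : ℝ}
    (hC : ∀ x, |φ x| ≤ C) (hφ : ∀ᵐ x, ContinuousAt φ x) :
    ∀ᵐ x : unitInterval, Tendsto (fun n => gridDefect n k φ (gridRound n x)) atTop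
      (𝓝 (defect k φ x)) := by
  have hofReal : ∀ y, ContinuousAt φ y → (y : ℝ) < 1 →
      Tendsto (fun n => ((φ (gridRound n y) : ℝ) : ℂ)) atTop (𝓝 (φ y : ℂ)) := fun y hy hy1 =>
    (Complex.continuous_ofReal.tendsto _).comp (hy.tendsto.comp (tendsto_gridRound hy1))
  filter_upwards [hφ, ae_lt_one] with x hx hx1
  refine (hofReal x hx hx1).sub ?_
  refine tendsto_average_grid (g := fun n y => k (gridRound n x, y) * (φ y : ℂ))
    (C := ‖k‖ * C) (fun n y => ?_) ?_
  · rw [norm_mul]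
    refine mul_le_mul (k.norm_coe_le_norm _) ?_ (norm_nonneg _) (norm_nonneg _)
    simpa using hC y
  · filter_upwards [hφ, ae_lt_one] with y hy hy1
    refine Tendsto.mul ?_ (hofReal y hy hy1)
    exact (k.continuous.tendsto (x, y)).comp
      ((tendsto_gridRound hx1).prodMk_nhds (tendsto_gridRound hy1))

/-- If `φ₁, …, φₘ` are orthogonal and `K φ_l` is close to `φ_l`, then `det (1 - K)` is small. -/
theorem normSq_fredholmC_mul_le (k : KernelSpace) {m : ℕ} (φ : Fin m → unitInterval → ℝ) {C : ℝ}
    (hC : ∀ l x, |φ l x| ≤ C) (hφ : ∀ l, ∀ᵐ x, ContinuousAt (φ l) x)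
    (horth : ∀ l l', l ≠ l' → ∫ x, φ l x * φ l' x = 0) (s : ℝ) :
    ‖fredholmC k‖ ^ 2 * |∏ l, (1 + s * ∫ x, φ l x ^ 2)| ^ 2 ≤
      Real.exp ((∫ x, ∫ y, ‖k (x, y)‖ ^ 2) - 2 * (∫ x, k (x, x)).re +
        ∑ l, (2 * s + s ^ 2 * ∫ x, φ l x ^ 2) * ∫ x, ‖defect k (φ l) x‖ ^ 2) := by
  -- The columns sample the `φ_l`, scaled by `1/√(n+1)`. Then `FᴴF` is a Riemann sum for the Gram
  -- matrix, which is diagonal in the limit by orthogonality.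
  let F : ∀ n : ℕ, Matrix (Fin (n + 1)) (Fin m) ℂ := fun n =>
    Matrix.of fun i l => ((Real.sqrt ((n + 1 : ℕ) : ℝ) : ℝ) : ℂ)⁻¹ * (φ l (gridPt n i) : ℂ)
  let G : Matrix (Fin m) (Fin m) ℂ := Matrix.diagonal fun l => ((∫ x, φ l x ^ 2 : ℝ) : ℂ)
  let M : Matrix (Fin m) (Fin m) ℂ := Matrix.of fun l l' =>
    ∫ x, star (defect k (φ l) x) * defect k (φ l') x
  have hsq : ∀ n : ℕ, (((Real.sqrt ((n + 1 : ℕ) : ℝ) : ℝ) : ℂ)⁻¹) *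
      (((Real.sqrt ((n + 1 : ℕ) : ℝ) : ℝ) : ℂ)⁻¹) = ((n + 1 : ℕ) : ℂ)⁻¹ := by
    intro n
    rw [← mul_inv, ← Complex.ofReal_mul, Real.mul_self_sqrt (by positivity)]
    simp
  have hG : Tendsto (fun n => (F n)ᴴ * F n) atTop (𝓝 G) := by
    refine tendsto_pi_nhds.mpr fun l => tendsto_pi_nhds.mpr fun l' => ?_
    have h1 : ∀ n, ((F n)ᴴ * F n) l l' = ((n + 1 : ℕ) : ℂ)⁻¹ *
        ∑ i, ((φ l (gridPt n i) * φ l' (gridPt n i) : ℝ) : ℂ) := by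
      intro n
      rw [Matrix.mul_apply, Finset.mul_sum]
      refine Finset.sum_congr rfl fun i _ => ?_
      simp only [F, Matrix.conjTranspose_apply, Matrix.of_apply, star_mul', star_inv₀,
        Complex.star_def, Complex.conj_ofReal]
      rw [← hsq n]
      push_cast
      ring
    have h2 : G l l' = ∫ x, ((φ l x * φ l' x : ℝ) : ℂ) := by
      rw [integral_complex_ofReal]
      rcases eq_or_ne l l' with rfl | hne
      · simp [G, sq]
      · simp [G, Matrix.diagonal_apply_ne _ hne, horth l l' hne]
    simp only [h1]
    rw [h2]
    refine tendsto_average_grid (g := fun _ x => ((φ l x * φ l' x : ℝ) : ℂ)) (C := C * C)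
      (fun n x => ?_) ?_
    · rw [Complex.norm_real, Real.norm_eq_abs, abs_mul]
      exact mul_le_mul (hC l x) (hC l' x) (abs_nonneg _) ((abs_nonneg _).trans (hC l x))
    · filter_upwards [hφ l, hφ l', ae_lt_one] with x hx hx' hx1
      have := tendsto_gridRound hx1
      exact (Complex.continuous_ofReal.tendsto _).comp
        ((hx.tendsto.comp this).mul (hx'.tendsto.comp this))
  have hM : Tendsto (fun n => (F n - gridMatrix n k * F n)ᴴ * (F n - gridMatrix n k * F n)) atTop
      (𝓝 M) := by
    refine tendsto_pi_nhds.mpr fun l => tendsto_pi_nhds.mpr fun l' => ?_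
    have h0 : ∀ n i l, (F n - gridMatrix n k * F n) i l =
        ((Real.sqrt ((n + 1 : ℕ) : ℝ) : ℝ) : ℂ)⁻¹ * gridDefect n k (φ l) (gridPt n i) := by
      intro n i l
      simp only [Matrix.sub_apply, Matrix.mul_apply, F, gridMatrix, Matrix.of_apply, gridDefect,
        mul_sub, Finset.mul_sum]
      congr 1
      refine Finset.sum_congr rfl fun j _ => ?_
      ring
    have h1 : ∀ n, ((F n - gridMatrix n k * F n)ᴴ * (F n - gridMatrix n k * F n)) l l' =
        ((n + 1 : ℕ) : ℂ)⁻¹ *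
        ∑ i, star (gridDefect n k (φ l) (gridPt n i)) * gridDefect n k (φ l') (gridPt n i) := by
      intro n
      rw [Matrix.mul_apply, Finset.mul_sum]
      refine Finset.sum_congr rfl fun i _ => ?_
      rw [Matrix.conjTranspose_apply, h0, h0]
      simp only [star_mul', star_inv₀, Complex.star_def, Complex.conj_ofReal]
      rw [← hsq n]
      ring
    simp only [h1]
    refine tendsto_average_grid
      (g := fun n x => star (gridDefect n k (φ l) x) * gridDefect n k (φ l') x)
      (C := (C + ‖k‖ * C) * (C + ‖k‖ * C)) (fun n x => ?_) ?_
    · rw [norm_mul, norm_star]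
      exact mul_le_mul (norm_gridDefect_le (hC l) n x) (norm_gridDefect_le (hC l') n x)
        (norm_nonneg _) ((norm_nonneg _).trans (norm_gridDefect_le (hC l) n x))
    · filter_upwards [tendsto_gridDefect (k := k) (hC l) (hφ l),
        tendsto_gridDefect (k := k) (hC l') (hφ l')] with x hx hx'
      exact hx.star.mul hx'
  have hK : Tendsto (fun n => ((gridMatrix n k)ᴴ * gridMatrix n k).trace) atTop
      (𝓝 (∫ x, ∫ y, ((‖k (x, y)‖ ^ 2 : ℝ) : ℂ))) := by
    have h1 : ∀ n, ((gridMatrix n k)ᴴ * gridMatrix n k).trace = ((n + 1 : ℕ) : ℂ)⁻¹ *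
        ∑ i, ((n + 1 : ℕ) : ℂ)⁻¹ * ∑ j, ((‖k (gridPt n i, gridPt n j)‖ ^ 2 : ℝ) : ℂ) := by
      intro n
      simp only [Matrix.trace, Matrix.diag_apply, Matrix.mul_apply, Matrix.conjTranspose_apply,
        Finset.mul_sum]
      rw [Finset.sum_comm]
      refine Finset.sum_congr rfl fun i _ => Finset.sum_congr rfl fun j _ => ?_
      simp only [gridMatrix, Matrix.of_apply, star_mul', star_inv₀, Complex.star_def,
        Complex.conj_natCast]
      push_cast
      rw [← Complex.conj_mul']
      ring
    simp only [h1]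
    have hin : ∀ (n : ℕ) (x : unitInterval), ‖((n + 1 : ℕ) : ℂ)⁻¹ *
        ∑ j, ((‖k (x, gridPt n j)‖ ^ 2 : ℝ) : ℂ)‖ ≤ ‖k‖ ^ 2 := by
      intro n x
      rw [norm_mul, norm_inv, Complex.norm_natCast, inv_mul_le_iff₀ (by positivity)]
      refine (norm_sum_le _ _).trans ?_
      refine (Finset.sum_le_card_nsmul _ _ (‖k‖ ^ 2) fun i _ => ?_).trans (by simp)
      rw [Complex.norm_real, Real.norm_of_nonneg (by positivity)]
      exact pow_le_pow_left₀ (norm_nonneg _) (k.norm_coe_le_norm _) 2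
    refine tendsto_average_grid
      (g := fun n x => ((n + 1 : ℕ) : ℂ)⁻¹ * ∑ j, ((‖k (x, gridPt n j)‖ ^ 2 : ℝ) : ℂ))
      (C := ‖k‖ ^ 2) hin ?_
    filter_upwards [ae_lt_one] with x hx1
    refine tendsto_average_grid (g := fun n y => ((‖k (gridRound n x, y)‖ ^ 2 : ℝ) : ℂ))
      (C := ‖k‖ ^ 2) (fun n y => ?_) ?_
    · rw [Complex.norm_real, Real.norm_of_nonneg (by positivity)]
      exact pow_le_pow_left₀ (norm_nonneg _) (k.norm_coe_le_norm _) 2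
    · filter_upwards [ae_lt_one] with y hy1
      have hc : Continuous fun p : unitInterval × unitInterval => ((‖k p‖ ^ 2 : ℝ) : ℂ) := by
        fun_prop
      exact (hc.tendsto (x, y)).comp
        ((tendsto_gridRound hx1).prodMk_nhds (tendsto_gridRound hy1))
  have hT : Tendsto (fun n => (gridMatrix n k).trace) atTop (𝓝 (∫ x, k (x, x))) := by
    have h1 : ∀ n, (gridMatrix n k).trace = ((n + 1 : ℕ) : ℂ)⁻¹ *
        ∑ i, k (gridPt n i, gridPt n i) := by
      intro n
      simp [Matrix.trace, gridMatrix, Finset.mul_sum]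
    simp only [h1]
    refine tendsto_average_grid (g := fun _ x => k (x, x)) (C := ‖k‖)
      (fun n x => k.norm_coe_le_norm _) ?_
    filter_upwards [ae_lt_one] with x hx1
    exact (k.continuous.tendsto (x, x)).comp
      ((tendsto_gridRound hx1).prodMk_nhds (tendsto_gridRound hx1))
  have hdet : Tendsto (fun n => (1 + (s : ℂ) • ((F n)ᴴ * F n)).det) atTop
      (𝓝 (1 + (s : ℂ) • G).det) := by
    have hc : Continuous fun A : Matrix (Fin m) (Fin m) ℂ => (1 + (s : ℂ) • A).det :=
      Continuous.matrix_det (continuous_const.add (continuous_const_smul (s : ℂ)))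
    exact (hc.tendsto G).comp hG
  -- The finite-dimensional inequality passes to the limit; the determinant, the Hilbert–Schmidt
  -- norm, the trace and both defect terms converge separately.
  have hlim := le_of_tendsto_of_tendsto'
    (((tendsto_det_gridMatrix k).norm.pow 2).mul (hdet.norm.pow 2))
    ((Real.continuous_exp.tendsto _).comp
      ((((Complex.continuous_re.tendsto _).comp hK).sub
        (((Complex.continuous_re.tendsto _).comp hT).const_mul 2)).add
        (((Complex.continuous_re.tendsto _).comp ((Continuous.matrix_trace continuous_id).tendsto M |>.comp hM)).const_mul (2 * s))
        |>.add (((Complex.continuous_re.tendsto _).comp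
          ((Continuous.matrix_trace continuous_id).tendsto (M * G) |>.comp (hM.mul hG))).const_mul (s ^ 2))))
    (fun n => normSq_det_mul_le (gridMatrix n k) (F n) s)
  have e1 : (1 + (s : ℂ) • G).det = ((∏ l, (1 + s * ∫ x, φ l x ^ 2) : ℝ) : ℂ) := by
    have : (1 + (s : ℂ) • G) =
        Matrix.diagonal fun l => ((1 + s * ∫ x, φ l x ^ 2 : ℝ) : ℂ) := by
      ext i j
      rcases eq_or_ne i j with rfl | hij
      · simp [G]
      · simp [G, hij]
    rw [this, Matrix.det_diagonal]
    push_cast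
    rfl
  have e2 : ∀ l, M l l = ((∫ x, ‖defect k (φ l) x‖ ^ 2 : ℝ) : ℂ) := by
    intro l
    simp only [M, Matrix.of_apply]
    rw [← integral_complex_ofReal]
    refine integral_congr_ae (Eventually.of_forall fun x => ?_)
    simp only [Complex.star_def, Complex.conj_mul']
    norm_cast
  have e3 : (∫ x, ∫ y, ((‖k (x, y)‖ ^ 2 : ℝ) : ℂ)) = ((∫ x, ∫ y, ‖k (x, y)‖ ^ 2 : ℝ) : ℂ) := by
    rw [← integral_complex_ofReal]
    refine integral_congr_ae (Eventually.of_forall fun x => ?_)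
    exact integral_complex_ofReal
  rw [e1, Complex.norm_real, Real.norm_eq_abs] at hlim
  refine hlim.trans (Real.exp_le_exp.mpr (le_of_eq ?_))
  rw [e3, Complex.ofReal_re, add_assoc]
  congr 1
  simp only [id, Matrix.trace, Matrix.diag_apply, G, Matrix.mul_diagonal, Complex.re_sum, e2,
    Complex.ofReal_re, Finset.mul_sum, ← Complex.ofReal_mul]
  rw [← Finset.sum_add_distrib]
  refine Finset.sum_congr rfl fun l _ => ?_
  ring

end

noncomputable section

/-! ### Rescaling the Fredholm determinant to the unit interval -/

theorem setIntegral_pi_uIcc {n : ℕ} {a b : ℝ} (hab : a ≠ b) (g : (Fin n → ℝ) → ℝ) :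
    ∫ x in Set.univ.pi (fun _ : Fin n => Set.uIcc a b), g x =
      |b - a| ^ n * ∫ x : Fin n → unitInterval, g (fun i => a + (b - a) * x i) := by
  have hR : b - a ≠ 0 := sub_ne_zero.mpr hab.symm
  have hmeas : MeasurableSet (Set.univ.pi (fun _ : Fin n => Set.uIcc a b)) :=
    MeasurableSet.univ_pi fun _ => measurableSet_uIcc
  have hmeas' : MeasurableSet (Set.univ.pi (fun _ : Fin n => Set.Icc (0 : ℝ) 1)) :=
    MeasurableSet.univ_pi fun _ => measurableSet_Icc
  set c : Fin n → ℝ := fun _ => a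
  set f := (Set.univ.pi (fun _ : Fin n => Set.uIcc a b)).indicator g with hf
  have h1 : ∫ x, f (c + (b - a) • x) = |((b - a) ^ n)⁻¹| • ∫ x, f x := by
    have := Measure.integral_comp_smul (volume : Measure (Fin n → ℝ)) (fun y => f (c + y)) (b - a)
    rw [Module.finrank_fin_fun] at this
    rw [this, integral_add_left_eq_self]
  have hmem : ∀ t : ℝ, a + (b - a) * t ∈ Set.uIcc a b ↔ t ∈ Set.Icc (0 : ℝ) 1 := by
    intro t
    rcases lt_or_gt_of_ne hab with h | h
    · rw [Set.uIcc_of_le h.le, Set.mem_Icc, Set.mem_Icc]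
      constructor
      · rintro ⟨h1, h2⟩; constructor <;> nlinarith
      · rintro ⟨h1, h2⟩; constructor <;> nlinarith
    · rw [Set.uIcc_of_ge h.le, Set.mem_Icc, Set.mem_Icc]
      constructor
      · rintro ⟨h1, h2⟩; constructor <;> nlinarith
      · rintro ⟨h1, h2⟩; constructor <;> nlinarith
  have h2 : ∀ x, f (c + (b - a) • x) = (Set.univ.pi (fun _ : Fin n => Set.Icc (0 : ℝ) 1)).indicator
      (fun x => g (fun i => a + (b - a) * x i)) x := by
    intro x
    have hiff : c + (b - a) • x ∈ Set.univ.pi (fun _ : Fin n => Set.uIcc a b) ↔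
        x ∈ Set.univ.pi (fun _ : Fin n => Set.Icc (0 : ℝ) 1) := by
      simp only [Set.mem_univ_pi, Pi.add_apply, Pi.smul_apply, smul_eq_mul, c, hmem]
    by_cases hx : x ∈ Set.univ.pi (fun _ : Fin n => Set.Icc (0 : ℝ) 1)
    · rw [hf, Set.indicator_of_mem hx, Set.indicator_of_mem (hiff.mpr hx)]
      rfl
    · rw [hf, Set.indicator_of_notMem hx, Set.indicator_of_notMem (fun h => hx (hiff.mp h))]
  have hmp : MeasurePreserving (fun (x : Fin n → unitInterval) i => (x i : ℝ)) volume
      ((volume : Measure (Fin n → ℝ)).restrict (Set.univ.pi (fun _ : Fin n => Set.Icc (0 : ℝ) 1))) := by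
    have := measurePreserving_pi (fun _ : Fin n => (volume : Measure unitInterval))
      (fun _ : Fin n => (volume : Measure ℝ).restrict unitInterval)
      (fun _ => unitInterval.measurePreserving_coe)
    have h : (volume : Measure (Fin n → ℝ)).restrict
        (Set.univ.pi (fun _ : Fin n => Set.Icc (0 : ℝ) 1)) =
        Measure.pi (fun _ : Fin n => (volume : Measure ℝ).restrict unitInterval) := by
      rw [volume_pi, Measure.restrict_pi_pi]
    rw [h]
    exact this
  have hemb : MeasurableEmbedding (fun (x : Fin n → unitInterval) i => (x i : ℝ)) := by
    refine (Continuous.isClosedEmbedding (by fun_prop) fun x y h => ?_).measurableEmbedding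
    ext i
    exact congrFun h i
  have h3 : ∫ x : Fin n → unitInterval, g (fun i => a + (b - a) * x i) =
      |((b - a) ^ n)⁻¹| • ∫ x in Set.univ.pi (fun _ : Fin n => Set.uIcc a b), g x := by
    rw [← integral_indicator hmeas, ← h1]
    simp only [h2]
    rw [integral_indicator hmeas', ← hmp.integral_comp hemb]
  rw [h3, smul_eq_mul, abs_inv, abs_pow, mul_inv_cancel_left₀]
  exact pow_ne_zero _ (abs_ne_zero.mpr hR)

/-- The affine change of variables puts a factor `b - a` into each row. Stated for `a ≠ b` in either
order, since `N < 0` reverses the endpoints. -/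
theorem fredholmDet_eq_fredholmC {K : ℝ → ℝ → ℝ} {a b : ℝ} (hab : a ≠ b) {k : KernelSpace}
    (hk : ∀ s t : unitInterval,
      k (s, t) = (((b - a) * K (a + (b - a) * s) (a + (b - a) * t) : ℝ) : ℂ)) :
    ((fredholmDet K a b : ℝ) : ℂ) = fredholmC k := by
  rw [fredholmDet, fredholmC, Complex.ofReal_tsum]
  refine tsum_congr fun n => ?_
  rw [setIntegral_pi_uIcc hab]
  have h1 : ∀ x : Fin n → unitInterval, (Matrix.of fun i j : Fin n => k (x i, x j)).det =
      (((b - a) ^ n * (Matrix.of fun i j : Fin n =>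
        K (a + (b - a) * x i) (a + (b - a) * x j)).det : ℝ) : ℂ) := by
    intro x
    have : (Matrix.of fun i j : Fin n => k (x i, x j)) = Complex.ofRealHom.mapMatrix ((b - a) •
        (Matrix.of fun i j : Fin n => K (a + (b - a) * x i) (a + (b - a) * x j))) := by
      ext i j
      simp [hk]
    rw [this, ← RingHom.map_det, Matrix.det_smul, Fintype.card_fin]
    rfl
  simp only [h1]
  rw [integral_complex_ofReal, integral_const_mul]
  -- The orientation sign and the absolute Jacobian `|b - a|` combine into the signed factor `b -
  -- a`.
  have h2 : (-(if a ≤ b then (1 : ℝ) else -1)) ^ n * |b - a| ^ n = (-1) ^ n * (b - a) ^ n := by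
    rw [← mul_pow, ← mul_pow]
    congr 1
    split_ifs with h
    · rw [abs_of_nonneg (sub_nonneg.mpr h)]
    · rw [abs_of_nonpos (by linarith)]; ring
  have h3 : (-1 : ℂ) ^ n / (n.factorial : ℂ) = (((-1) ^ n / (n.factorial : ℝ) : ℝ) : ℂ) := by
    push_cast; rfl
  rw [h3, ← Complex.ofReal_mul]
  congr 1
  rw [div_mul_eq_mul_div, div_mul_eq_mul_div, ← mul_assoc, h2, mul_assoc]

/-! ### The entire function `h` with `h (z²) = sin z / z` -/

/-- The Taylor coefficients of `sin √w / √w`. -/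
def sincCoeff (n : ℕ) : ℂ := (-1) ^ n / ((2 * n + 1).factorial : ℂ)

/-- The function `w ↦ sin √w / √w`, by its Taylor series in a Banach algebra. -/
def sincSqrt {A : Type*} [NormedRing A] [NormedAlgebra ℂ A] (w : A) : A :=
  FormalMultilinearSeries.ofScalarsSum (E := A) sincCoeff w

theorem norm_sincCoeff (n : ℕ) : ‖sincCoeff n‖ = ((2 * n + 1).factorial : ℝ)⁻¹ := by
  simp [sincCoeff]

theorem sincSeries_radius (A : Type*) [NormedRing A] [NormedAlgebra ℂ A] :
    (FormalMultilinearSeries.ofScalars A sincCoeff).radius = ⊤ := by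
  refine FormalMultilinearSeries.ofScalars_radius_eq_top_of_tendsto _ _
    (Eventually.of_forall fun n => ?_) ?_
  · rw [← norm_ne_zero_iff, norm_sincCoeff]
    have := (2 * n + 1).factorial_pos
    positivity
  · refine squeeze_zero (fun n => by positivity) (fun n => ?_) tendsto_one_div_add_atTop_nhds_zero_nat
    rw [norm_sincCoeff, norm_sincCoeff, div_inv_eq_mul, show 2 * n.succ + 1 = (2 * n + 1 + 1) + 1 by
      simp only [Nat.succ_eq_add_one]; ring, Nat.factorial_succ, Nat.factorial_succ]
    have h := (2 * n + 1).factorial_pos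
    push_cast
    rw [inv_mul_le_iff₀ (by positivity)]
    have h' : (1 : ℝ) ≤ (2 * (n : ℝ) + 1 + 1 + 1) * (2 * n + 1 + 1) / (n + 1) := by
      rw [le_div_iff₀ (by positivity)]
      nlinarith [(Nat.cast_nonneg n : (0 : ℝ) ≤ n)]
    calc ((2 * n + 1).factorial : ℝ) ≤ (2 * n + 1).factorial *
        ((2 * (n : ℝ) + 1 + 1 + 1) * (2 * n + 1 + 1) / (n + 1)) :=
          le_mul_of_one_le_right (by positivity) h'
      _ = _ := by ring

theorem sincSqrt_hasFPowerSeriesOnBall (A : Type*) [NormedRing A] [NormedAlgebra ℂ A]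
    [CompleteSpace A] : HasFPowerSeriesOnBall (sincSqrt : A → A)
      (FormalMultilinearSeries.ofScalars A sincCoeff) 0 ⊤ := by
  have := (FormalMultilinearSeries.ofScalars A sincCoeff).hasFPowerSeriesOnBall
    (by rw [sincSeries_radius]; exact ENNReal.zero_lt_top)
  rw [sincSeries_radius] at this
  exact this

theorem analyticAt_sincSqrt {A : Type*} [NormedRing A] [NormedAlgebra ℂ A] [CompleteSpace A]
    (w : A) : AnalyticAt ℂ (sincSqrt : A → A) w :=
  (sincSqrt_hasFPowerSeriesOnBall A).analyticAt_of_mem (by simp [Metric.eball])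

theorem hasSum_sincSqrt {A : Type*} [NormedRing A] [NormedAlgebra ℂ A] [CompleteSpace A]
    (w : A) : HasSum (fun n => sincCoeff n • w ^ n) (sincSqrt w) := by
  have := (sincSqrt_hasFPowerSeriesOnBall A).hasSum (y := w) (by simp [Metric.eball])
  simpa [FormalMultilinearSeries.ofScalars_apply_eq] using this

/-- Evaluation at a point is a continuous algebra homomorphism, hence commutes with the power
series. -/
theorem sincSqrt_apply (f : KernelSpace) (p : unitInterval × unitInterval) :
    (sincSqrt f) p = sincSqrt (f p) := by
  have h1 := (ContinuousMap.evalCLM ℂ p).hasSum (hasSum_sincSqrt f)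
  refine h1.unique ?_
  refine (hasSum_sincSqrt (f p)).congr_fun ?_
  intro n
  simp

theorem sincSqrt_sq_mul (z : ℂ) : sincSqrt (z ^ 2) * z = Complex.sin z := by
  have h1 := (hasSum_sincSqrt (z ^ 2)).mul_right z
  refine h1.unique ?_
  refine (Complex.hasSum_sin z).congr_fun fun n => ?_
  simp only [sincCoeff, smul_eq_mul]
  ring

theorem sincSqrt_zero : sincSqrt (0 : ℂ) = 1 := by
  simp [sincSqrt, FormalMultilinearSeries.ofScalarsSum_zero, sincCoeff]

/-- Beyond the constant term the coefficients are at most `2^(-(n+1))`, so the tail is dominated by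
a geometric series with sum `‖w‖`. -/
theorem norm_sincSqrt_sub_one_le {w : ℂ} (hw : ‖w‖ ≤ 1) : ‖sincSqrt w - 1‖ ≤ ‖w‖ := by
  have h1 := (hasSum_nat_add_iff' 1).mpr (hasSum_sincSqrt w)
  have h2 : ∑ i ∈ Finset.range 1, sincCoeff i • w ^ i = 1 := by simp [sincCoeff]
  rw [h2] at h1
  have h3 : HasSum (fun n : ℕ => ‖w‖ / 2 * (1 / 2 : ℝ) ^ n) ‖w‖ := by
    simpa using hasSum_geometric_two.mul_left (‖w‖ / 2)
  rw [← h1.tsum_eq]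
  refine tsum_of_norm_bounded h3 fun n => ?_
  rw [norm_smul, norm_sincCoeff, norm_pow, pow_succ]
  have h4 : ((2 * (n + 1) + 1).factorial : ℝ)⁻¹ ≤ 1 / 2 * (1 / 2) ^ n := by
    rw [← pow_succ', one_div, inv_pow]
    refine inv_anti₀ (by positivity) ?_
    have h5 : (1 + (n + 1)).factorial ≤ (2 * (n + 1) + 1).factorial := Nat.factorial_le (by lia)
    have h6 : Nat.factorial 1 * (1 + 1) ^ (n + 1) ≤ (1 + (n + 1)).factorial :=
      Nat.factorial_mul_pow_le_factorial
    rw [Nat.factorial_one, one_mul] at h6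
    exact_mod_cast h6.trans h5
  calc ((2 * (n + 1) + 1).factorial : ℝ)⁻¹ * (‖w‖ ^ n * ‖w‖) ≤
      (1 / 2 * (1 / 2) ^ n) * (1 * ‖w‖) := by
        gcongr
        exact pow_le_one₀ (norm_nonneg _) hw
    _ = _ := by ring

end

noncomputable section

/-! ### The conditioned kernel on the unit square -/

/-- The first coordinate `s` on the unit square. -/
def coordS : KernelSpace := ⟨fun p => ((p.1 : ℝ) : ℂ), by fun_prop⟩

/-- The second coordinate `t` on the unit square. -/
def coordT : KernelSpace := ⟨fun p => ((p.2 : ℝ) : ℂ), by fun_prop⟩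

/-- The point `a + (b - a) s` of an interval with (complex) endpoints `a`, `b`. -/
def pointS (a b : ℂ) : KernelSpace := a • (1 : KernelSpace) + (b - a) • coordS

/-- The point `a + (b - a) t` of an interval with (complex) endpoints `a`, `b`. -/
def pointT (a b : ℂ) : KernelSpace := a • (1 : KernelSpace) + (b - a) • coordT

/-- The kernel `S (x - y) - π S (x) S (y)` on an interval with endpoints `a`, `b`, rescaled to the
unit square; `σ` is composition with `S`. -/
def condKer (σ : KernelSpace → KernelSpace) (a b : ℂ) : KernelSpace :=
  (b - a) • (σ ((b - a) • (coordS - coordT)) -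
    (Real.pi : ℂ) • (σ (pointS a b) * σ (pointT a b)))

theorem condKer_apply {σ : KernelSpace → KernelSpace} {S : ℂ → ℂ}
    (h : ∀ (X : KernelSpace) p, (σ X) p = S (X p)) (a b : ℂ) (s t : unitInterval) :
    condKer σ a b (s, t) = (b - a) * (S ((b - a) * (((s : ℝ) : ℂ) - ((t : ℝ) : ℂ))) -
      (Real.pi : ℂ) * (S (a + (b - a) * ((s : ℝ) : ℂ)) * S (a + (b - a) * ((t : ℝ) : ℂ)))) := by
  simp only [condKer, ContinuousMap.smul_apply, ContinuousMap.sub_apply, ContinuousMap.mul_apply, h,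
    smul_eq_mul]
  simp [pointS, pointT, coordS, coordT]

/-- The unfolded kernel function `S_ε (z) = (sin z / z) / (π sin (√ε z) / (√ε z))`. -/
def sineRatio (ε z : ℂ) : ℂ := (Real.pi : ℂ)⁻¹ * (sincSqrt (z ^ 2) * (sincSqrt (ε * z ^ 2))⁻¹)

/-- Composition with `S_ε`. -/
def sineRatioOp (ε : ℂ) (X : KernelSpace) : KernelSpace :=
  (Real.pi : ℂ)⁻¹ • (sincSqrt (X ^ 2) * Ring.inverse (sincSqrt (ε • X ^ 2)))

theorem sineRatioOp_apply {ε : ℂ} {X : KernelSpace} (h : ∀ p, sincSqrt (ε * X p ^ 2) ≠ 0)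
    (p : unitInterval × unitInterval) : sineRatioOp ε X p = sineRatio ε (X p) := by
  have hu : IsUnit (sincSqrt (ε • X ^ 2)) := by
    rw [ContinuousMap.isUnit_iff_forall_ne_zero]
    intro q
    rw [sincSqrt_apply]
    simpa using h q
  have hinv : (Ring.inverse (sincSqrt (ε • X ^ 2))) p = (sincSqrt (ε * X p ^ 2))⁻¹ := by
    have h1 := congrArg (fun f : KernelSpace => f p) (Ring.mul_inverse_cancel _ hu)
    simp only [ContinuousMap.mul_apply, ContinuousMap.one_apply, sincSqrt_apply,
      ContinuousMap.smul_apply, ContinuousMap.pow_apply, smul_eq_mul] at h1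
    exact eq_inv_of_mul_eq_one_right h1
  simp only [sineRatioOp, sineRatio, ContinuousMap.smul_apply, ContinuousMap.mul_apply, hinv,
    sincSqrt_apply, ContinuousMap.pow_apply, smul_eq_mul]

/-- Pointwise nonvanishing makes the denominator a unit of the algebra of continuous functions, and
inversion is analytic at units. -/
theorem analyticAt_sineRatioOp {E : Type*} [NormedAddCommGroup E] [NormedSpace ℂ E]
    {ε : E → ℂ} {X : E → KernelSpace} {z : E} (hε : AnalyticAt ℂ ε z) (hX : AnalyticAt ℂ X z)
    (h : ∀ p, sincSqrt (ε z * X z p ^ 2) ≠ 0) :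
    AnalyticAt ℂ (fun z => sineRatioOp (ε z) (X z)) z := by
  have hu : IsUnit (sincSqrt (ε z • X z ^ 2)) := by
    rw [ContinuousMap.isUnit_iff_forall_ne_zero]
    intro q
    rw [sincSqrt_apply]
    simpa using h q
  obtain ⟨u, hu⟩ := hu
  have h1 : AnalyticAt ℂ (fun z => sincSqrt (X z ^ 2)) z :=
    (analyticAt_sincSqrt (A := KernelSpace) _).comp (hX.pow 2)
  have h2 : AnalyticAt ℂ (fun z => sincSqrt (ε z • X z ^ 2)) z :=
    (analyticAt_sincSqrt (A := KernelSpace) _).comp (hε.smul (hX.pow 2))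
  have h3 : AnalyticAt ℂ (fun z => Ring.inverse (sincSqrt (ε z • X z ^ 2))) z := by
    have := analyticAt_inverse (𝕜 := ℂ) u
    rw [hu] at this
    exact AnalyticAt.comp (f := fun z => sincSqrt (ε z • X z ^ 2)) this h2
  exact analyticAt_const.fun_smul (h1.fun_mul h3)

/-- The frequencies of the unfolded finite kernel. -/
def freq (N : ℕ) (j : ℕ) : ℝ := (2 * (j : ℝ) - N + 1) / N

/-- The unfolded kernel function for integer `N`, as a sum of exponentials. -/
def expSum (N : ℕ) (z : ℂ) : ℂ :=
  ((Real.pi * N : ℝ) : ℂ)⁻¹ * ∑ j ∈ Finset.range N, Complex.exp (Complex.I * (freq N j : ℂ) * z)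

/-- Composition with `expSum N`. -/
def expSumOp (N : ℕ) (X : KernelSpace) : KernelSpace :=
  ((Real.pi * N : ℝ) : ℂ)⁻¹ • ∑ j ∈ Finset.range N,
    NormedSpace.exp ((Complex.I * (freq N j : ℂ)) • X)

theorem expSumOp_apply (N : ℕ) (X : KernelSpace) (p : unitInterval × unitInterval) :
    expSumOp N X p = expSum N (X p) := by
  have h : ∀ Y : KernelSpace, (NormedSpace.exp Y) p = Complex.exp (Y p) := by
    intro Y
    have := NormedSpace.map_exp (ContinuousMap.evalAlgHom ℂ ℂ p) (continuous_eval_const p) Y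
    rw [Complex.exp_eq_exp_ℂ]
    exact this
  simp only [expSumOp, expSum, ContinuousMap.smul_apply, ContinuousMap.coe_sum, Finset.sum_apply, h,
    smul_eq_mul]

theorem analyticAt_expSumOp {E : Type*} [NormedAddCommGroup E] [NormedSpace ℂ E] (N : ℕ)
    {X : E → KernelSpace} {z : E} (hX : AnalyticAt ℂ X z) :
    AnalyticAt ℂ (fun z => expSumOp N (X z)) z := by
  refine analyticAt_const.fun_smul (Finset.analyticAt_fun_sum _ fun j _ => ?_)
  exact (NormedSpace.exp_analytic (𝕂 := ℂ) (𝔸 := KernelSpace) _).comp (analyticAt_const.fun_smul hX)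

/-- `(sin z / z) = (sin (z / N) / (z / N)) · π S_N (z)`. -/
theorem sincSqrt_eq_mul_expSum {N : ℕ} (hN : N ≠ 0) (z : ℂ) :
    sincSqrt (z ^ 2) = sincSqrt (1 / (N : ℂ) ^ 2 * z ^ 2) * ((Real.pi : ℂ) * expSum N z) := by
  have hN' : (N : ℂ) ≠ 0 := Nat.cast_ne_zero.mpr hN
  have hpi : (Real.pi : ℂ) ≠ 0 := by exact_mod_cast Real.pi_ne_zero
  rcases eq_or_ne z 0 with rfl | hz
  · simp only [ne_eq, OfNat.ofNat_ne_zero, not_false_eq_true, zero_pow, mul_zero, sincSqrt_zero,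
      expSum, Complex.exp_zero, Finset.sum_const, Finset.card_range, nsmul_eq_mul, mul_one, one_mul]
    push_cast
    field_simp
  · refine mul_right_cancel₀ hz ?_
    rw [sincSqrt_sq_mul]
    have h1 : sincSqrt (1 / (N : ℂ) ^ 2 * z ^ 2) * z = N * Complex.sin (z / N) := by
      have := sincSqrt_sq_mul (z / N)
      rw [← this, div_pow, show z ^ 2 / (N : ℂ) ^ 2 = 1 / (N : ℂ) ^ 2 * z ^ 2 by ring]
      field_simp
    have h2 : (Real.pi : ℂ) * expSum N z = (N : ℂ)⁻¹ *
        ∑ j ∈ Finset.range N, Complex.exp (Complex.I * (freq N j : ℂ) * z) := by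
      rw [expSum]
      push_cast
      rw [mul_inv, ← mul_assoc, mul_inv_cancel_left₀ hpi]
    -- The frequencies have spacing `2/N`, so multiplication by `2i sin(z/N)` makes the sum of
    -- exponentials telescope.
    have h3 : (2 * Complex.I * Complex.sin (z / N)) *
        ∑ j ∈ Finset.range N, Complex.exp (Complex.I * (freq N j : ℂ) * z) =
        2 * Complex.I * Complex.sin z := by
      have hs : ∀ w : ℂ, 2 * Complex.I * Complex.sin w =
          Complex.exp (Complex.I * w) - Complex.exp (-(Complex.I * w)) := by
        intro w
        rw [Complex.sin, mul_comm Complex.I w, neg_mul]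
        linear_combination (Complex.exp (-(w * Complex.I)) - Complex.exp (w * Complex.I)) *
          Complex.I_mul_I
      rw [hs, hs, Finset.mul_sum]
      have h4 : ∀ j ∈ Finset.range N, (Complex.exp (Complex.I * (z / N)) -
          Complex.exp (-(Complex.I * (z / N)))) *
          Complex.exp (Complex.I * (freq N j : ℂ) * z) =
          Complex.exp (Complex.I * z * ((2 * ((j + 1 : ℕ) : ℂ) - N) / N)) -
          Complex.exp (Complex.I * z * ((2 * (j : ℂ) - N) / N)) := by
        intro j _
        rw [sub_mul, ← Complex.exp_add, ← Complex.exp_add]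
        congr 2
        · rw [freq]; push_cast; field_simp; ring
        · rw [freq]; push_cast; field_simp; ring
      rw [Finset.sum_congr rfl h4, Finset.sum_range_sub (fun j : ℕ =>
        Complex.exp (Complex.I * z * ((2 * (j : ℂ) - N) / N)))]
      congr 2
      · field_simp; ring
      · push_cast; field_simp; ring
    have h5 : Complex.sin z = Complex.sin (z / N) *
        ∑ j ∈ Finset.range N, Complex.exp (Complex.I * (freq N j : ℂ) * z) := by
      have h2I : (2 * Complex.I) ≠ 0 := by simp
      refine mul_left_cancel₀ h2I ?_
      rw [← h3, mul_assoc]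
    calc Complex.sin z = (N * Complex.sin (z / N)) * ((N : ℂ)⁻¹ *
        ∑ j ∈ Finset.range N, Complex.exp (Complex.I * (freq N j : ℂ) * z)) := by
          rw [h5]; field_simp
      _ = _ := by rw [← h1, ← h2]; ring

/-- A zero would force `sin (x/N) = 0` with `0 < |x/N| < π`. This is the origin of the condition `A₂
- A₁ < π|N|`. -/
theorem sincSqrt_ne_zero {N x : ℝ} (hN : N ≠ 0) (hx : |x| < Real.pi * |N|) :
    sincSqrt (1 / (N : ℂ) ^ 2 * (x : ℂ) ^ 2) ≠ 0 := by
  rcases eq_or_ne x 0 with rfl | hx0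
  · simp [sincSqrt_zero]
  · intro h
    have h1 := sincSqrt_sq_mul ((x / N : ℝ) : ℂ)
    have h2 : (((x / N : ℝ) : ℂ)) ^ 2 = 1 / (N : ℂ) ^ 2 * (x : ℂ) ^ 2 := by push_cast; ring
    rw [h2, h, zero_mul, ← Complex.ofReal_sin] at h1
    have h3 : Real.sin (x / N) = 0 := by exact_mod_cast h1.symm
    have h4 : |x / N| < Real.pi := by
      rw [abs_div, div_lt_iff₀ (abs_pos.mpr hN)]; exact hx
    have h5 := (Real.sin_eq_zero_iff_of_lt_of_lt (abs_lt.mp h4).1 (abs_lt.mp h4).2).mp h3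
    exact (div_ne_zero hx0 hN) h5

theorem sineRatio_eq_cueKernel {N : ℝ} (hN : N ≠ 0) {x y : ℝ} (h : |x - y| < Real.pi * |N|) :
    sineRatio (1 / (N : ℂ) ^ 2) ((x : ℂ) - y) =
      ((2 / N * cueKernel N (2 / N * x) (2 / N * y) : ℝ) : ℂ) := by
  have hNc : (N : ℂ) ≠ 0 := by exact_mod_cast hN
  have hpi : (Real.pi : ℂ) ≠ 0 := by exact_mod_cast Real.pi_ne_zero
  have h2N : (2 / N) ≠ 0 := div_ne_zero two_ne_zero hN
  rcases eq_or_ne x y with rfl | hxy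
  · simp only [sub_self, sineRatio, ne_eq, OfNat.ofNat_ne_zero, not_false_eq_true, zero_pow,
      mul_zero, sincSqrt_zero, inv_one, mul_one, cueKernel, if_true]
    push_cast
    field_simp
  · have hne : 2 / N * x ≠ 2 / N * y := fun he => hxy (mul_left_cancel₀ h2N he)
    have hd : ((x - y : ℝ) : ℂ) ≠ 0 := by exact_mod_cast sub_ne_zero.mpr hxy
    rw [cueKernel, if_neg hne, show N * (2 / N * x - 2 / N * y) / 2 = x - y by field_simp,
      show (2 / N * x - 2 / N * y) / 2 = (x - y) / N by field_simp]
    have h1 := sincSqrt_sq_mul ((x - y : ℝ) : ℂ)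
    have h2 := sincSqrt_sq_mul (((x - y) / N : ℝ) : ℂ)
    have h3 : ((((x - y) / N : ℝ) : ℂ)) ^ 2 = 1 / (N : ℂ) ^ 2 * ((x - y : ℝ) : ℂ) ^ 2 := by
      push_cast; ring
    rw [h3] at h2
    have h4 := sincSqrt_ne_zero hN h
    rw [sineRatio, ← Complex.ofReal_sub]
    push_cast at h1 h2 h4 hd ⊢
    rw [← h1, ← h2]
    field_simp

/-- The unfolded conditional Jánossy density, as an analytic function of `1 / N²` and of the
endpoints. -/
def janossyC (z : ℂ × ℂ × ℂ) : ℂ := fredholmC (condKer (sineRatioOp z.1) z.2.1 z.2.2)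

/-- The unfolded conditional Jánossy density for integer `N`, as an entire function of the
endpoints (the first variable is a dummy). -/
def janossyInt (N : ℕ) (z : ℂ × ℂ × ℂ) : ℂ := fredholmC (condKer (expSumOp N) z.2.1 z.2.2)

theorem analyticAt_param (z : ℂ × ℂ × ℂ) : AnalyticAt ℂ (fun z : ℂ × ℂ × ℂ => z.1) z :=
  (ContinuousLinearMap.fst ℂ ℂ (ℂ × ℂ)).analyticAt z

theorem analyticAt_left (z : ℂ × ℂ × ℂ) : AnalyticAt ℂ (fun z : ℂ × ℂ × ℂ => z.2.1) z :=
  ((ContinuousLinearMap.fst ℂ ℂ ℂ).comp (ContinuousLinearMap.snd ℂ ℂ (ℂ × ℂ))).analyticAt z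

theorem analyticAt_right (z : ℂ × ℂ × ℂ) : AnalyticAt ℂ (fun z : ℂ × ℂ × ℂ => z.2.2) z :=
  ((ContinuousLinearMap.snd ℂ ℂ ℂ).comp (ContinuousLinearMap.snd ℂ ℂ (ℂ × ℂ))).analyticAt z

theorem analyticAt_pointS (z : ℂ × ℂ × ℂ) :
    AnalyticAt ℂ (fun z : ℂ × ℂ × ℂ => pointS z.2.1 z.2.2) z := by
  unfold pointS
  have h1 := analyticAt_left z
  have h2 := analyticAt_right z
  exact (h1.smul analyticAt_const).add ((h2.sub h1).smul analyticAt_const)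

theorem analyticAt_pointT (z : ℂ × ℂ × ℂ) :
    AnalyticAt ℂ (fun z : ℂ × ℂ × ℂ => pointT z.2.1 z.2.2) z := by
  unfold pointT
  have h1 := analyticAt_left z
  have h2 := analyticAt_right z
  exact (h1.smul analyticAt_const).add ((h2.sub h1).smul analyticAt_const)

theorem analyticAt_pointDiff (z : ℂ × ℂ × ℂ) :
    AnalyticAt ℂ (fun z : ℂ × ℂ × ℂ => (z.2.2 - z.2.1) • (coordS - coordT)) z := by
  have h1 := analyticAt_left z
  have h2 := analyticAt_right z
  exact (h2.sub h1).smul analyticAt_const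

/-- The arguments at which the kernel function is evaluated. -/
def ArgsSatisfy (P : ℂ → Prop) (a b : ℂ) : Prop :=
  (∀ s t : unitInterval, P ((b - a) * (((s : ℝ) : ℂ) - ((t : ℝ) : ℂ)))) ∧
    ∀ s : unitInterval, P (a + (b - a) * ((s : ℝ) : ℂ))

theorem pointS_apply (a b : ℂ) (p : unitInterval × unitInterval) :
    pointS a b p = a + (b - a) * ((p.1 : ℝ) : ℂ) := by simp [pointS, coordS]

theorem pointT_apply (a b : ℂ) (p : unitInterval × unitInterval) :
    pointT a b p = a + (b - a) * ((p.2 : ℝ) : ℂ) := by simp [pointT, coordT]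

theorem pointDiff_apply (a b : ℂ) (p : unitInterval × unitInterval) :
    ((b - a) • (coordS - coordT)) p = (b - a) * (((p.1 : ℝ) : ℂ) - ((p.2 : ℝ) : ℂ)) := by
  simp [coordS, coordT]

/-- The kernel depends analytically on all three variables as an element of the Banach algebra,
provided the denominator does not vanish at any argument occurring on the square. -/
theorem analyticAt_janossyC {z : ℂ × ℂ × ℂ}
    (h : ArgsSatisfy (fun w => sincSqrt (z.1 * w ^ 2) ≠ 0) z.2.1 z.2.2) :
    AnalyticAt ℂ janossyC z := by
  have h0 := analyticAt_param z
  have h1 := analyticAt_left z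
  have h2 := analyticAt_right z
  refine (analyticAt_fredholmC _).comp ((h2.sub h1).smul (AnalyticAt.fun_sub ?_
    (analyticAt_const.fun_smul (AnalyticAt.fun_mul ?_ ?_))))
  · refine analyticAt_sineRatioOp h0 (analyticAt_pointDiff z) fun p => ?_
    rw [pointDiff_apply]
    exact h.1 _ _
  · refine analyticAt_sineRatioOp h0 (analyticAt_pointS z) fun p => ?_
    rw [pointS_apply]
    exact h.2 _
  · refine analyticAt_sineRatioOp h0 (analyticAt_pointT z) fun p => ?_
    rw [pointT_apply]
    exact h.2 _

theorem analyticAt_janossyInt (N : ℕ) (z : ℂ × ℂ × ℂ) : AnalyticAt ℂ (janossyInt N) z := by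
  have h1 := analyticAt_left z
  have h2 := analyticAt_right z
  exact (analyticAt_fredholmC _).comp ((h2.sub h1).smul
    ((analyticAt_expSumOp N (analyticAt_pointDiff z)).fun_sub
    (analyticAt_const.fun_smul ((analyticAt_expSumOp N (analyticAt_pointS z)).fun_mul
      (analyticAt_expSumOp N (analyticAt_pointT z))))))

theorem condKer_sineRatioOp_apply {ε a b : ℂ}
    (h : ArgsSatisfy (fun w => sincSqrt (ε * w ^ 2) ≠ 0) a b) (s t : unitInterval) :
    condKer (sineRatioOp ε) a b (s, t) =
      (b - a) * (sineRatio ε ((b - a) * (((s : ℝ) : ℂ) - ((t : ℝ) : ℂ))) -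
      (Real.pi : ℂ) * (sineRatio ε (a + (b - a) * ((s : ℝ) : ℂ)) *
        sineRatio ε (a + (b - a) * ((t : ℝ) : ℂ)))) := by
  simp only [condKer, ContinuousMap.smul_apply, ContinuousMap.sub_apply, ContinuousMap.mul_apply]
  rw [sineRatioOp_apply (fun p => by rw [pointDiff_apply]; exact h.1 _ _),
    sineRatioOp_apply (fun p => by rw [pointS_apply]; exact h.2 _),
    sineRatioOp_apply (fun p => by rw [pointT_apply]; exact h.2 _), pointDiff_apply, pointS_apply,
    pointT_apply]
  simp only [smul_eq_mul]

theorem abs_args_le {A₁ A₂ : ℝ} (h1 : A₁ ≤ 0) (h2 : 0 ≤ A₂) (s t : unitInterval) :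
    |(A₂ - A₁) * ((s : ℝ) - t)| ≤ A₂ - A₁ ∧ |A₁ + (A₂ - A₁) * s| ≤ A₂ - A₁ := by
  obtain ⟨s, hs0, hs1⟩ := s
  obtain ⟨t, ht0, ht1⟩ := t
  constructor <;> rw [abs_le] <;> constructor <;> simp only <;> nlinarith

theorem argsSatisfy_real {A₁ A₂ : ℝ} (h1 : A₁ ≤ 0) (h2 : 0 ≤ A₂) {P : ℂ → Prop}
    (hP : ∀ x : ℝ, |x| ≤ A₂ - A₁ → P x) : ArgsSatisfy P A₁ A₂ := by
  refine ⟨fun s t => ?_, fun s => ?_⟩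
  · have := hP _ (abs_args_le h1 h2 s t).1
    push_cast at this
    exact this
  · have := hP _ (abs_args_le h1 h2 s s).2
    push_cast at this
    exact this

theorem argsSatisfy_sincSqrt_ne_zero {N A₁ A₂ : ℝ} (hN : N ≠ 0) (h1 : A₁ ≤ 0) (h2 : 0 ≤ A₂)
    (hL : A₂ - A₁ < Real.pi * |N|) :
    ArgsSatisfy (fun w => sincSqrt (1 / (N : ℂ) ^ 2 * w ^ 2) ≠ 0) A₁ A₂ :=
  argsSatisfy_real h1 h2 fun _ hx => sincSqrt_ne_zero hN (hx.trans_lt hL)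

/-- The unfolded diagonal value is `(2/N) K_N(0,0) = 1/π`; its inverse is the factor `π` in the
conditioned kernel. -/
theorem condKernel_unfold {N : ℝ} (hN : N ≠ 0) (x y : ℝ) :
    2 / N * condKernel N (2 / N * x) (2 / N * y) =
      2 / N * cueKernel N (2 / N * x) (2 / N * y) - Real.pi *
        ((2 / N * cueKernel N (2 / N * x) (2 / N * 0)) *
          (2 / N * cueKernel N (2 / N * 0) (2 / N * y))) := by
  have h : cueKernel N 0 0 = N / (2 * Real.pi) := by simp [cueKernel]
  rw [condKernel, h, mul_zero]
  have := Real.pi_ne_zero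
  field_simp

theorem sineRatio_neg (ε z : ℂ) : sineRatio ε (-z) = sineRatio ε z := by
  simp [sineRatio]

theorem condJanossyUnf_eq {N A₁ A₂ : ℝ} (hN : N ≠ 0) (h1 : A₁ < 0) (h2 : 0 < A₂)
    (hL : A₂ - A₁ < Real.pi * |N|) :
    ((condJanossyUnf N A₁ A₂ : ℝ) : ℂ) = janossyC (1 / (N : ℂ) ^ 2, (A₁ : ℂ), (A₂ : ℂ)) := by
  have h2N : (2 / N) ≠ 0 := div_ne_zero two_ne_zero hN
  refine fredholmDet_eq_fredholmC (fun he => ?_) fun s t => ?_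
  · have := mul_left_cancel₀ h2N he
    linarith
  · rw [condKer_sineRatioOp_apply (argsSatisfy_sincSqrt_ne_zero hN h1.le h2.le hL)]
    have hs := abs_args_le h1.le h2.le s t
    have ht := abs_args_le h1.le h2.le t s
    set x := A₁ + (A₂ - A₁) * s with hx
    set y := A₁ + (A₂ - A₁) * t with hy
    have hxy : (A₂ - A₁) * ((s : ℝ) - t) = x - y := by rw [hx, hy]; ring
    have e0 : ((A₂ : ℂ) - A₁) * (((s : ℝ) : ℂ) - ((t : ℝ) : ℂ)) = (x : ℂ) - (y : ℂ) := by
      rw [hx, hy]; push_cast; ring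
    have e1 : (A₁ : ℂ) + ((A₂ : ℂ) - A₁) * ((s : ℝ) : ℂ) = (x : ℂ) - ((0 : ℝ) : ℂ) := by
      rw [hx]; push_cast; ring
    -- The second conditioning factor is `K(0, y)`, with argument `0 - y`; evenness of `S_ε` absorbs
    -- the sign.
    have e2 : (A₁ : ℂ) + ((A₂ : ℂ) - A₁) * ((t : ℝ) : ℂ) = -(((0 : ℝ) : ℂ) - (y : ℂ)) := by
      rw [hy]; push_cast; ring
    rw [hxy] at hs
    rw [e0, e1, e2, sineRatio_neg, sineRatio_eq_cueKernel hN (hs.1.trans_lt hL),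
      sineRatio_eq_cueKernel hN (by rw [sub_zero]; exact hs.2.trans_lt hL),
      sineRatio_eq_cueKernel hN (by rw [zero_sub, abs_neg]; exact ht.2.trans_lt hL)]
    have e3 : 2 / N * A₁ + (2 / N * A₂ - 2 / N * A₁) * s = 2 / N * x := by rw [hx]; ring
    have e4 : 2 / N * A₁ + (2 / N * A₂ - 2 / N * A₁) * t = 2 / N * y := by rw [hy]; ring
    rw [e3, e4, show 2 / N * A₂ - 2 / N * A₁ = (A₂ - A₁) * (2 / N) by ring, mul_assoc,
      condKernel_unfold hN]
    push_cast
    ring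

theorem sineRatio_eq_expSum {N : ℕ} (hN : N ≠ 0) {x : ℝ} (hx : |x| < Real.pi * N) :
    sineRatio (1 / (N : ℂ) ^ 2) x = expSum N x := by
  have h := sincSqrt_ne_zero (N := N) (Nat.cast_ne_zero.mpr hN) (x := x)
    (by rwa [abs_of_nonneg (by positivity : (0 : ℝ) ≤ N)])
  have hpi : (Real.pi : ℂ) ≠ 0 := by exact_mod_cast Real.pi_ne_zero
  push_cast at h
  rw [sineRatio, sincSqrt_eq_mul_expSum hN, mul_right_comm, mul_inv_cancel₀ h, one_mul,
    inv_mul_cancel_left₀ hpi]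

/-- For integer `N` the quotient defining the kernel is a finite exponential sum. The right side is
entire in the endpoints, hence usable on polydiscs that cross the edge of the admissible range. -/
theorem janossyC_eq_janossyInt {N : ℕ} (hN : N ≠ 0) {A₁ A₂ : ℝ} (h1 : A₁ ≤ 0) (h2 : 0 ≤ A₂)
    (hL : A₂ - A₁ < Real.pi * N) (ε : ℂ) :
    janossyC (1 / (N : ℂ) ^ 2, (A₁ : ℂ), (A₂ : ℂ)) = janossyInt N (ε, (A₁ : ℂ), (A₂ : ℂ)) := by
  have hne := argsSatisfy_sincSqrt_ne_zero (N := N) (Nat.cast_ne_zero.mpr hN) h1 h2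
    (by rwa [abs_of_nonneg (by positivity : (0 : ℝ) ≤ N)])
  push_cast at hne
  have heq := argsSatisfy_real h1 h2 (P := fun w => sineRatio (1 / (N : ℂ) ^ 2) w = expSum N w)
    fun x hx => sineRatio_eq_expSum hN (hx.trans_lt hL)
  rw [janossyC, janossyInt]
  congr 1
  ext ⟨s, t⟩
  rw [condKer_sineRatioOp_apply hne, condKer_apply (expSumOp_apply N), heq.1, heq.2, heq.2]

end

noncomputable section

/-! ### Reproducing kernels and truncated functions -/

theorem intervalIntegral_swap {F : ℝ → ℝ → ℝ} (hF : Continuous (Function.uncurry F))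
    {a b c d : ℝ} (hab : a ≤ b) (hcd : c ≤ d) :
    ∫ x in a..b, ∫ y in c..d, F x y = ∫ y in c..d, ∫ x in a..b, F x y := by
  simp only [intervalIntegral.integral_of_le hab, intervalIntegral.integral_of_le hcd]
  refine integral_integral_swap ?_
  rw [Measure.prod_restrict]
  refine (hF.continuousOn.integrableOn_compact (isCompact_Icc.prod isCompact_Icc)).mono_set
    (Set.prod_mono Set.Ioc_subset_Icc_self Set.Ioc_subset_Icc_self)

theorem intervalIntegral_indicator_Ioo (h : ℝ → ℝ) {a b c d : ℝ} (hac : a ≤ c) (hcd : c ≤ d)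
    (hdb : d ≤ b) :
    ∫ x in a..b, (Set.Ioo c d).indicator h x = ∫ x in c..d, h x := by
  rw [intervalIntegral.integral_of_le (hac.trans (hcd.trans hdb)),
    intervalIntegral.integral_of_le hcd, setIntegral_indicator measurableSet_Ioo,
    integral_Ioc_eq_integral_Ioo]
  congr 2
  ext x
  simp only [Set.mem_inter_iff, Set.mem_Ioc, Set.mem_Ioo]
  constructor
  · exact fun h => h.2
  · exact fun h => ⟨⟨hac.trans_lt h.1, h.2.le.trans hdb⟩, h⟩

theorem intervalIntegral_le_of_subset {h : ℝ → ℝ} (hc : Continuous h) (h0 : ∀ x, 0 ≤ h x)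
    {a b c d : ℝ} (hac : a ≤ c) (hcd : c ≤ d) (hdb : d ≤ b) :
    ∫ x in c..d, h x ≤ ∫ x in a..b, h x :=
  intervalIntegral.integral_mono_interval hac hcd hdb (Eventually.of_forall h0)
    (hc.intervalIntegrable _ _)

/-- The defect of the truncation to `(c, d)` of a unit vector in the range of the projection with
kernel `K`. -/
theorem integral_truncation_defect_le {K : ℝ → ℝ → ℝ} {e : ℝ → ℝ} {α β T c d : ℝ}
    (hK : Continuous (Function.uncurry K)) (he : Continuous e)
    (hsymm : ∀ x y, K x y = K y x)
    (hrep : ∀ x w, ∫ y in α..(α + T), K x y * K y w = K x w)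
    (hunit : ∫ x in α..(α + T), e x ^ 2 = 1)
    (heig : ∀ y, ∫ x in α..(α + T), e x * K x y = e y)
    (hac : α ≤ c) (hcd : c ≤ d) (hdb : d ≤ β) (hβ : β ≤ α + T) :
    ∫ x in α..β, ((Set.Ioo c d).indicator e x - ∫ y in c..d, K x y * e y) ^ 2 ≤
      1 - ∫ x in c..d, e x ^ 2 := by
  have hαT : α ≤ α + T := hac.trans (hcd.trans (hdb.trans hβ))
  have hαβ : α ≤ β := hac.trans (hcd.trans hdb)
  set u : ℝ → ℝ := fun x => ∫ y in c..d, K x y * e y with hu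
  have huc : Continuous u := by
    refine intervalIntegral.continuous_parametric_intervalIntegral_of_continuous' ?_ c d
    exact hK.mul (he.comp continuous_snd)
  set g := ∫ x in c..d, e x ^ 2 with hg
  set q := ∫ x in c..d, e x * u x with hq
  have hg1 : g ≤ 1 := by
    rw [← hunit]
    exact intervalIntegral_le_of_subset (he.pow 2) (fun x => sq_nonneg _) hac hcd (hdb.trans hβ)
  have hg0 : 0 ≤ g := intervalIntegral.integral_nonneg hcd fun x _ => sq_nonneg _
  -- With `f` the truncation of `e` and `u = P f`, this is `⟨P f, P f⟩ = ⟨f, P f⟩`, by symmetry and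
  -- the reproducing property.
  have hu2 : ∫ x in α..(α + T), u x ^ 2 = q := by
    have h1 : ∀ x, u x ^ 2 = ∫ y in c..d, e y * (u x * K x y) := by
      intro x
      rw [sq]
      nth_rewrite 2 [hu]
      rw [← intervalIntegral.integral_const_mul]
      refine intervalIntegral.integral_congr fun y _ => ?_
      ring
    simp only [h1]
    rw [intervalIntegral_swap (by
      exact (he.comp continuous_snd).mul ((huc.comp continuous_fst).mul hK)) hαT hcd, hq]
    refine intervalIntegral.integral_congr fun y _ => ?_
    rw [intervalIntegral.integral_const_mul]
    congr 1
    have h2 : ∀ x, u x * K x y = ∫ z in c..d, e z * (K y x * K x z) := by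
      intro x
      rw [hu, ← intervalIntegral.integral_mul_const]
      refine intervalIntegral.integral_congr fun z _ => ?_
      rw [hsymm x y]; ring
    simp only [h2]
    rw [intervalIntegral_swap (F := fun x z => e z * (K y x * K x z)) (by
      refine (he.comp continuous_snd).mul (Continuous.mul ?_ hK)
      exact hK.comp (continuous_const.prodMk continuous_fst)) hαT hcd]
    refine intervalIntegral.integral_congr fun z _ => ?_
    rw [intervalIntegral.integral_const_mul, hrep, mul_comm]
  -- `⟨e, P f⟩ = ⟨P e, f⟩ = ⟨e, f⟩`, the mass of `e²` on the window.
  have heu : ∫ x in α..(α + T), e x * u x = g := by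
    have h1 : ∀ x, e x * u x = ∫ y in c..d, e y * (e x * K x y) := by
      intro x
      rw [hu, ← intervalIntegral.integral_const_mul]
      refine intervalIntegral.integral_congr fun y _ => ?_
      ring
    simp only [h1]
    rw [intervalIntegral_swap (by
      exact (he.comp continuous_snd).mul ((he.comp continuous_fst).mul hK)) hαT hcd, hg]
    refine intervalIntegral.integral_congr fun y _ => ?_
    rw [intervalIntegral.integral_const_mul, heig, sq]
  clear_value g q
  -- The squared distance from `u` to `g e` equals `q - g²`, and is nonnegative.
  have hgq : g ^ 2 ≤ q := by
    have h1 : 0 ≤ ∫ x in α..(α + T), (u x - g * e x) ^ 2 :=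
      intervalIntegral.integral_nonneg hαT fun x _ => sq_nonneg _
    have h2 : ∫ x in α..(α + T), (u x - g * e x) ^ 2 = (∫ x in α..(α + T), u x ^ 2) -
        2 * g * (∫ x in α..(α + T), e x * u x) + g ^ 2 * ∫ x in α..(α + T), e x ^ 2 := by
      rw [← intervalIntegral.integral_const_mul, ← intervalIntegral.integral_const_mul,
        ← intervalIntegral.integral_sub, ← intervalIntegral.integral_add]
      · refine intervalIntegral.integral_congr fun x _ => ?_
        ring
      all_goals exact Continuous.intervalIntegrable (by fun_prop) _ _
    rw [h2, hu2, heu, hunit] at h1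
    nlinarith
  have hmain : ∫ x in α..β, ((Set.Ioo c d).indicator e x - u x) ^ 2 =
      g - 2 * q + ∫ x in α..β, u x ^ 2 := by
    have h1 : ∀ x, ((Set.Ioo c d).indicator e x - u x) ^ 2 =
        (Set.Ioo c d).indicator (fun x => e x ^ 2 - 2 * (e x * u x)) x + u x ^ 2 := by
      intro x
      by_cases hx : x ∈ Set.Ioo c d
      · simp only [Set.indicator_of_mem hx]; ring
      · simp only [Set.indicator_of_notMem hx]; ring
    simp only [h1]
    rw [intervalIntegral.integral_add, intervalIntegral_indicator_Ioo _ hac hcd hdb,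
      intervalIntegral.integral_sub, intervalIntegral.integral_const_mul, ← hg, ← hq]
    · exact Continuous.intervalIntegrable (by fun_prop) _ _
    · exact Continuous.intervalIntegrable (by fun_prop) _ _
    · rw [intervalIntegrable_iff_integrableOn_Ioc_of_le hαβ]
      refine Integrable.indicator ?_ measurableSet_Ioo
      rw [← IntegrableOn, ← intervalIntegrable_iff_integrableOn_Ioc_of_le hαβ]
      exact Continuous.intervalIntegrable (by fun_prop) _ _
    · exact Continuous.intervalIntegrable (by fun_prop) _ _
  have hle : ∫ x in α..β, u x ^ 2 ≤ q := by
    rw [← hu2]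
    exact intervalIntegral_le_of_subset (huc.pow 2) (fun x => sq_nonneg _) le_rfl hαβ hβ
  -- The squared defect is at most `g - 2q + q = g - q ≤ g - g²`, and `g(1 - g) ≤ 1 - g`.
  rw [hmain]
  nlinarith

/-! ### The kernel for integer `N` -/

theorem expSum_neg (N : ℕ) (z : ℂ) : expSum N (-z) = expSum N z := by
  rw [expSum, expSum, ← Finset.sum_range_reflect]
  congr 1
  refine Finset.sum_congr rfl fun j hj => ?_
  have hj' : j + 1 ≤ N := Finset.mem_range.mp hj
  congr 1
  rw [freq, freq, show N - 1 - j = N - (j + 1) by lia, Nat.cast_sub hj']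
  push_cast
  ring

/-- The unfolded kernel function for integer `N`, on the real line. -/
def sineKer (N : ℕ) (x : ℝ) : ℝ := (expSum N x).re

theorem expSum_ofReal (N : ℕ) (x : ℝ) : expSum N x = (sineKer N x : ℂ) := by
  have h : (starRingEnd ℂ) (expSum N x) = expSum N x := by
    conv_rhs => rw [← expSum_neg N x]
    rw [expSum, expSum, map_mul, map_inv₀, Complex.conj_ofReal, map_sum]
    congr 1
    refine Finset.sum_congr rfl fun j _ => ?_
    rw [← Complex.exp_conj]
    simp
  exact (Complex.conj_eq_iff_re.mp h).symm

theorem sineKer_neg (N : ℕ) (x : ℝ) : sineKer N (-x) = sineKer N x := by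
  rw [sineKer, sineKer, Complex.ofReal_neg, expSum_neg]

theorem continuous_expSum (N : ℕ) : Continuous (expSum N) := by
  unfold expSum; fun_prop

theorem continuous_sineKer (N : ℕ) : Continuous (sineKer N) :=
  Complex.continuous_re.comp ((continuous_expSum N).comp Complex.continuous_ofReal)

theorem sineKer_zero {N : ℕ} (hN : N ≠ 0) : sineKer N 0 = 1 / Real.pi := by
  have hN' : (N : ℂ) ≠ 0 := Nat.cast_ne_zero.mpr hN
  have hpi : (Real.pi : ℂ) ≠ 0 := by exact_mod_cast Real.pi_ne_zero
  have h : ((sineKer N 0 : ℝ) : ℂ) = ((1 / Real.pi : ℝ) : ℂ) := by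
    rw [← expSum_ofReal, expSum]
    simp
    field_simp
  exact_mod_cast h

/-- Exponentials whose frequencies differ by a nonzero multiple of `2/N` are orthogonal over any
interval of length `πN`, leaving only the diagonal terms. -/
theorem sineKer_reproducing {N : ℕ} (hN : N ≠ 0) (α x w : ℝ) :
    ∫ y in α..(α + Real.pi * N), sineKer N (x - y) * sineKer N (y - w) = sineKer N (x - w) := by
  have hN' : (N : ℂ) ≠ 0 := Nat.cast_ne_zero.mpr hN
  have hpi : (Real.pi : ℂ) ≠ 0 := by exact_mod_cast Real.pi_ne_zero
  have hc : ((∫ y in α..(α + Real.pi * N), sineKer N (x - y) * sineKer N (y - w) : ℝ) : ℂ) =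
      ((sineKer N (x - w) : ℝ) : ℂ) := by
    rw [← intervalIntegral.integral_ofReal]
    have h1 : ∀ y : ℝ, ((sineKer N (x - y) * sineKer N (y - w) : ℝ) : ℂ) =
        ∑ j ∈ Finset.range N, ∑ l ∈ Finset.range N,
          (((Real.pi * N : ℝ) : ℂ)⁻¹ * ((Real.pi * N : ℝ) : ℂ)⁻¹ *
          Complex.exp (Complex.I * (freq N j * x - freq N l * w))) *
          Complex.exp ((Complex.I * (freq N l - freq N j)) * y) := by
      intro y
      rw [Complex.ofReal_mul, ← expSum_ofReal, ← expSum_ofReal, expSum, expSum, mul_mul_mul_comm,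
        Finset.sum_mul_sum, Finset.mul_sum]
      refine Finset.sum_congr rfl fun j _ => ?_
      rw [Finset.mul_sum]
      refine Finset.sum_congr rfl fun l _ => ?_
      have h0 : Complex.exp (Complex.I * (freq N j : ℂ) * ((x - y : ℝ) : ℂ)) *
          Complex.exp (Complex.I * (freq N l : ℂ) * ((y - w : ℝ) : ℂ)) =
          Complex.exp (Complex.I * (freq N j * x - freq N l * w)) *
          Complex.exp ((Complex.I * (freq N l - freq N j)) * y) := by
        rw [← Complex.exp_add, ← Complex.exp_add]
        congr 1
        push_cast
        ring
      rw [h0, ← mul_assoc]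
    simp only [h1]
    rw [intervalIntegral.integral_finsetSum fun j _ =>
      Continuous.intervalIntegrable (by fun_prop) _ _]
    have h2 : ∀ j ∈ Finset.range N, ∫ y in α..(α + Real.pi * N), ∑ l ∈ Finset.range N,
          (((Real.pi * N : ℝ) : ℂ)⁻¹ * ((Real.pi * N : ℝ) : ℂ)⁻¹ *
          Complex.exp (Complex.I * (freq N j * x - freq N l * w))) *
          Complex.exp ((Complex.I * (freq N l - freq N j)) * y) =
        ((Real.pi * N : ℝ) : ℂ)⁻¹ * Complex.exp (Complex.I * (freq N j : ℂ) * ((x - w : ℝ) : ℂ)) := by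
      intro j hj
      rw [intervalIntegral.integral_finsetSum fun l _ =>
        Continuous.intervalIntegrable (by fun_prop) _ _]
      rw [Finset.sum_eq_single_of_mem j hj]
      · rw [intervalIntegral.integral_const_mul]
        simp only [sub_self, mul_zero, zero_mul, Complex.exp_zero, intervalIntegral.integral_const,
          add_sub_cancel_left, Complex.real_smul, mul_one]
        have hne : ((Real.pi * N : ℝ) : ℂ) ≠ 0 := by push_cast; exact mul_ne_zero hpi hN'
        rw [mul_right_comm, inv_mul_cancel_right₀ hne]
        congr 2
        push_cast
        ring
      · intro l _ hlj
        rw [intervalIntegral.integral_const_mul]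
        refine mul_eq_zero_of_right _ ?_
        have hd : (freq N l : ℂ) - freq N j = 2 * ((l : ℂ) - j) / N := by
          rw [freq, freq]; push_cast; field_simp; ring
        have hlj' : (l : ℂ) - j ≠ 0 := sub_ne_zero.mpr (Nat.cast_injective.ne hlj)
        have hne : Complex.I * ((freq N l : ℂ) - freq N j) ≠ 0 := by
          rw [hd]
          exact mul_ne_zero Complex.I_ne_zero (div_ne_zero (mul_ne_zero two_ne_zero hlj') hN')
        rw [integral_exp_mul_complex hne]
        refine div_eq_zero_iff.mpr (Or.inl ?_)
        rw [Complex.ofReal_add, mul_add, Complex.exp_add]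
        have hper : Complex.exp (Complex.I * ((freq N l : ℂ) - freq N j) *
            ((Real.pi * N : ℝ) : ℂ)) = 1 := by
          rw [hd]
          have := Complex.exp_int_mul_two_pi_mul_I ((l : ℤ) - j)
          rw [← this]
          congr 1
          push_cast
          field_simp
        rw [hper, mul_one, sub_self]
    rw [Finset.sum_congr rfl h2, ← Finset.mul_sum, ← expSum_ofReal, expSum]
  exact_mod_cast hc

theorem sineKer_sin {N : ℕ} (hN : N ≠ 0) (x : ℝ) :
    Real.sin x = N * Real.sin (x / N) * (Real.pi * sineKer N x) := by
  have hN' : (N : ℂ) ≠ 0 := Nat.cast_ne_zero.mpr hN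
  have h1 := sincSqrt_sq_mul (x : ℂ)
  have h2 := sincSqrt_sq_mul ((x : ℂ) / N)
  rw [sincSqrt_eq_mul_expSum hN, expSum_ofReal] at h1
  rw [div_pow, show (x : ℂ) ^ 2 / (N : ℂ) ^ 2 = 1 / (N : ℂ) ^ 2 * (x : ℂ) ^ 2 by ring] at h2
  have h3 : Complex.sin x = N * Complex.sin ((x : ℂ) / N) * (Real.pi * sineKer N x) := by
    rw [← h1, ← h2]
    field_simp
  exact_mod_cast h3

/-- At these points `sin x` vanishes while `sin (x/N)` does not. They serve as centres of the trial
functions. -/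
theorem sineKer_pi_mul {N l : ℕ} (hl : 0 < l) (hlN : l < N) : sineKer N (Real.pi * l) = 0 := by
  have hN : N ≠ 0 := by lia
  have h := sineKer_sin hN (Real.pi * l)
  rw [mul_comm Real.pi, Real.sin_nat_mul_pi] at h
  have hlN' : (l : ℝ) < N := by exact_mod_cast hlN
  have hN0 : (0 : ℝ) < N := by positivity
  have hs : 0 < Real.sin (l * Real.pi / N) := by
    refine Real.sin_pos_of_pos_of_lt_pi (by positivity) ?_
    rw [div_lt_iff₀ hN0, mul_comm]
    exact mul_lt_mul_of_pos_left hlN' Real.pi_pos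
  rw [mul_comm Real.pi]
  have h2 := h.symm
  have hpi := Real.pi_pos
  have h3 : (N : ℝ) * Real.sin (l * Real.pi / N) * Real.pi ≠ 0 := by positivity
  rw [← mul_assoc] at h2
  exact (mul_eq_zero.mp h2).resolve_left h3

/-- Jordan's inequality `sin y ≥ 2y/π` bounds the denominator on half a period, giving `|S_N(x)| ≤
1/(2x)` uniformly in `N`. -/
theorem sineKer_sq_le {N : ℕ} (hN : N ≠ 0) {x : ℝ} (hx0 : 0 < x) (hx : x ≤ Real.pi * N / 2) :
    sineKer N x ^ 2 ≤ 1 / (4 * x ^ 2) := by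
  have hN0 : (0 : ℝ) < N := by positivity
  have h := sineKer_sin hN x
  have hs : 2 / Real.pi * (x / N) ≤ Real.sin (x / N) := by
    refine Real.mul_le_sin (by positivity) ?_
    rw [div_le_iff₀ hN0]
    linarith
  have h1 : |Real.sin x| ≤ 1 := Real.abs_sin_le_one x
  have hpi := Real.pi_pos
  have hs' : 2 * x ≤ N * Real.sin (x / N) * Real.pi := by
    have := mul_le_mul_of_nonneg_left hs (mul_pos hN0 hpi).le
    calc 2 * x = N * Real.pi * (2 / Real.pi * (x / N)) := by field_simp
      _ ≤ _ := this
      _ = _ := by ring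
  have h2 : 2 * x * |sineKer N x| ≤ 1 := by
    calc 2 * x * |sineKer N x| ≤ N * Real.sin (x / N) * Real.pi * |sineKer N x| := by gcongr
      _ = |Real.sin x| := by
        rw [h, abs_mul, abs_mul, abs_mul, abs_of_pos hpi, abs_of_pos hN0,
          abs_of_nonneg (le_trans (by positivity) hs)]
        ring
      _ ≤ 1 := h1
  rw [← sq_abs, le_div_iff₀ (by positivity)]
  have h3 : 0 ≤ 2 * x * |sineKer N x| := by positivity
  nlinarith

end

noncomputable section

/-! ### Smallness of the determinant on long intervals -/

/-- All frequencies lie in `[-1, 1]`, so the growth off the real axis is bounded independently of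
`N`. -/
theorem norm_expSum_le (N : ℕ) (z : ℂ) : ‖expSum N z‖ ≤ Real.exp |z.im| / Real.pi := by
  rcases Nat.eq_zero_or_pos N with rfl | hN
  · simp only [expSum, Finset.range_zero, Finset.sum_empty, mul_zero, norm_zero]
    positivity
  have hN0 : (0 : ℝ) < N := by exact_mod_cast hN
  have hpi := Real.pi_pos
  rw [expSum, norm_mul, norm_inv, Complex.norm_real, Real.norm_of_nonneg (by positivity)]
  have h1 : ‖∑ j ∈ Finset.range N, Complex.exp (Complex.I * (freq N j : ℂ) * z)‖ ≤
      N * Real.exp |z.im| := by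
    refine (norm_sum_le _ _).trans ((Finset.sum_le_card_nsmul _ _ (Real.exp |z.im|)
      fun j hj => ?_).trans (by simp))
    rw [Complex.norm_exp]
    refine Real.exp_le_exp.mpr ?_
    have hre : (Complex.I * (freq N j : ℂ) * z).re = -(freq N j * z.im) := by
      simp [Complex.mul_re, mul_comm]
    have hf : |freq N j| ≤ 1 := by
      have hj' : (j : ℝ) + 1 ≤ N := by exact_mod_cast Finset.mem_range.mp hj
      rw [freq, abs_div, abs_of_pos hN0, div_le_one hN0, abs_le]
      constructor <;> [skip; skip] <;> have : (0 : ℝ) ≤ j := by positivity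
      · linarith
      · linarith
    rw [hre]
    calc -(freq N j * z.im) ≤ |freq N j * z.im| := neg_le_abs _
      _ = |freq N j| * |z.im| := abs_mul _ _
      _ ≤ 1 * |z.im| := by gcongr
      _ = |z.im| := one_mul _
  rw [inv_mul_le_iff₀ (by positivity)]
  calc _ ≤ _ := h1
    _ = _ := by field_simp

theorem abs_sineKer_le (N : ℕ) (x : ℝ) : |sineKer N x| ≤ 1 / Real.pi := by
  have := norm_expSum_le N x
  rw [expSum_ofReal, Complex.norm_real, Complex.ofReal_im, abs_zero, Real.exp_zero] at this
  exact this

/-- The kernel of the projection conditioned at the origin. -/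
def condSine (N : ℕ) (x y : ℝ) : ℝ := sineKer N (x - y) - Real.pi * (sineKer N x * sineKer N y)

theorem condSine_symm (N : ℕ) (x y : ℝ) : condSine N x y = condSine N y x := by
  rw [condSine, condSine, ← sineKer_neg N (x - y), neg_sub, mul_comm (sineKer N x)]

theorem continuous_condSine (N : ℕ) : Continuous (Function.uncurry (condSine N)) := by
  have := continuous_sineKer N
  unfold condSine Function.uncurry
  fun_prop

theorem Continuous.condSine {X : Type*} [TopologicalSpace X] (N : ℕ) {f g : X → ℝ}
    (hf : Continuous f) (hg : Continuous g) : Continuous fun x => condSine N (f x) (g x) := by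
  have := continuous_sineKer N
  unfold CUEJanossy.condSine
  fun_prop

/-- Since `S_N(0) = 1/π`, the function `√π S_N` is a unit vector in the range of the projection; the
conditioned kernel removes exactly that direction. -/
theorem condSine_reproducing {N : ℕ} (hN : N ≠ 0) (α x w : ℝ) :
    ∫ y in α..(α + Real.pi * N), condSine N x y * condSine N y w = condSine N x w := by
  have hc := continuous_sineKer N
  have h1 : ∀ y, condSine N x y * condSine N y w =
      sineKer N (x - y) * sineKer N (y - w) -
      (Real.pi * sineKer N w) * (sineKer N (x - y) * sineKer N (y - 0)) -
      (Real.pi * sineKer N x) * (sineKer N (0 - y) * sineKer N (y - w)) +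
      (Real.pi ^ 2 * sineKer N x * sineKer N w) * (sineKer N (0 - y) * sineKer N (y - 0)) := by
    intro y
    rw [condSine, condSine, zero_sub, sub_zero, sineKer_neg]
    ring
  simp only [h1]
  rw [intervalIntegral.integral_add, intervalIntegral.integral_sub, intervalIntegral.integral_sub,
    intervalIntegral.integral_const_mul, intervalIntegral.integral_const_mul,
    intervalIntegral.integral_const_mul, sineKer_reproducing hN, sineKer_reproducing hN,
    sineKer_reproducing hN, sineKer_reproducing hN, sub_zero, sub_zero, zero_sub, sineKer_neg,
    sineKer_zero hN, condSine]
  · have := Real.pi_ne_zero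
    field_simp
    ring
  all_goals exact Continuous.intervalIntegrable (by fun_prop) _ _

/-- The normalized functions `√π S_N (x - c)`. -/
def unitSine (N : ℕ) (c x : ℝ) : ℝ := Real.sqrt Real.pi * sineKer N (x - c)

theorem continuous_unitSine (N : ℕ) (c : ℝ) : Continuous (unitSine N c) := by
  have := continuous_sineKer N
  unfold unitSine
  fun_prop

theorem abs_unitSine_le (N : ℕ) (c x : ℝ) : |unitSine N c x| ≤ 1 := by
  have h1 := abs_sineKer_le N (x - c)
  have hpi : 1 ≤ Real.pi := by linarith [Real.pi_gt_three]
  have hs : Real.sqrt Real.pi ≤ Real.pi := Real.sqrt_le_iff.mpr ⟨by positivity, by nlinarith⟩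
  rw [unitSine, abs_mul, abs_of_nonneg (Real.sqrt_nonneg _)]
  calc Real.sqrt Real.pi * |sineKer N (x - c)| ≤ Real.pi * (1 / Real.pi) := by gcongr
    _ = 1 := by field_simp

theorem unitSine_sq (N : ℕ) (c x : ℝ) : unitSine N c x ^ 2 = Real.pi * sineKer N (x - c) ^ 2 := by
  rw [unitSine, mul_pow, Real.sq_sqrt Real.pi_pos.le]

theorem integral_unitSine_sq {N : ℕ} (hN : N ≠ 0) (c α : ℝ) :
    ∫ x in α..(α + Real.pi * N), unitSine N c x ^ 2 = 1 := by
  have h1 : ∀ x, unitSine N c x ^ 2 = Real.pi * (sineKer N (c - x) * sineKer N (x - c)) := by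
    intro x
    rw [unitSine_sq, ← sineKer_neg N (c - x), neg_sub, sq]
  simp only [h1]
  rw [intervalIntegral.integral_const_mul, sineKer_reproducing hN, sub_self, sineKer_zero hN]
  have := Real.pi_ne_zero
  field_simp

/-- The condition `S_N(c) = 0` says that the translate centred at `c` is orthogonal to `S_N`, so it
stays in the range after conditioning at the origin. -/
theorem integral_unitSine_mul_condSine {N : ℕ} (hN : N ≠ 0) {c : ℝ} (hc : sineKer N c = 0)
    (α y : ℝ) :
    ∫ x in α..(α + Real.pi * N), unitSine N c x * condSine N x y = unitSine N c y := by
  have hcont := continuous_sineKer N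
  have h1 : ∀ x, unitSine N c x * condSine N x y = Real.sqrt Real.pi *
      (sineKer N (c - x) * sineKer N (x - y)) -
      (Real.sqrt Real.pi * Real.pi * sineKer N y) * (sineKer N (c - x) * sineKer N (x - 0)) := by
    intro x
    rw [unitSine, condSine, sub_zero, ← sineKer_neg N (c - x), neg_sub]
    ring
  simp only [h1]
  rw [intervalIntegral.integral_sub, intervalIntegral.integral_const_mul,
    intervalIntegral.integral_const_mul, sineKer_reproducing hN, sineKer_reproducing hN, sub_zero,
    hc, mul_zero, sub_zero, unitSine, ← sineKer_neg N (c - y), neg_sub]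
  all_goals exact Continuous.intervalIntegrable (by fun_prop) _ _

/-- The total mass over a period is `1`, and the bound `π/(4x²)` for the density gives each of the
two tails mass at most `π/(4d)`. -/
theorem one_sub_le_integral_unitSine_sq {N : ℕ} (hN : N ≠ 0) (c : ℝ) {d : ℝ} (hd : 0 < d)
    (hdN : d ≤ Real.pi * N / 2) :
    1 - Real.pi / (2 * d) ≤ ∫ x in (c - d)..(c + d), unitSine N c x ^ 2 := by
  have hcont := continuous_sineKer N
  have hpi := Real.pi_pos
  set R := Real.pi * N / 2 with hR
  have h0 : ∫ x in (c - d)..(c + d), unitSine N c x ^ 2 =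
      ∫ x in (-d)..d, Real.pi * sineKer N x ^ 2 := by
    simp only [unitSine_sq]
    rw [intervalIntegral.integral_comp_sub_right (fun x => Real.pi * sineKer N x ^ 2)]
    congr 1 <;> ring
  have h1 : ∫ x in (-R)..R, Real.pi * sineKer N x ^ 2 = 1 := by
    have := integral_unitSine_sq hN 0 (-R)
    simp only [unitSine_sq, sub_zero] at this
    rw [← this]
    congr 1
    rw [hR]; ring
  have hint : ∀ a b, IntervalIntegrable (fun x => Real.pi * sineKer N x ^ 2) volume a b :=
    fun a b => Continuous.intervalIntegrable (by fun_prop) _ _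
  have h2 : ∫ x in (-R)..(-d), Real.pi * sineKer N x ^ 2 = ∫ x in d..R, Real.pi * sineKer N x ^ 2 := by
    have := intervalIntegral.integral_comp_neg (a := d) (b := R)
      (fun x => Real.pi * sineKer N x ^ 2)
    rw [← this]
    simp only [sineKer_neg]
  have h3 : ∫ x in d..R, Real.pi * sineKer N x ^ 2 ≤ Real.pi / (4 * d) := by
    have h4 : ∫ x in d..R, Real.pi / 4 * (x ^ 2)⁻¹ = Real.pi / 4 * (d⁻¹ - R⁻¹) := by
      rw [intervalIntegral.integral_const_mul]
      congr 1
      have hne : ∀ x ∈ Set.uIcc d R, x ≠ 0 := fun x hx => by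
        rw [Set.uIcc_of_le hdN] at hx
        exact (hd.trans_le hx.1).ne'
      rw [intervalIntegral.integral_eq_sub_of_hasDerivAt (f := fun x => -x⁻¹)
        (f' := fun x => (x ^ 2)⁻¹)]
      · ring
      · intro x hx
        have := (hasDerivAt_inv (hne x hx)).neg
        rwa [neg_neg] at this
      · refine ContinuousOn.intervalIntegrable ?_
        exact (continuousOn_id.pow 2).inv₀ fun x hx => pow_ne_zero 2 (hne x hx)
    have hR0 : 0 < R := hd.trans_le hdN
    calc ∫ x in d..R, Real.pi * sineKer N x ^ 2 ≤ ∫ x in d..R, Real.pi / 4 * (x ^ 2)⁻¹ := by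
          refine intervalIntegral.integral_mono_on hdN (hint _ _) ?_ fun x hx => ?_
          · refine ContinuousOn.intervalIntegrable ?_
            refine continuousOn_const.mul ((continuousOn_id.pow 2).inv₀ fun x hx => pow_ne_zero 2 ?_)
            rw [Set.uIcc_of_le hdN] at hx
            exact (hd.trans_le hx.1).ne'
          · have := sineKer_sq_le hN (hd.trans_le hx.1) hx.2
            calc Real.pi * sineKer N x ^ 2 ≤ Real.pi * (1 / (4 * x ^ 2)) := by gcongr
              _ = _ := by rw [one_div, mul_inv]; ring
      _ = Real.pi / 4 * (d⁻¹ - R⁻¹) := h4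
      _ ≤ Real.pi / 4 * d⁻¹ := by
          gcongr
          have : 0 < R⁻¹ := inv_pos.mpr hR0
          linarith
      _ = Real.pi / (4 * d) := by field_simp
  have h5 := intervalIntegral.integral_add_adjacent_intervals (hint (-R) (-d)) (hint (-d) d)
  have h6 := intervalIntegral.integral_add_adjacent_intervals (hint (-R) d) (hint d R)
  have h7 : Real.pi / (2 * d) = Real.pi / (4 * d) + Real.pi / (4 * d) := by field_simp; ring
  rw [h0, h7]
  linarith

theorem unitInterval_integral_eq {f : ℝ → ℝ} :
    ∫ t : unitInterval, f t = ∫ x in (0 : ℝ)..1, f x := by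
  rw [intervalIntegral.integral_of_le zero_le_one, ← integral_Icc_eq_integral_Ioc]
  exact unitInterval.measurePreserving_coe.integral_comp unitInterval.measurableEmbedding_coe f

theorem mul_integral_unitInterval (g : ℝ → ℝ) (α β : ℝ) :
    ∫ t : unitInterval, (β - α) * g (α + (β - α) * t) = ∫ x in α..β, g x := by
  rw [integral_const_mul, unitInterval_integral_eq (f := fun t => g (α + (β - α) * t))]
  have := intervalIntegral.smul_integral_comp_add_mul (a := 0) (b := 1) g (β - α) α
  rw [smul_eq_mul] at this
  rw [this]
  congr 1 <;> ring

theorem continuousAt_indicator_Ioo {e : ℝ → ℝ} (he : Continuous e) {c d x : ℝ} (hc : x ≠ c)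
    (hd : x ≠ d) : ContinuousAt ((Set.Ioo c d).indicator e) x := by
  by_cases hx : x ∈ Set.Ioo c d
  · refine he.continuousAt.congr ?_
    filter_upwards [isOpen_Ioo.mem_nhds hx] with y hy
    rw [Set.indicator_of_mem hy]
  · have hx' : x ∈ (Set.Icc c d)ᶜ := by
      intro h
      exact hx ⟨lt_of_le_of_ne h.1 hc.symm, lt_of_le_of_ne h.2 hd⟩
    refine (continuousAt_const (y := (0 : ℝ))).congr ?_
    filter_upwards [isClosed_Icc.isOpen_compl.mem_nhds hx'] with y hy
    rw [Set.indicator_of_notMem fun h => hy (Set.Ioo_subset_Icc_self h)]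

/-- The Carleman exponent of kernels close to a symmetric contraction. -/
theorem carleman_exponent_le_of_close {k₀ : unitInterval → unitInterval → ℝ}
    (hk₀c : Continuous fun p : unitInterval × unitInterval => k₀ p.1 p.2)
    (h2 : ∀ x, ∫ y, k₀ x y ^ 2 ≤ k₀ x x) {k : KernelSpace} {δ : ℝ} (hδ1 : δ ≤ 1)
    (hk : ∀ s t : unitInterval, ‖k (s, t) - (k₀ s t : ℂ)‖ ≤ δ) :
    (∫ x, ∫ y, ‖k (x, y)‖ ^ 2) - 2 * (∫ x, k (x, x)).re ≤ 5 := by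
  have hint : ∀ f : unitInterval → ℝ, Continuous f → Integrable f := fun f hf =>
    hf.integrable_of_hasCompactSupport (HasCompactSupport.of_compactSpace _)
  have hk₀x : ∀ x, Continuous (k₀ x) := fun x => hk₀c.comp (by fun_prop : Continuous fun y => (x, y))
  have hdiag : Continuous fun x => k₀ x x :=
    hk₀c.comp (by fun_prop : Continuous fun x : unitInterval => (x, x))
  have h1 : ∀ x y, ‖k (x, y)‖ ^ 2 ≤ 3 / 2 * k₀ x y ^ 2 + 3 := by
    intro x y
    have h2 : ‖k (x, y)‖ ≤ |k₀ x y| + δ := by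
      have := norm_add_le (k (x, y) - (k₀ x y : ℂ)) (k₀ x y : ℂ)
      rw [sub_add_cancel, Complex.norm_real, Real.norm_eq_abs] at this
      linarith [hk x y]
    have h3 : ‖k (x, y)‖ ^ 2 ≤ (|k₀ x y| + δ) ^ 2 := pow_le_pow_left₀ (norm_nonneg _) h2 2
    rw [← sq_abs (k₀ x y)]
    have hδ0 : 0 ≤ δ := (norm_nonneg _).trans (hk x y)
    -- The square yields `(|k₀| + δ)² ≤ (3/2) k₀² + 3 δ²`. A factor below `2` is essential: the
    -- trace term must still dominate.
    nlinarith [sq_nonneg (|k₀ x y| - 2 * δ), abs_nonneg (k₀ x y)]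
  have hkc : Continuous fun p : unitInterval × unitInterval => ‖k p‖ ^ 2 := by fun_prop
  have h3 : ∫ x, ∫ y, ‖k (x, y)‖ ^ 2 ≤ 3 / 2 * (∫ x, k₀ x x) + 3 := by
    have h4 : ∀ x, ∫ y, ‖k (x, y)‖ ^ 2 ≤ 3 / 2 * k₀ x x + 3 := by
      intro x
      have h5 : ∫ y, ‖k (x, y)‖ ^ 2 ≤ ∫ y, (3 / 2 * k₀ x y ^ 2 + 3) := by
        refine integral_mono (hint _ (hkc.comp (by fun_prop : Continuous fun y => (x, y))))
          (hint _ ?_) (h1 x)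
        have := hk₀x x
        fun_prop
      rw [integral_add (hint _ (by have := hk₀x x; fun_prop)) (integrable_const _),
        integral_const_mul] at h5
      simp only [integral_const, probReal_univ, smul_eq_mul, one_mul] at h5
      linarith [h2 x]
    have h5 : ∫ x, ∫ y, ‖k (x, y)‖ ^ 2 ≤ ∫ x, (3 / 2 * k₀ x x + 3) := by
      refine integral_mono_of_nonneg (Eventually.of_forall fun x =>
        integral_nonneg fun y => by positivity) (hint _ (by fun_prop)) (Eventually.of_forall h4)
    rw [integral_add (hint _ (by fun_prop)) (integrable_const _), integral_const_mul] at h5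
    simpa using h5
  have h4 : (∫ x, k₀ x x) - 1 ≤ (∫ x, k (x, x)).re := by
    have hkd : Continuous fun x => k (x, x) := by fun_prop
    have hki : Integrable fun x => k (x, x) := hkd.integrable_of_hasCompactSupport
      (HasCompactSupport.of_compactSpace _)
    have h5 : (∫ x, k (x, x)).re = ∫ x, (k (x, x)).re := by
      have := Complex.reCLM.integral_comp_comm hki
      exact this.symm
    rw [h5]
    have h6 : ∫ x, (k₀ x x - 1) ≤ ∫ x, (k (x, x)).re := by
      refine integral_mono (hint _ (by fun_prop)) (hint _ (by fun_prop)) fun x => ?_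
      have := (Complex.abs_re_le_norm _).trans (hk x x)
      rw [Complex.sub_re, Complex.ofReal_re, abs_le] at this
      linarith [this.1]
    rw [integral_sub (hint _ hdiag) (integrable_const _)] at h6
    simpa using h6
  -- With `τ` the trace of `k₀`, the exponent is at most `(3/2) τ + 3 - 2(τ - 1) = 5 - τ/2`, bounded
  -- independently of the interval length.
  have h5 : 0 ≤ ∫ x, k₀ x x := integral_nonneg fun x =>
    (integral_nonneg fun y => sq_nonneg _).trans (h2 x)
  linarith

/-- The kernel of the conditioned projection on `[α, β]`, rescaled to the unit square. -/
def condSineUnit (N : ℕ) (α β : ℝ) (s t : unitInterval) : ℝ :=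
  (β - α) * condSine N (α + (β - α) * s) (α + (β - α) * t)

theorem continuous_condSineUnit (N : ℕ) (α β : ℝ) :
    Continuous fun p : unitInterval × unitInterval => condSineUnit N α β p.1 p.2 :=
  continuous_const.mul (Continuous.condSine N (by fun_prop) (by fun_prop))

/-- Over a full period the integral of the square is the diagonal value, by the reproducing
property; restriction to a shorter interval only decreases it. -/
theorem integral_condSineUnit_sq_le {N : ℕ} (hN : N ≠ 0) {α β : ℝ} (hαβ : α ≤ β)
    (hβ : β ≤ α + Real.pi * N) (x : unitInterval) :
    ∫ y, condSineUnit N α β x y ^ 2 ≤ condSineUnit N α β x x := by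
  have h3 : ∀ y : unitInterval, condSineUnit N α β x y ^ 2 =
      (β - α) * ((β - α) * condSine N (α + (β - α) * x) (α + (β - α) * y) ^ 2) := by
    intro y; rw [condSineUnit]; ring
  simp only [h3]
  rw [integral_const_mul]
  refine mul_le_mul_of_nonneg_left ?_ (sub_nonneg.mpr hαβ)
  rw [mul_integral_unitInterval (fun y => condSine N (α + (β - α) * x) y ^ 2)]
  refine (intervalIntegral_le_of_subset ?_ (fun y => sq_nonneg _) le_rfl hαβ hβ).trans
    (le_of_eq ?_)
  · exact (Continuous.condSine N continuous_const continuous_id).pow 2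
  · rw [← condSine_reproducing hN α (α + (β - α) * x) (α + (β - α) * x)]
    refine intervalIntegral.integral_congr fun y _ => ?_
    rw [condSine_symm N y, sq]

end

/-! ### Trial functions on disjoint windows and the resulting determinant bound -/

noncomputable section

/-- The truncated shifted sine kernel, rescaled to the unit interval. -/
def trialFun (N : ℕ) (α β c d : ℝ) (t : unitInterval) : ℝ :=
  Real.sqrt (β - α) * (Set.Ioo (c - d) (c + d)).indicator (unitSine N c) (α + (β - α) * t)

theorem abs_trialFun_le (N : ℕ) (α β c d : ℝ) (t : unitInterval) :
    |trialFun N α β c d t| ≤ Real.sqrt (β - α) := by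
  rw [trialFun, abs_mul, abs_of_nonneg (Real.sqrt_nonneg _)]
  refine mul_le_of_le_one_right (Real.sqrt_nonneg _) ?_
  by_cases h : α + (β - α) * t ∈ Set.Ioo (c - d) (c + d)
  · rw [Set.indicator_of_mem h]; exact abs_unitSine_le N c _
  · rw [Set.indicator_of_notMem h]; simp

theorem ae_continuousAt_trialFun (N : ℕ) {α β : ℝ} (hαβ : α < β) (c d : ℝ) :
    ∀ᵐ t, ContinuousAt (trialFun N α β c d) t := by
  have h1 : ∀ e : ℝ, ∀ᵐ t : unitInterval, α + (β - α) * t ≠ e := by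
    intro e
    have hs : Set.Subsingleton {t : unitInterval | α + (β - α) * t = e} := by
      intro s hs t ht
      have h2 : (β - α) * s = (β - α) * t := by
        have h3 : α + (β - α) * s = e := hs
        have h4 : α + (β - α) * t = e := ht
        linarith
      exact Subtype.ext (mul_left_cancel₀ (sub_pos.mpr hαβ).ne' h2)
    have := hs.measure_zero (volume : Measure unitInterval)
    rw [ae_iff]
    simpa using this
  filter_upwards [h1 (c - d), h1 (c + d)] with t h2 h3
  refine continuousAt_const.mul ?_
  exact (continuousAt_indicator_Ioo (continuous_unitSine N c) h2 h3).comp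
    (f := fun t : unitInterval => α + (β - α) * (t : ℝ))
    (by fun_prop : Continuous fun t : unitInterval => α + (β - α) * (t : ℝ)).continuousAt

theorem trialFun_mul_of_disjoint (N : ℕ) (α β : ℝ) {c c' d : ℝ}
    (h : Disjoint (Set.Ioo (c - d) (c + d)) (Set.Ioo (c' - d) (c' + d))) (t : unitInterval) :
    trialFun N α β c d t * trialFun N α β c' d t = 0 := by
  rw [trialFun, trialFun]
  by_cases h1 : α + (β - α) * t ∈ Set.Ioo (c - d) (c + d)
  · rw [Set.indicator_of_notMem (Set.disjoint_left.mp h h1)]; simp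
  · rw [Set.indicator_of_notMem h1]; simp

theorem integral_trialFun_sq (N : ℕ) {α β c d : ℝ} (hd : 0 < d) (h1 : α ≤ c - d)
    (h2 : c + d ≤ β) :
    ∫ t, trialFun N α β c d t ^ 2 = ∫ x in (c - d)..(c + d), unitSine N c x ^ 2 := by
  have h3 : ∀ t : unitInterval, trialFun N α β c d t ^ 2 = (β - α) *
      (Set.Ioo (c - d) (c + d)).indicator (fun x => unitSine N c x ^ 2) (α + (β - α) * t) := by
    intro t
    rw [trialFun, mul_pow, Real.sq_sqrt (by linarith)]
    by_cases h : α + (β - α) * t ∈ Set.Ioo (c - d) (c + d)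
    · rw [Set.indicator_of_mem h, Set.indicator_of_mem h]
    · rw [Set.indicator_of_notMem h, Set.indicator_of_notMem h]; simp
  simp only [h3]
  rw [mul_integral_unitInterval, intervalIntegral_indicator_Ioo _ h1 (by linarith) h2]

theorem integrable_trialFun_mul (N : ℕ) {α β : ℝ} (c d : ℝ) (g : C(unitInterval, ℂ)) :
    Integrable fun t => g t * (trialFun N α β c d t : ℂ) := by
  have hm : Measurable (trialFun N α β c d) := by
    have h1 : Measurable ((Set.Ioo (c - d) (c + d)).indicator (unitSine N c)) :=
      (continuous_unitSine N c).measurable.indicator measurableSet_Ioo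
    exact measurable_const.mul (h1.comp (by fun_prop))
  refine Integrable.of_bound (C := ‖g‖ * Real.sqrt (β - α)) ?_ (Eventually.of_forall fun t => ?_)
  · exact (g.continuous.measurable.mul (Complex.measurable_ofReal.comp hm)).aestronglyMeasurable
  · rw [norm_mul, Complex.norm_real, Real.norm_eq_abs]
    exact mul_le_mul (g.norm_coe_le_norm t) (abs_trialFun_le N α β c d t) (abs_nonneg _)
      (norm_nonneg _)

/-- The defect splits into that of the exact projection, with squared norm at most `π/(2d)`, and a
perturbation bounded by `δ`. The inequality `(x + y)² ≤ 2x² + 2y²` gives the two terms. -/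
theorem integral_norm_defect_sq_le {N : ℕ} (hN : N ≠ 0) {α β c d δ : ℝ}
    (hβ : β ≤ α + Real.pi * N) (hc : sineKer N c = 0) (hd : 0 < d) (hdN : d ≤ Real.pi * N / 2)
    (h1 : α ≤ c - d) (h2 : c + d ≤ β) {k : KernelSpace}
    (hk : ∀ s t : unitInterval, ‖k (s, t) - (condSineUnit N α β s t : ℂ)‖ ≤ δ) :
    ∫ s, ‖defect k (trialFun N α β c d) s‖ ^ 2 ≤ Real.pi / d + 2 * δ ^ 2 := by
  have hαβ : α ≤ β := by linarith
  set φ := trialFun N α β c d with hφ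
  set f := (Set.Ioo (c - d) (c + d)).indicator (unitSine N c) with hf
  set u : ℝ → ℝ := fun x => ∫ y in (c - d)..(c + d), condSine N x y * unitSine N c y with hu
  have hle1 : ∫ t, φ t ^ 2 ≤ 1 := by
    rw [hφ, integral_trialFun_sq N hd h1 h2, ← integral_unitSine_sq hN c α]
    exact intervalIntegral_le_of_subset ((continuous_unitSine N c).pow 2) (fun x => sq_nonneg _)
      h1 (by linarith) (by linarith)
  have hφi : Integrable fun t => |φ t| := by
    have := (integrable_trialFun_mul N (α := α) (β := β) c d 1).norm
    simpa using this
  have hφ2i : Integrable fun t => φ t ^ 2 := by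
    have hc2 := (hφi.mul_bdd (c := Real.sqrt (β - α)) (g := fun t => |φ t|) hφi.1
      (Eventually.of_forall fun t => by
        simpa using abs_trialFun_le N α β c d t))
    refine hc2.congr (Eventually.of_forall fun t => ?_)
    simp [← sq]
  have hle2 : ∫ t, |φ t| ≤ 1 := by
    have h3 : ∫ t, |φ t| ≤ ∫ t, (1 / 2 + 1 / 2 * φ t ^ 2) := by
      refine integral_mono hφi ((integrable_const _).add (hφ2i.const_mul _)) fun t => ?_
      simp only
      nlinarith [sq_nonneg (|φ t| - 1), sq_abs (φ t)]
    rw [integral_add (integrable_const _) (hφ2i.const_mul _), integral_const_mul] at h3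
    simp only [integral_const, probReal_univ, smul_eq_mul, one_mul] at h3
    linarith
  have hmain : ∀ s : unitInterval, ‖defect k φ s‖ ^ 2 ≤
      2 * ((β - α) * (f (α + (β - α) * s) - u (α + (β - α) * s)) ^ 2) + 2 * δ ^ 2 := by
    intro s
    have hks : Continuous fun t => k (s, t) := by fun_prop
    have hk0 : Continuous fun t => condSineUnit N α β s t :=
      continuous_const.mul (Continuous.condSine N continuous_const (by fun_prop))
    have hk0' : Continuous fun t => (condSineUnit N α β s t : ℂ) :=
      Complex.continuous_ofReal.comp hk0
    have hi1 : Integrable fun t => k (s, t) * (φ t : ℂ) :=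
      integrable_trialFun_mul N (α := α) (β := β) c d ⟨fun t => k (s, t), hks⟩
    have hi2 : Integrable fun t => (condSineUnit N α β s t : ℂ) * (φ t : ℂ) :=
      integrable_trialFun_mul N (α := α) (β := β) c d
        ⟨fun t => (condSineUnit N α β s t : ℂ), hk0'⟩
    have h3 : ∫ t, (condSineUnit N α β s t : ℂ) * (φ t : ℂ) =
        ((Real.sqrt (β - α) * u (α + (β - α) * s) : ℝ) : ℂ) := by
      have h4 : ∀ t : unitInterval, (condSineUnit N α β s t : ℂ) * (φ t : ℂ) =
          ((Real.sqrt (β - α) * ((β - α) * (Set.Ioo (c - d) (c + d)).indicator (fun y =>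
            condSine N (α + (β - α) * s) y * unitSine N c y) (α + (β - α) * t)) : ℝ) : ℂ) := by
        intro t
        rw [← Complex.ofReal_mul, hφ, trialFun, condSineUnit]
        congr 1
        by_cases h : α + (β - α) * t ∈ Set.Ioo (c - d) (c + d)
        · rw [Set.indicator_of_mem h, Set.indicator_of_mem h]
          ring
        · rw [Set.indicator_of_notMem h, Set.indicator_of_notMem h]
          ring
      simp only [h4]
      rw [integral_complex_ofReal, integral_const_mul, mul_integral_unitInterval,
        intervalIntegral_indicator_Ioo _ h1 (by linarith) h2]
    have h5 : defect k φ s = ((Real.sqrt (β - α) * (f (α + (β - α) * s) -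
        u (α + (β - α) * s)) : ℝ) : ℂ) -
        ∫ t, (k (s, t) - (condSineUnit N α β s t : ℂ)) * (φ t : ℂ) := by
      simp only [sub_mul]
      rw [integral_sub hi1 hi2, h3, defect]
      have : φ s = Real.sqrt (β - α) * f (α + (β - α) * s) := rfl
      rw [this]
      push_cast
      ring_nf
    have h6 : ‖∫ t, (k (s, t) - (condSineUnit N α β s t : ℂ)) * (φ t : ℂ)‖ ≤ δ := by
      have hδ0 : 0 ≤ δ := (norm_nonneg _).trans (hk s s)
      calc _ ≤ ∫ t, δ * |φ t| := by
            refine norm_integral_le_of_norm_le (hφi.const_mul _) (Eventually.of_forall fun t => ?_)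
            rw [norm_mul, Complex.norm_real, Real.norm_eq_abs]
            exact mul_le_mul_of_nonneg_right (hk s t) (abs_nonneg _)
        _ = δ * ∫ t, |φ t| := integral_const_mul _ _
        _ ≤ δ := mul_le_of_le_one_right hδ0 hle2
    have h7 := norm_sub_le (((Real.sqrt (β - α) * (f (α + (β - α) * s) -
        u (α + (β - α) * s)) : ℝ) : ℂ))
        (∫ t, (k (s, t) - (condSineUnit N α β s t : ℂ)) * (φ t : ℂ))
    rw [← h5, Complex.norm_real] at h7
    set x := Real.sqrt (β - α) * (f (α + (β - α) * s) - u (α + (β - α) * s)) with hx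
    have h8 : x ^ 2 = (β - α) * (f (α + (β - α) * s) - u (α + (β - α) * s)) ^ 2 := by
      rw [hx, mul_pow, Real.sq_sqrt (sub_nonneg.mpr hαβ)]
    have h9 : ‖defect k φ s‖ ^ 2 ≤ (‖x‖ + δ) ^ 2 :=
      pow_le_pow_left₀ (norm_nonneg _) (by linarith) 2
    rw [← h8]
    have h10 : ‖x‖ ^ 2 = x ^ 2 := by rw [Real.norm_eq_abs, sq_abs]
    nlinarith [sq_nonneg (‖x‖ - δ)]
  have hucont : Continuous u := by
    refine intervalIntegral.continuous_parametric_intervalIntegral_of_continuous'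
      (f := fun x y => condSine N x y * unitSine N c y) ?_ _ _
    exact ((continuous_condSine N).mul ((continuous_unitSine N c).comp continuous_snd))
  have hgi : Integrable fun s : unitInterval =>
      (β - α) * (f (α + (β - α) * s) - u (α + (β - α) * s)) ^ 2 := by
    have hfm : Measurable f := (continuous_unitSine N c).measurable.indicator measurableSet_Ioo
    obtain ⟨M, hM⟩ := (isCompact_univ (X := unitInterval)).exists_bound_of_continuousOn
      (f := fun s : unitInterval => u (α + (β - α) * s))
      (hucont.comp (by fun_prop)).continuousOn
    refine Integrable.of_bound (C := (β - α) * (1 + M) ^ 2) ?_ (Eventually.of_forall fun s => ?_)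
    · refine Measurable.aestronglyMeasurable ?_
      have hl : Measurable fun s : unitInterval => α + (β - α) * (s : ℝ) := by fun_prop
      exact measurable_const.mul (((hfm.comp hl).sub (hucont.measurable.comp hl)).pow_const 2)
    · rw [norm_mul, norm_pow, Real.norm_of_nonneg (sub_nonneg.mpr hαβ)]
      have hf1 : ‖f (α + (β - α) * s)‖ ≤ 1 := by
        rw [hf]
        refine (norm_indicator_le_norm_self _ _).trans ?_
        exact abs_unitSine_le N c _
      have := norm_sub_le (f (α + (β - α) * s)) (u (α + (β - α) * s))
      have h11 := hM s (Set.mem_univ _)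
      exact mul_le_mul_of_nonneg_left (pow_le_pow_left₀ (norm_nonneg _) (by linarith) 2)
        (sub_nonneg.mpr hαβ)
  have hgint : ∫ s : unitInterval, (β - α) * (f (α + (β - α) * s) - u (α + (β - α) * s)) ^ 2 ≤
      1 - ∫ x in (c - d)..(c + d), unitSine N c x ^ 2 := by
    rw [mul_integral_unitInterval (fun x => (f x - u x) ^ 2)]
    exact integral_truncation_defect_le (continuous_condSine N) (continuous_unitSine N c)
      (condSine_symm N) (condSine_reproducing hN α) (integral_unitSine_sq hN c α)
      (integral_unitSine_mul_condSine hN hc α) h1 (by linarith) h2 hβ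
  calc ∫ s, ‖defect k φ s‖ ^ 2 ≤ ∫ s : unitInterval,
        (2 * ((β - α) * (f (α + (β - α) * s) - u (α + (β - α) * s)) ^ 2) + 2 * δ ^ 2) :=
        integral_mono_of_nonneg (Eventually.of_forall fun s => by positivity)
          ((hgi.const_mul 2).add (integrable_const _)) (Eventually.of_forall hmain)
    _ = 2 * (∫ s : unitInterval, (β - α) * (f (α + (β - α) * s) - u (α + (β - α) * s)) ^ 2) +
        2 * δ ^ 2 := by
        rw [integral_add (hgi.const_mul 2) (integrable_const _), integral_const_mul]
        simp
    _ ≤ Real.pi / d + 2 * δ ^ 2 := by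
        have h3 := one_sub_le_integral_unitSine_sq hN c hd hdN
        have h4 : Real.pi / d = 2 * (Real.pi / (2 * d)) := by field_simp
        rw [h4]
        linarith

/-- The Fredholm determinant of a kernel close to the conditioned projection is small if the
interval holds many zeros of the sine kernel. -/
theorem normSq_fredholmC_le_of_close {N : ℕ} (hN : N ≠ 0) {α β d δ s : ℝ} (hαβ : α ≤ β)
    (hβ : β ≤ α + Real.pi * N) {m : ℕ} (c : Fin m → ℝ) (hc : ∀ l, sineKer N (c l) = 0)
    (hd : Fin m → Real.pi ≤ d) (hdN : Fin m → d ≤ Real.pi * N / 2) (h1 : ∀ l, α ≤ c l - d)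
    (h2 : ∀ l, c l + d ≤ β) (hδ : δ ≤ 1) (hs : 0 ≤ s)
    (hdisj : ∀ l l', l ≠ l' → Disjoint (Set.Ioo (c l - d) (c l + d))
      (Set.Ioo (c l' - d) (c l' + d)))
    {k : KernelSpace}
    (hk : ∀ s t : unitInterval, ‖k (s, t) - (condSineUnit N α β s t : ℂ)‖ ≤ δ) :
    ‖fredholmC k‖ ^ 2 * ((1 + s / 2) ^ m) ^ 2 ≤
      Real.exp (5 + m * ((2 * s + s ^ 2) * (Real.pi / d + 2 * δ ^ 2))) := by
  have hd0 : Fin m → 0 < d := fun l => Real.pi_pos.trans_le (hd l)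
  -- The half-width `d ≥ π` makes the lost mass `π/(2d)` at most one half.
  have hlow : ∀ l, 1 / 2 ≤ ∫ x, trialFun N α β (c l) d x ^ 2 := by
    intro l
    rw [integral_trialFun_sq N (hd0 l) (h1 l) (h2 l)]
    refine le_trans ?_ (one_sub_le_integral_unitSine_sq hN (c l) (hd0 l) (hdN l))
    have : Real.pi / (2 * d) ≤ 1 / 2 := by
      have := hd0 l
      rw [div_le_div_iff₀ (by positivity) (by norm_num)]
      linarith [hd l]
    linarith
  have hup : ∀ l, ∫ x, trialFun N α β (c l) d x ^ 2 ≤ 1 := by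
    intro l
    rw [integral_trialFun_sq N (hd0 l) (h1 l) (h2 l), ← integral_unitSine_sq hN (c l) α]
    exact intervalIntegral_le_of_subset ((continuous_unitSine N _).pow 2) (fun x => sq_nonneg _)
      (h1 l) (by linarith [hd0 l]) (by linarith [h2 l])
  have hkey := normSq_fredholmC_mul_le k (fun l => trialFun N α β (c l) d)
    (C := Real.sqrt (β - α)) (fun l x => abs_trialFun_le N α β (c l) d x)
    (fun l => ae_continuousAt_trialFun N (by linarith [h1 l, h2 l, hd0 l]) (c l) d)
    (fun l l' hl => by simp [trialFun_mul_of_disjoint N α β (hdisj l l' hl)]) s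
  have hcl := carleman_exponent_le_of_close (continuous_condSineUnit N α β)
    (integral_condSineUnit_sq_le hN hαβ hβ) hδ hk
  have hprod : (1 + s / 2) ^ m ≤ |∏ l : Fin m, (1 + s * ∫ x, trialFun N α β (c l) d x ^ 2)| := by
    rw [Finset.abs_prod]
    calc (1 + s / 2) ^ m = ∏ _l : Fin m, (1 + s / 2) := by simp
      _ ≤ _ := by
          refine Finset.prod_le_prod (fun l _ => by positivity) fun l _ => ?_
          refine le_trans ?_ (le_abs_self _)
          nlinarith [hlow l]
  refine (mul_le_mul_of_nonneg_left (pow_le_pow_left₀ (by positivity) hprod 2)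
    (sq_nonneg _)).trans (hkey.trans (Real.exp_le_exp.mpr (add_le_add hcl ?_)))
  have hsum : ∀ l : Fin m, (2 * s + s ^ 2 * ∫ x, trialFun N α β (c l) d x ^ 2) *
      ∫ x, ‖defect k (trialFun N α β (c l) d) x‖ ^ 2 ≤
      (2 * s + s ^ 2) * (Real.pi / d + 2 * δ ^ 2) := by
    intro l
    have := hd0 l
    refine mul_le_mul ?_ (integral_norm_defect_sq_le hN hβ (hc l) (hd0 l) (hdN l) (h1 l) (h2 l) hk)
      (integral_nonneg fun x => by positivity) (by positivity)
    nlinarith [hup l, sq_nonneg s]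
  calc _ ≤ ∑ _l : Fin m, (2 * s + s ^ 2) * (Real.pi / d + 2 * δ ^ 2) :=
        Finset.sum_le_sum fun l _ => hsum l
    _ = _ := by simp

end

/-! ### Decay faster than any power along a ray -/

noncomputable section

/-- Fredholm determinants of kernels close to the conditioned projection on `[-rb, b]` decay faster
than any power of `b`, uniformly in `N`. -/
theorem exists_norm_fredholmC_le {r : ℝ} (hr : 0 < r) (m : ℕ) :
    ∃ C : ℝ, 0 < C ∧ ∀ N : ℕ, N ≠ 0 → ∀ b : ℝ, 0 ≤ b → (1 + r) * b ≤ Real.pi * N →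
      ∀ k : KernelSpace,
        (∀ s t : unitInterval, ‖k (s, t) - (condSineUnit N (-(r * b)) b s t : ℂ)‖ ≤ 1 / (1 + b)) →
        ‖fredholmC k‖ ≤ C / (1 + b) ^ m := by
  set M := 2 * m with hM
  set K := Real.exp (5 + 9 * M) * (4 * (8 * Real.pi * M + 1)) ^ M with hK
  have hpi := Real.pi_pos
  have hK0 : 0 < K := by positivity
  refine ⟨Real.sqrt K, Real.sqrt_pos.mpr hK0, fun N hN b hb hbN k hk => ?_⟩
  have hα : -(r * b) ≤ b := by nlinarith [mul_nonneg hr.le hb]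
  have hβ : b ≤ -(r * b) + Real.pi * N := by linarith
  have hδ : 1 / (1 + b) ≤ 1 := by rw [div_le_one (by positivity)]; linarith
  have hfin : ‖fredholmC k‖ ^ 2 * (1 + b) ^ M ≤ K → ‖fredholmC k‖ ≤ Real.sqrt K / (1 + b) ^ m := by
    intro h
    rw [le_div_iff₀ (by positivity)]
    refine Real.le_sqrt_of_sq_le ?_
    rw [mul_pow, ← pow_mul, mul_comm m 2]
    exact h
  apply hfin
  -- The `M` windows of half-width `πl`, centred at `(2j+1)πl`, tile an interval from `0` to `2πMl ≤
  -- b/2`. The centres are zeros of the kernel because `2Ml < N`.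
  set l := ⌊b / (4 * Real.pi * M)⌋₊ with hl
  rcases Nat.eq_zero_or_pos l with hl0 | hl0
  -- If `l = 0`, then `b` is bounded in terms of `M`, and the estimate without any window, `|det|² ≤
  -- e⁵`, is enough.
  · have h1 := normSq_fredholmC_le_of_close hN (d := 0) (s := 0) hα hβ
      (m := 0) Fin.elim0 (fun i => i.elim0) Fin.elim0 Fin.elim0 (fun i => i.elim0)
      (fun i => i.elim0) hδ le_rfl (fun i => i.elim0) hk
    simp only [pow_zero, one_pow, mul_one, CharP.cast_eq_zero, zero_mul, add_zero] at h1
    have h2 : (1 + b) ^ M ≤ (4 * (8 * Real.pi * M + 1)) ^ M := by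
      rcases Nat.eq_zero_or_pos M with hM0 | hM0
      · rw [hM0, pow_zero, pow_zero]
      · have hM0' : (0 : ℝ) < M := by exact_mod_cast hM0
        have h3 := (Nat.floor_eq_zero.mp hl0)
        rw [div_lt_one (by positivity)] at h3
        refine pow_le_pow_left₀ (by positivity) ?_ M
        have : 0 < Real.pi * M := by positivity
        linarith
    exact mul_le_mul (h1.trans (Real.exp_le_exp.mpr (by linarith [Nat.cast_nonneg (α := ℝ) M]))) h2
      (by positivity) (by positivity)
  · have hM0 : 0 < M := by
      rcases Nat.eq_zero_or_pos M with h | h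
      · rw [hl, h] at hl0; simp at hl0
      · exact h
    have hM1 : (1 : ℝ) ≤ M := by exact_mod_cast hM0
    have hl1 : (1 : ℝ) ≤ l := by exact_mod_cast hl0
    have hl2 : (l : ℝ) * (4 * Real.pi * M) ≤ b := by
      rw [← le_div_iff₀ (by positivity)]
      exact Nat.floor_le (by positivity)
    have hl3 : b < (l + 1) * (4 * Real.pi * M) := by
      rw [← div_lt_iff₀ (by positivity)]
      exact Nat.lt_floor_add_one _
    have hbN' : b ≤ Real.pi * N := by nlinarith
    have hlM : 2 * M * l < N := by
      have h1 : Real.pi * (4 * M * l) ≤ Real.pi * N := by linarith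
      have h2 : (4 * M * l : ℝ) ≤ N := le_of_mul_le_mul_left h1 hpi
      have h3 : 4 * M * l ≤ N := by exact_mod_cast h2
      have : 0 < M * l := Nat.mul_pos hM0 hl0
      nlinarith
    have hlM' : (2 * M * l : ℝ) ≤ N := by exact_mod_cast hlM.le
    have hMl : (l : ℝ) ≤ M * l := by nlinarith
    have hj : ∀ j : Fin M, (j : ℝ) + 1 ≤ M := fun j => by exact_mod_cast j.2
    have h1 := normSq_fredholmC_le_of_close hN (d := Real.pi * l) (s := Real.sqrt l) hα hβ
      (m := M) (fun j => Real.pi * ((2 * j + 1) * l : ℕ))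
      (fun j => sineKer_pi_mul (Nat.mul_pos (by lia) hl0) (lt_of_le_of_lt
        (Nat.mul_le_mul_right l (by have := j.2; lia)) hlM))
      (fun _ => by nlinarith) (fun _ => by nlinarith)
      (fun j => by
        push_cast
        have : 0 ≤ Real.pi * (2 * (j : ℝ) * l) := by positivity
        nlinarith [mul_nonneg hr.le hb])
      (fun j => by
        push_cast
        have h2 : Real.pi * l * ((j : ℝ) + 1) ≤ Real.pi * l * M :=
          mul_le_mul_of_nonneg_left (hj j) (by positivity)
        nlinarith) hδ (Real.sqrt_nonneg _)
      (fun j j' hjj => by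
        have key : ∀ i i' : Fin M, i < i' →
            Disjoint (Set.Ioo (Real.pi * ((2 * i + 1) * l : ℕ) - Real.pi * l)
              (Real.pi * ((2 * i + 1) * l : ℕ) + Real.pi * l))
            (Set.Ioo (Real.pi * ((2 * i' + 1) * l : ℕ) - Real.pi * l)
              (Real.pi * ((2 * i' + 1) * l : ℕ) + Real.pi * l)) := by
          intro i i' hii
          refine Set.disjoint_left.mpr fun x hx hx' => ?_
          have h2 : (i : ℝ) + 1 ≤ i' := by exact_mod_cast hii
          have h3 : Real.pi * l * ((i : ℝ) + 1) ≤ Real.pi * l * i' :=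
            mul_le_mul_of_nonneg_left h2 (by positivity)
          have h4 := hx.2
          have h5 := hx'.1
          push_cast at h4 h5
          nlinarith
        rcases lt_or_gt_of_ne hjj with h | h
        · exact key j j' h
        · exact (key j' j h).symm) hk
    have hsq : Real.sqrt l ^ 2 = l := Real.sq_sqrt (by positivity)
    have hs1 : Real.sqrt l ≤ l := Real.sqrt_le_iff.mpr ⟨by positivity, by nlinarith⟩
    -- The choice `s = √l` balances both sides: defects of size `1/l` cost a bounded exponent, while
    -- each factor `(1 + s/2)²` is at least `l/4`.
    have hexp : (2 * Real.sqrt l + Real.sqrt l ^ 2) *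
        (Real.pi / (Real.pi * l) + 2 * (1 / (1 + b)) ^ 2) ≤ 9 := by
      have h2 : 1 / (1 + b) ≤ 1 / l := by
        refine one_div_le_one_div_of_le (by positivity) ?_
        nlinarith [Real.pi_gt_three]
      have h3 : (1 / (1 + b)) ^ 2 ≤ 1 / l := by
        have h4 : (0 : ℝ) ≤ 1 / (1 + b) := by positivity
        nlinarith
      have h4 : Real.pi / (Real.pi * l) = 1 / l := by field_simp
      rw [h4, hsq]
      calc (2 * Real.sqrt l + l) * (1 / l + 2 * (1 / (1 + b)) ^ 2)
          ≤ (3 * l) * (3 * (1 / l)) := by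
            refine mul_le_mul (by linarith) (by linarith) (by positivity) (by positivity)
        _ = 9 := by field_simp; norm_num
    have hexp' : Real.exp (5 + M * ((2 * Real.sqrt l + Real.sqrt l ^ 2) *
        (Real.pi / (Real.pi * l) + 2 * (1 / (1 + b)) ^ 2))) ≤ Real.exp (5 + 9 * M) := by
      refine Real.exp_le_exp.mpr ?_
      nlinarith
    -- Here `1 + b ≤ 1 + 4πM(l + 1) ≤ (8πM + 1) l`, which is `4(8πM + 1)` times `l/4`.
    have h2 : (1 + b) ^ M ≤ (4 * (8 * Real.pi * M + 1)) ^ M * ((1 + Real.sqrt l / 2) ^ M) ^ 2 := by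
      rw [pow_right_comm (1 + Real.sqrt l / 2) M 2, ← mul_pow]
      refine pow_le_pow_left₀ (by positivity) ?_ M
      have h3 : (l : ℝ) / 4 ≤ (1 + Real.sqrt l / 2) ^ 2 := by
        nlinarith [Real.sqrt_nonneg (l : ℝ)]
      have h5 : Real.pi * M ≤ Real.pi * M * l := le_mul_of_one_le_right (by positivity) hl1
      calc 1 + b ≤ (4 * (8 * Real.pi * M + 1)) * ((l : ℝ) / 4) := by linarith
        _ ≤ _ := mul_le_mul_of_nonneg_left h3 (by positivity)
    calc ‖fredholmC k‖ ^ 2 * (1 + b) ^ M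
        ≤ ‖fredholmC k‖ ^ 2 *
          ((4 * (8 * Real.pi * M + 1)) ^ M * ((1 + Real.sqrt l / 2) ^ M) ^ 2) := by gcongr
      _ = (‖fredholmC k‖ ^ 2 * ((1 + Real.sqrt l / 2) ^ M) ^ 2) *
          (4 * (8 * Real.pi * M + 1)) ^ M := by ring
      _ ≤ K := mul_le_mul_of_nonneg_right (h1.trans hexp') (by positivity)

end

/-! ### Persistence of the bounds on complex polydiscs -/

noncomputable section

theorem differentiable_expSum (N : ℕ) : Differentiable ℂ (expSum N) := by
  unfold expSum; fun_prop

theorem norm_expSum_le_one (N : ℕ) {z : ℂ} (hz : |z.im| ≤ 1) : ‖expSum N z‖ ≤ 1 := by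
  refine (norm_expSum_le N z).trans ?_
  rw [div_le_one Real.pi_pos]
  linarith [Real.exp_le_exp.mpr hz, Real.exp_one_lt_d9, Real.pi_gt_three]

/-- Cauchy's estimate on unit discs: there the imaginary part is at most `2`, so the derivative is
at most `e²/π < 3` on the strip. -/
theorem norm_expSum_sub_le (N : ℕ) {z w : ℂ} (hz : |z.im| ≤ 1) (hw : |w.im| ≤ 1) :
    ‖expSum N z - expSum N w‖ ≤ 3 * ‖z - w‖ := by
  have hconv : Convex ℝ {z : ℂ | |z.im| ≤ 1} := by
    have : {z : ℂ | |z.im| ≤ 1} = Complex.imCLM ⁻¹' Set.Icc (-1) 1 := by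
      ext z; simp [abs_le]
    rw [this]
    exact (convex_Icc _ _).linear_preimage Complex.imCLM.toLinearMap
  refine hconv.norm_image_sub_le_of_norm_deriv_le (fun x _ => (differentiable_expSum N).differentiableAt)
    (fun x hx => ?_) hw hz
  have h1 : ‖deriv (expSum N) x‖ ≤ 3 / 1 := by
    refine Complex.norm_deriv_le_of_forall_mem_sphere_norm_le one_pos
      (differentiable_expSum N).diffContOnCl fun y hy => ?_
    refine (norm_expSum_le N y).trans ?_
    rw [div_le_iff₀ Real.pi_pos]
    have h2 : |y.im| ≤ 2 := by
      have h3 : |(y - x).im| ≤ 1 := by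
        refine (Complex.abs_im_le_norm _).trans ?_
        rw [mem_sphere_iff_norm] at hy
        exact hy.le
      have h4 : y.im = (y - x).im + x.im := by simp
      rw [h4]
      have hx' : |x.im| ≤ 1 := hx
      linarith [abs_add_le (y - x).im x.im]
    have h5 : Real.exp 2 = Real.exp 1 * Real.exp 1 := by rw [← Real.exp_add]; norm_num
    have := Real.exp_le_exp.mpr h2
    nlinarith [Real.exp_one_lt_d9, Real.exp_pos 1, Real.pi_gt_three]
  simpa using h1

/-- The size of the polydiscs around real endpoints on which the bounds for real endpoints
persist. -/
def polyRadius (r b : ℝ) : ℝ := 1 / (100 * (2 + r) ^ 3 * (1 + b) ^ 4)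

theorem polyRadius_pos {r b : ℝ} (hr : 0 < r) (hb : 0 ≤ b) : 0 < polyRadius r b := by
  unfold polyRadius; positivity

theorem polyRadius_le_of_le {r b : ℝ} (hr : 0 < r) (hb : 0 ≤ b) :
    polyRadius r b ≤ 1 / 800 := by
  unfold polyRadius
  refine one_div_le_one_div_of_le (by norm_num) ?_
  have h1 : (2 : ℝ) ^ 3 ≤ (2 + r) ^ 3 := pow_le_pow_left₀ (by norm_num) (by linarith) 3
  have h2 : (1 : ℝ) ≤ (1 + b) ^ 4 := one_le_pow₀ (by linarith)
  nlinarith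

/-- The scale of `ε z²` on the polydisc. -/
def argScale (r b : ℝ) : ℝ := 1 / (100 * (2 + r) * (1 + b) ^ 2)

/-- Arguments of the kernel have modulus at most `(2+r)(1+b)` on the polydisc, so this identity
calibrates the radius to control `|ε z²|`. -/
theorem polyRadius_mul_sq {r b : ℝ} (hr : 0 < r) (hb : 0 ≤ b) :
    polyRadius r b * ((2 + r) * (1 + b)) ^ 2 = argScale r b := by
  unfold polyRadius argScale
  field_simp

theorem polyRadius_le_argScale {r b : ℝ} (hr : 0 < r) (hb : 0 ≤ b) :
    4 * polyRadius r b ≤ argScale r b := by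
  rw [← polyRadius_mul_sq hr hb, mul_comm]
  refine mul_le_mul_of_nonneg_left ?_ (polyRadius_pos hr hb).le
  nlinarith [mul_nonneg hr.le hb]

theorem argScale_pos {r b : ℝ} (hr : 0 < r) (hb : 0 ≤ b) : 0 < argScale r b := by
  unfold argScale; positivity

theorem argScale_le {r b : ℝ} (hr : 0 < r) (hb : 0 ≤ b) : argScale r b ≤ 1 / 200 := by
  unfold argScale
  refine one_div_le_one_div_of_le (by norm_num) ?_
  have h2 : (1 : ℝ) ≤ (1 + b) ^ 2 := one_le_pow₀ (by linarith)
  nlinarith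

theorem norm_kernel_sub_le {Λ η : ℝ} {L U V W L₀ U₀ V₀ W₀ : ℂ} (hΛ : ‖L₀‖ ≤ Λ) (hη : η ≤ 1)
    (hU₀ : ‖U₀‖ ≤ 1) (hV₀ : ‖V₀‖ ≤ 1) (hW₀ : ‖W₀‖ ≤ 1) (hL : ‖L - L₀‖ ≤ η) (hU : ‖U - U₀‖ ≤ η)
    (hV : ‖V - V₀‖ ≤ η) (hW : ‖W - W₀‖ ≤ η) :
    ‖L * (U - (Real.pi : ℂ) * (V * W)) - L₀ * (U₀ - (Real.pi : ℂ) * (V₀ * W₀))‖ ≤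
      15 * (Λ + 1) * η := by
  have hη0 : 0 ≤ η := (norm_nonneg _).trans hL
  have hΛ0 : 0 ≤ Λ := (norm_nonneg _).trans hΛ
  have hpi : ‖(Real.pi : ℂ)‖ = Real.pi := by
    rw [Complex.norm_real, Real.norm_of_nonneg Real.pi_pos.le]
  have hL' : ‖L‖ ≤ Λ + 1 := by
    have := norm_add_le (L - L₀) L₀
    rw [sub_add_cancel] at this
    linarith
  have hW' : ‖W‖ ≤ 2 := by
    have := norm_add_le (W - W₀) W₀
    rw [sub_add_cancel] at this
    linarith
  have h1 : L * (U - (Real.pi : ℂ) * (V * W)) - L₀ * (U₀ - (Real.pi : ℂ) * (V₀ * W₀)) =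
      L * ((U - U₀) - (Real.pi : ℂ) * ((V - V₀) * W + V₀ * (W - W₀))) +
        (L - L₀) * (U₀ - (Real.pi : ℂ) * (V₀ * W₀)) := by ring
  have h2 : ‖(V - V₀) * W + V₀ * (W - W₀)‖ ≤ 3 * η := by
    refine (norm_add_le _ _).trans ?_
    rw [norm_mul, norm_mul]
    nlinarith [mul_le_mul hV hW' (norm_nonneg _) hη0, mul_le_mul hV₀ hW (norm_nonneg _) zero_le_one]
  have h3 : ‖(U - U₀) - (Real.pi : ℂ) * ((V - V₀) * W + V₀ * (W - W₀))‖ ≤ η + Real.pi * (3 * η) := by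
    refine (norm_sub_le _ _).trans (add_le_add hU ?_)
    rw [norm_mul, hpi]
    exact mul_le_mul_of_nonneg_left h2 Real.pi_pos.le
  have h4 : ‖U₀ - (Real.pi : ℂ) * (V₀ * W₀)‖ ≤ 1 + Real.pi := by
    refine (norm_sub_le _ _).trans (add_le_add hU₀ ?_)
    rw [norm_mul, hpi, norm_mul]
    exact mul_le_of_le_one_right Real.pi_pos.le (mul_le_one₀ hV₀ (norm_nonneg _) hW₀)
  rw [h1]
  refine (norm_add_le _ _).trans ?_
  rw [norm_mul, norm_mul]
  have h5 := mul_le_mul hL' h3 (norm_nonneg _) (by positivity)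
  have h6 := mul_le_mul hL h4 (norm_nonneg _) hη0
  have h7 : η * (1 + Real.pi) ≤ (Λ + 1) * (η * (1 + Real.pi)) :=
    le_mul_of_one_le_left (by positivity) (by linarith)
  have h8 : (Λ + 1) * η * (2 + 4 * Real.pi) ≤ (Λ + 1) * η * 15 :=
    mul_le_mul_of_nonneg_left (by linarith [Real.pi_lt_d2]) (by positivity)
  linarith

/-- Both values lie within `q ≤ 1/2` of `1`: their difference is at most `2q`, and the denominator
is at least `1/2`. -/
theorem norm_sincSqrt_div_sub_one_le {q : ℝ} (hq : q ≤ 1 / 2) {w w' : ℂ} (hw : ‖w‖ ≤ q)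
    (hw' : ‖w'‖ ≤ q) :
    sincSqrt w ≠ 0 ∧ ‖sincSqrt w' * (sincSqrt w)⁻¹ - 1‖ ≤ 4 * q := by
  have h1 := norm_sincSqrt_sub_one_le (hw.trans (by linarith))
  have h2 := norm_sincSqrt_sub_one_le (hw'.trans (by linarith))
  have h3 : 1 / 2 ≤ ‖sincSqrt w‖ := by
    have := norm_sub_norm_le (1 : ℂ) (1 - sincSqrt w)
    rw [sub_sub_cancel, norm_one, norm_sub_rev] at this
    linarith
  have h0 : sincSqrt w ≠ 0 := norm_pos_iff.mp (by linarith)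
  refine ⟨h0, ?_⟩
  have h4 : sincSqrt w' * (sincSqrt w)⁻¹ - 1 =
      ((sincSqrt w' - 1) - (sincSqrt w - 1)) * (sincSqrt w)⁻¹ := by
    field_simp; ring
  rw [h4, norm_mul, norm_inv]
  have h5 : ‖(sincSqrt w' - 1) - (sincSqrt w - 1)‖ ≤ 2 * q := (norm_sub_le _ _).trans (by linarith)
  have h6 : ‖sincSqrt w‖⁻¹ ≤ 2 := by
    rw [inv_le_comm₀ (by linarith) (by norm_num)]; linarith
  have hq0 : 0 ≤ q := (norm_nonneg _).trans hw
  calc _ ≤ (2 * q) * 2 := mul_le_mul h5 h6 (by positivity) (by positivity)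
    _ = _ := by ring

/-- Endpoints in the polydisc around `(-rb, b)`. -/
structure NearEndpoints (r b : ℝ) (a₁ a₂ : ℂ) : Prop where
  left : ‖a₁ + (r * b : ℝ)‖ ≤ polyRadius r b
  right : ‖a₂ - b‖ ≤ polyRadius r b

section Near

variable {r b : ℝ} {a₁ a₂ : ℂ}

theorem NearEndpoints.norm_sub_length (h : NearEndpoints r b a₁ a₂) :
    ‖(a₂ - a₁) - ((b - -(r * b) : ℝ) : ℂ)‖ ≤ 2 * polyRadius r b := by
  have h1 : (a₂ - a₁) - ((b - -(r * b) : ℝ) : ℂ) = (a₂ - b) - (a₁ + (r * b : ℝ)) := by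
    push_cast; ring
  rw [h1]
  exact (norm_sub_le _ _).trans (by linarith [h.1, h.2])

theorem NearEndpoints.norm_sub_diff (h : NearEndpoints r b a₁ a₂) (s t : unitInterval) :
    ‖(a₂ - a₁) * (((s : ℝ) : ℂ) - ((t : ℝ) : ℂ)) -
      (((b - -(r * b)) * ((s : ℝ) - t) : ℝ) : ℂ)‖ ≤ 2 * polyRadius r b := by
  have h1 : (a₂ - a₁) * (((s : ℝ) : ℂ) - ((t : ℝ) : ℂ)) -
      (((b - -(r * b)) * ((s : ℝ) - t) : ℝ) : ℂ) =
      ((a₂ - a₁) - ((b - -(r * b) : ℝ) : ℂ)) * (((s : ℝ) - t : ℝ) : ℂ) := by push_cast; ring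
  rw [h1, norm_mul, Complex.norm_real]
  refine (mul_le_of_le_one_right (norm_nonneg _) ?_).trans h.norm_sub_length
  rw [Real.norm_eq_abs, abs_le]
  constructor <;> linarith [s.2.1, s.2.2, t.2.1, t.2.2]

theorem NearEndpoints.norm_sub_point (h : NearEndpoints r b a₁ a₂) (s : unitInterval) :
    ‖(a₁ + (a₂ - a₁) * ((s : ℝ) : ℂ)) -
      ((-(r * b) + (b - -(r * b)) * (s : ℝ) : ℝ) : ℂ)‖ ≤ 2 * polyRadius r b := by
  have h1 : (a₁ + (a₂ - a₁) * ((s : ℝ) : ℂ)) -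
      ((-(r * b) + (b - -(r * b)) * (s : ℝ) : ℝ) : ℂ) =
      ((1 - s : ℝ) : ℂ) * (a₁ + (r * b : ℝ)) + ((s : ℝ) : ℂ) * (a₂ - b) := by push_cast; ring
  rw [h1]
  refine (norm_add_le _ _).trans ?_
  rw [norm_mul, norm_mul, Complex.norm_real, Complex.norm_real, Real.norm_of_nonneg s.2.1,
    Real.norm_of_nonneg (sub_nonneg.mpr s.2.2)]
  have h2 := mul_le_mul (sub_le_self 1 s.2.1) h.1 (norm_nonneg _) zero_le_one
  have h3 := mul_le_mul s.2.2 h.2 (norm_nonneg _) zero_le_one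
  linarith

theorem condSineUnit_eq (N : ℕ) (s t : unitInterval) :
    (condSineUnit N (-(r * b)) b s t : ℂ) = ((b - -(r * b) : ℝ) : ℂ) *
      (expSum N (((b - -(r * b)) * ((s : ℝ) - t) : ℝ) : ℂ) - (Real.pi : ℂ) *
        (expSum N ((-(r * b) + (b - -(r * b)) * (s : ℝ) : ℝ) : ℂ) *
          expSum N ((-(r * b) + (b - -(r * b)) * (t : ℝ) : ℝ) : ℂ))) := by
  rw [expSum_ofReal, expSum_ofReal, expSum_ofReal, condSineUnit, condSine]
  push_cast
  congr 4
  ring_nf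

theorem norm_sub_condSineUnit_le (hr : 0 < r) (hb : 0 ≤ b) {S : ℂ → ℂ} {N : ℕ}
    (h : NearEndpoints r b a₁ a₂)
    (hS : ∀ (z : ℂ) (x : ℝ), |x| ≤ (1 + r) * b → ‖z - x‖ ≤ 2 * polyRadius r b →
      ‖S z - expSum N x‖ ≤ 6 * argScale r b) (s t : unitInterval) :
    ‖(a₂ - a₁) * (S ((a₂ - a₁) * (((s : ℝ) : ℂ) - ((t : ℝ) : ℂ))) -
      (Real.pi : ℂ) * (S (a₁ + (a₂ - a₁) * ((s : ℝ) : ℂ)) * S (a₁ + (a₂ - a₁) * ((t : ℝ) : ℂ)))) -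
      (condSineUnit N (-(r * b)) b s t : ℂ)‖ ≤ 1 / (1 + b) := by
  have hrb : 0 ≤ r * b := mul_nonneg hr.le hb
  have hone : ∀ x : ℝ, ‖expSum N x‖ ≤ 1 := fun x => norm_expSum_le_one N (by simp)
  have hab := fun s t => abs_args_le (A₁ := -(r * b)) (A₂ := b) (by linarith) hb s t
  have hΛ : b - -(r * b) = (1 + r) * b := by ring
  rw [condSineUnit_eq]
  refine (norm_kernel_sub_le (Λ := (1 + r) * b) (η := 6 * argScale r b) ?_ ?_ (hone _) (hone _)
    (hone _) ?_ (hS _ _ ?_ (h.norm_sub_diff s t)) (hS _ _ ?_ (h.norm_sub_point s))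
    (hS _ _ ?_ (h.norm_sub_point t))).trans ?_
  · rw [Complex.norm_real, hΛ, Real.norm_of_nonneg (by positivity)]
  · linarith [argScale_le hr hb]
  · refine h.norm_sub_length.trans ?_
    linarith [polyRadius_le_argScale hr hb, argScale_pos hr hb, polyRadius_pos hr hb]
  · rw [← hΛ]; exact (hab s t).1
  · rw [← hΛ]; exact (hab s s).2
  · rw [← hΛ]; exact (hab t t).2
  -- The error is at most `15 · 6 · (Λ + 1)` times `argScale`, hence at most `90/100` of `1/(1+b)`.
  · have h1 : (1 + r) * b + 1 ≤ (2 + r) * (1 + b) := by linarith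
    have h2 : (2 + r) * (1 + b) * argScale r b = 1 / (100 * (1 + b)) := by
      unfold argScale; field_simp
    have h3 := mul_le_mul_of_nonneg_right h1 (argScale_pos hr hb).le
    have h4 : 1 / (100 * (1 + b)) = 1 / 100 * (1 / (1 + b)) := by field_simp
    have h5 : 0 ≤ 1 / (1 + b) := by positivity
    rw [h2, h4] at h3
    linarith

theorem norm_expSum_sub_ofReal_le (hr : 0 < r) (hb : 0 ≤ b) (N : ℕ) {z : ℂ} {x : ℝ}
    (hz : ‖z - x‖ ≤ 2 * polyRadius r b) :
    ‖expSum N z - expSum N x‖ ≤ 2 * argScale r b ∧ ‖expSum N z‖ ≤ 1 := by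
  have him : |z.im| ≤ 1 := by
    have h1 := (Complex.abs_im_le_norm (z - x)).trans hz
    rw [Complex.sub_im, Complex.ofReal_im, sub_zero] at h1
    linarith [polyRadius_le_of_le hr hb]
  refine ⟨?_, norm_expSum_le_one N him⟩
  have := norm_expSum_sub_le N him (w := x) (by simp)
  linarith [polyRadius_le_argScale hr hb, argScale_pos hr hb]

theorem norm_sq_arg_le (hr : 0 < r) (hb : 0 ≤ b) {z ε : ℂ} {x : ℝ} (hx : |x| ≤ (1 + r) * b)
    (hz : ‖z - x‖ ≤ 2 * polyRadius r b) (hε : ‖ε‖ ≤ polyRadius r b) :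
    ‖ε * z ^ 2‖ ≤ argScale r b := by
  have h1 : ‖z‖ ≤ (2 + r) * (1 + b) := by
    have := norm_add_le (z - x) x
    rw [sub_add_cancel, Complex.norm_real, Real.norm_eq_abs] at this
    linarith [polyRadius_le_of_le hr hb]
  rw [← polyRadius_mul_sq hr hb, norm_mul, norm_pow]
  exact mul_le_mul hε (pow_le_pow_left₀ (norm_nonneg _) h1 2) (by positivity)
    (polyRadius_pos hr hb).le

/-- `S_ε` is `S_N` times a ratio of sinc values at `z²/N²` and `ε z²`, both close to `1`. The
constant is `6 = 4 + 2`: four from the ratio, two from moving `z` to the real point `x`. -/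
theorem norm_sineRatio_sub_expSum_le (hr : 0 < r) (hb : 0 ≤ b) {N : ℕ} (hN : N ≠ 0)
    (hNb : 1 / (N : ℝ) ^ 2 ≤ polyRadius r b) {z ε : ℂ} {x : ℝ} (hx : |x| ≤ (1 + r) * b)
    (hz : ‖z - x‖ ≤ 2 * polyRadius r b) (hε : ‖ε‖ ≤ polyRadius r b) :
    ‖sineRatio ε z - expSum N x‖ ≤ 6 * argScale r b := by
  have h1 := norm_expSum_sub_ofReal_le hr hb N hz
  have hεN : ‖1 / (N : ℂ) ^ 2‖ ≤ polyRadius r b := by simpa using hNb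
  obtain ⟨h2, h3⟩ := norm_sincSqrt_div_sub_one_le
    (by linarith [argScale_le hr hb] : argScale r b ≤ 1 / 2) (norm_sq_arg_le hr hb hx hz hε)
    (norm_sq_arg_le hr hb hx hz hεN)
  have hpi : (Real.pi : ℂ) ≠ 0 := by exact_mod_cast Real.pi_ne_zero
  have h4 : sineRatio ε z - expSum N x = expSum N z *
      (sincSqrt (1 / (N : ℂ) ^ 2 * z ^ 2) * (sincSqrt (ε * z ^ 2))⁻¹ - 1) +
      (expSum N z - expSum N x) := by
    rw [sineRatio, sincSqrt_eq_mul_expSum hN]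
    field_simp
    ring
  rw [h4]
  refine (norm_add_le _ _).trans ?_
  rw [norm_mul]
  have h5 := mul_le_mul h1.2 h3 (norm_nonneg _) zero_le_one
  linarith [h1.1]

theorem NearEndpoints.argsSatisfy (hr : 0 < r) (hb : 0 ≤ b) (h : NearEndpoints r b a₁ a₂)
    {P : ℂ → Prop}
    (hP : ∀ (z : ℂ) (x : ℝ), |x| ≤ (1 + r) * b → ‖z - x‖ ≤ 2 * polyRadius r b → P z) :
    ArgsSatisfy P a₁ a₂ := by
  have hrb : 0 ≤ r * b := mul_nonneg hr.le hb
  have hΛ : b - -(r * b) = (1 + r) * b := by ring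
  refine ⟨fun s t => hP _ _ ?_ (h.norm_sub_diff s t), fun s => hP _ _ ?_ (h.norm_sub_point s)⟩
  · rw [← hΛ]; exact (abs_args_le (A₁ := -(r * b)) (A₂ := b) (by linarith) hb s t).1
  · rw [← hΛ]; exact (abs_args_le (A₁ := -(r * b)) (A₂ := b) (by linarith) hb s s).2

theorem NearEndpoints.sincSqrt_ne_zero (hr : 0 < r) (hb : 0 ≤ b) (h : NearEndpoints r b a₁ a₂)
    {ε : ℂ} (hε : ‖ε‖ ≤ polyRadius r b) :
    ArgsSatisfy (fun w => sincSqrt (ε * w ^ 2) ≠ 0) a₁ a₂ :=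
  h.argsSatisfy hr hb fun _ _ hx hz => (norm_sincSqrt_div_sub_one_le
    (by linarith [argScale_le hr hb] : argScale r b ≤ 1 / 2) (norm_sq_arg_le hr hb hx hz hε)
    (norm_sq_arg_le hr hb hx hz hε)).1

end Near

/-- The projection structure is available only at `ε = 1/N²` with `N` an integer. The kernel at a
complex `ε` is therefore compared with that of an auxiliary integer `n`, so large that `1/n²` lies
in the same disc and the interval fits into one period. -/
theorem exists_norm_janossyC_le {r : ℝ} (hr : 0 < r) (m : ℕ) :
    ∃ C : ℝ, 0 < C ∧ ∀ b : ℝ, 0 ≤ b → ∀ ε a₁ a₂ : ℂ, ‖ε‖ ≤ polyRadius r b →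
      NearEndpoints r b a₁ a₂ → ‖janossyC (ε, a₁, a₂)‖ ≤ C / (1 + b) ^ m := by
  obtain ⟨C, hC, h⟩ := exists_norm_fredholmC_le hr m
  refine ⟨C, hC, fun b hb ε a₁ a₂ hε hn => ?_⟩
  have hρ := polyRadius_pos hr hb
  obtain ⟨n, hn1⟩ := exists_nat_gt (1 / polyRadius r b + (1 + r) * b)
  have hn0 : 0 < 1 / polyRadius r b + (1 + r) * b := by positivity
  have hnR : (0 : ℝ) < n := hn0.trans hn1
  have hN : n ≠ 0 := by
    rintro rfl
    simp at hnR
  have hn2 : (1 : ℝ) ≤ n := by exact_mod_cast Nat.one_le_iff_ne_zero.mpr hN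
  have hrb : 0 ≤ (1 + r) * b := by positivity
  have hNb : 1 / (n : ℝ) ^ 2 ≤ polyRadius r b := by
    rw [one_div_le (by positivity) hρ]
    nlinarith
  have hnpi : (n : ℝ) ≤ Real.pi * n :=
    le_mul_of_one_le_left hnR.le (by linarith [Real.pi_gt_three])
  have hρ' : 0 < 1 / polyRadius r b := by positivity
  refine h n hN b hb (by linarith) _ fun s t => ?_
  rw [condKer_sineRatioOp_apply (hn.sincSqrt_ne_zero hr hb hε)]
  exact norm_sub_condSineUnit_le hr hb hn
    (fun z x hx hz => norm_sineRatio_sub_expSum_le hr hb hN hNb hx hz hε) s t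

/-- Only the endpoints are perturbed here, so the bound holds for every integer `N` up to the edge
of the range, with no condition relating `1/N²` to the polydisc. -/
theorem exists_norm_janossyInt_le {r : ℝ} (hr : 0 < r) (m : ℕ) :
    ∃ C : ℝ, 0 < C ∧ ∀ N : ℕ, N ≠ 0 → ∀ b : ℝ, 0 ≤ b → (1 + r) * b ≤ Real.pi * N →
      ∀ ε a₁ a₂ : ℂ, NearEndpoints r b a₁ a₂ → ‖janossyInt N (ε, a₁, a₂)‖ ≤ C / (1 + b) ^ m := by
  obtain ⟨C, hC, h⟩ := exists_norm_fredholmC_le hr m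
  refine ⟨C, hC, fun N hN b hb hbN ε a₁ a₂ hn => ?_⟩
  refine h N hN b hb hbN _ fun s t => ?_
  rw [condKer_apply (expSumOp_apply N)]
  refine norm_sub_condSineUnit_le hr hb hn (fun z x hx hz => ?_) s t
  have := (norm_expSum_sub_ofReal_le hr hb N hz).1
  linarith [argScale_pos hr hb]

end

noncomputable section

/-! ### Directional derivatives of analytic functions and Cauchy bounds -/

section DirDeriv

variable {E : Type*} [NormedAddCommGroup E] [NormedSpace ℂ E]

/-- The derivative of `f` in the direction `v`. -/
def dirDeriv (v : E) (f : E → ℂ) (z : E) : ℂ := fderiv ℂ f z v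

theorem analyticAt_dirDeriv {f : E → ℂ} {z : E} (h : AnalyticAt ℂ f z) (v : E) :
    AnalyticAt ℂ (dirDeriv v f) z :=
  ((ContinuousLinearMap.apply ℂ ℂ v).analyticAt _).comp h.fderiv

theorem analyticAt_iterate_dirDeriv {f : E → ℂ} {z : E} (h : AnalyticAt ℂ f z) (v : E) (k : ℕ) :
    AnalyticAt ℂ ((dirDeriv v)^[k] f) z := by
  induction k with
  | zero => exact h
  | succ k ih => rw [Function.iterate_succ_apply']; exact analyticAt_dirDeriv ih v

theorem hasDerivAt_comp_of_analyticAt {f : E → ℂ} {γ : ℂ → E} {v : E} {t : ℂ}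
    (h : AnalyticAt ℂ f (γ t)) (hγ : HasDerivAt γ v t) :
    HasDerivAt (fun t => f (γ t)) (dirDeriv v f (γ t)) t :=
  h.differentiableAt.hasFDerivAt.comp_hasDerivAt t hγ

/-- Cauchy's estimate for the restriction of `f` to the complex line through `z` in direction `v`.
-/
theorem norm_dirDeriv_le {f : E → ℂ} {z v : E} {R C : ℝ} (hR : 0 < R)
    (h : ∀ t : ℂ, ‖t‖ ≤ R → AnalyticAt ℂ f (z + t • v))
    (hC : ∀ t : ℂ, ‖t‖ ≤ R → ‖f (z + t • v)‖ ≤ C) : ‖dirDeriv v f z‖ ≤ C / R := by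
  have hγ : ∀ t : ℂ, HasDerivAt (fun t : ℂ => z + t • v) v t := fun t => by
    simpa using ((hasDerivAt_id t).smul_const v).const_add z
  have hd : ∀ t : ℂ, ‖t‖ ≤ R → HasDerivAt (fun t : ℂ => f (z + t • v))
      (dirDeriv v f (z + t • v)) t := fun t ht => hasDerivAt_comp_of_analyticAt (h t ht) (hγ t)
  have h1 := Complex.norm_deriv_le_of_forall_mem_sphere_norm_le (c := 0)
    (f := fun t : ℂ => f (z + t • v)) hR
    (DifferentiableOn.diffContOnCl fun t ht => (hd t ?_).differentiableAt.differentiableWithinAt)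
    fun t ht => hC t (by rw [mem_sphere_zero_iff_norm] at ht; exact ht.le)
  · rw [(hd 0 (by simpa using hR.le)).deriv, zero_smul, add_zero] at h1
    exact h1
  · rw [closure_ball _ hR.ne'] at ht
    simpa using ht

end DirDeriv

/-- The mixed derivative in the two endpoints. -/
def mixedDeriv (f : ℂ × ℂ × ℂ → ℂ) : ℂ × ℂ × ℂ → ℂ :=
  dirDeriv (0, 1, 0) (dirDeriv (0, 0, 1) f)

theorem analyticAt_mixedDeriv {f : ℂ × ℂ × ℂ → ℂ} {z : ℂ × ℂ × ℂ} (h : AnalyticAt ℂ f z) :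
    AnalyticAt ℂ (mixedDeriv f) z :=
  analyticAt_dirDeriv (analyticAt_dirDeriv h _) _

theorem norm_mixedDeriv_le {f : ℂ × ℂ × ℂ → ℂ} {ε c₁ c₂ : ℂ} {R C : ℝ} (hR : 0 < R)
    (h : ∀ a₁ a₂ : ℂ, ‖a₁ - c₁‖ ≤ R → ‖a₂ - c₂‖ ≤ R → AnalyticAt ℂ f (ε, a₁, a₂))
    (hC : ∀ a₁ a₂ : ℂ, ‖a₁ - c₁‖ ≤ R → ‖a₂ - c₂‖ ≤ R → ‖f (ε, a₁, a₂)‖ ≤ C) :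
    ‖mixedDeriv f (ε, c₁, c₂)‖ ≤ C / R ^ 2 := by
  have h1 : ∀ a₁ : ℂ, ‖a₁ - c₁‖ ≤ R → ‖dirDeriv (0, 0, 1) f (ε, a₁, c₂)‖ ≤ C / R := by
    intro a₁ ha
    refine norm_dirDeriv_le hR (fun t ht => ?_) fun t ht => ?_
    · simpa using h a₁ (c₂ + t) ha (by simpa using ht)
    · simpa using hC a₁ (c₂ + t) ha (by simpa using ht)
  have h2 : ‖mixedDeriv f (ε, c₁, c₂)‖ ≤ C / R / R := by
    refine norm_dirDeriv_le hR (fun t ht => ?_) fun t ht => ?_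
    · refine analyticAt_dirDeriv ?_ _
      simpa using h (c₁ + t) c₂ (by simpa using ht) (by simpa using hR.le)
    · simpa using h1 (c₁ + t) (by simpa using ht)
  rwa [div_div, ← sq] at h2

/-- Taylor coefficients in `ε` become derivatives of a jointly analytic function, which makes them
continuous in the endpoints. -/
theorem iteratedDeriv_eq_iterate_dirDeriv {f : ℂ × ℂ × ℂ → ℂ} (k : ℕ) {ε a₁ a₂ : ℂ}
    (h : AnalyticAt ℂ f (ε, a₁, a₂)) :
    iteratedDeriv k (fun ε => f (ε, a₁, a₂)) ε = (dirDeriv (1, 0, 0))^[k] f (ε, a₁, a₂) := by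
  induction k generalizing ε with
  | zero => simp
  | succ k ih =>
    have hev : ∀ᶠ x in 𝓝 ε, AnalyticAt ℂ f (x, a₁, a₂) :=
      (by fun_prop : Continuous fun x : ℂ => (x, a₁, a₂)).continuousAt.eventually
        h.eventually_analyticAt
    have heq : iteratedDeriv k (fun ε => f (ε, a₁, a₂)) =ᶠ[𝓝 ε]
        fun x => (dirDeriv (1, 0, 0))^[k] f (x, a₁, a₂) := by
      filter_upwards [hev] with x hx using ih hx
    rw [iteratedDeriv_succ, heq.deriv_eq, Function.iterate_succ_apply']
    refine (hasDerivAt_comp_of_analyticAt (γ := fun x : ℂ => (x, a₁, a₂))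
      (analyticAt_iterate_dirDeriv h _ k) ?_).deriv
    exact (hasDerivAt_id ε).prodMk ((hasDerivAt_const _ _).prodMk (hasDerivAt_const _ _))

theorem iteratedDeriv_re_ofReal {φ : ℂ → ℂ} (k : ℕ) {x : ℝ} (h : AnalyticAt ℂ φ x) :
    iteratedDeriv k (fun t : ℝ => (φ t).re) x = (iteratedDeriv k φ x).re := by
  induction k generalizing x with
  | zero => simp
  | succ k ih =>
    have hev : ∀ᶠ t : ℝ in 𝓝 x, AnalyticAt ℂ φ t :=
      Complex.continuous_ofReal.continuousAt.eventually h.eventually_analyticAt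
    have heq : iteratedDeriv k (fun t : ℝ => (φ t).re) =ᶠ[𝓝 x]
        fun t : ℝ => (iteratedDeriv k φ t).re := by
      filter_upwards [hev] with t ht using ih ht
    rw [iteratedDeriv_succ, heq.deriv_eq, iteratedDeriv_succ]
    have hd : DifferentiableAt ℂ (iteratedDeriv k φ) x := by
      rw [iteratedDeriv_eq_iterate]
      exact (h.iterated_deriv k).differentiableAt
    exact hd.hasDerivAt.real_of_complex.deriv

theorem analyticAt_re_ofReal {φ : ℂ → ℂ} {x : ℝ} (h : AnalyticAt ℂ φ x) :
    AnalyticAt ℝ (fun t : ℝ => (φ t).re) x :=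
  (Complex.reCLM.analyticAt _).comp
    ((h.restrictScalars (𝕜 := ℝ)).comp (f := fun t : ℝ => (t : ℂ)) (Complex.ofRealCLM.analyticAt x))

section Taylor

variable {φ : ℂ → ℂ} {R M : ℝ}

theorem diffContOnCl_ball_of_analyticAt (hR : 0 < R) (h : ∀ z : ℂ, ‖z‖ ≤ R → AnalyticAt ℂ φ z) :
    DiffContOnCl ℂ φ (Metric.ball 0 R) := by
  refine DifferentiableOn.diffContOnCl fun t ht => (h t ?_).differentiableAt.differentiableWithinAt
  rw [closure_ball _ hR.ne'] at ht
  simpa using ht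

theorem norm_taylorCoeff_le (hR : 0 < R) (h : ∀ z : ℂ, ‖z‖ ≤ R → AnalyticAt ℂ φ z)
    (hM : ∀ z : ℂ, ‖z‖ ≤ R → ‖φ z‖ ≤ M) (k : ℕ) :
    ‖iteratedDeriv k φ 0 / (k.factorial : ℂ)‖ ≤ M / R ^ k := by
  have h1 := Complex.norm_iteratedDeriv_le_of_forall_mem_sphere_norm_le k hR
    (diffContOnCl_ball_of_analyticAt hR h)
    fun t ht => hM t (by rw [mem_sphere_zero_iff_norm] at ht; exact ht.le)
  have hk : (0 : ℝ) < k.factorial := by exact_mod_cast k.factorial_pos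
  rw [norm_div, Complex.norm_natCast, div_le_iff₀ hk]
  refine h1.trans (le_of_eq ?_)
  ring

/-- By Cauchy's estimates the tail is dominated by a geometric series of ratio `‖z‖/R ≤ 1/2`, whose
sum contributes the factor `2`. -/
theorem norm_sub_taylor_le (hR : 0 < R) (h : ∀ z : ℂ, ‖z‖ ≤ R → AnalyticAt ℂ φ z)
    (hM : ∀ z : ℂ, ‖z‖ ≤ R → ‖φ z‖ ≤ M) (m : ℕ) {z : ℂ} (hz : ‖z‖ ≤ R / 2) :
    ‖φ z - ∑ k ∈ Finset.range m, iteratedDeriv k φ 0 / (k.factorial : ℂ) * z ^ k‖ ≤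
      2 * M * (‖z‖ / R) ^ m := by
  have hM0 : 0 ≤ M := (norm_nonneg _).trans (hM 0 (by simpa using hR.le))
  have hs := Complex.hasSum_taylorSeries_on_ball (f := φ) (c := 0) (r := R) (z := z)
    (fun t ht => (h t (by simpa using (Metric.mem_ball.mp ht).le)).differentiableAt.differentiableWithinAt)
    (by rw [mem_ball_zero_iff]; linarith)
  have hs' : HasSum (fun k : ℕ => iteratedDeriv k φ 0 / (k.factorial : ℂ) * z ^ k) (φ z) := by
    have heq : (fun k : ℕ => iteratedDeriv k φ 0 / (k.factorial : ℂ) * z ^ k) =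
        fun k : ℕ => (k.factorial : ℂ)⁻¹ • (z - 0) ^ k • iteratedDeriv k φ 0 := by
      funext k
      rw [smul_eq_mul, smul_eq_mul, sub_zero]
      ring
    rw [heq]
    exact hs
  have hs2 := (hasSum_nat_add_iff' m).mpr hs'
  set q := ‖z‖ / R with hq
  have hq0 : 0 ≤ q := by positivity
  have hq1 : q ≤ 1 / 2 := by rw [hq, div_le_iff₀ hR]; linarith
  have hg : HasSum (fun k : ℕ => M * q ^ m * q ^ k) (M * q ^ m * (1 - q)⁻¹) :=
    (hasSum_geometric_of_lt_one hq0 (by linarith)).mul_left _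
  have h1 : ‖φ z - ∑ k ∈ Finset.range m, iteratedDeriv k φ 0 / (k.factorial : ℂ) * z ^ k‖ ≤
      M * q ^ m * (1 - q)⁻¹ := by
    rw [← hs2.tsum_eq]
    refine tsum_of_norm_bounded hg fun k => ?_
    rw [norm_mul, norm_pow]
    have h2 := norm_taylorCoeff_le hR h hM (k + m)
    calc _ ≤ M / R ^ (k + m) * ‖z‖ ^ (k + m) := by gcongr
      _ = M * q ^ m * q ^ k := by rw [hq, div_pow, div_pow, pow_add, pow_add]; field_simp
  refine h1.trans ?_
  have h3 : (1 - q)⁻¹ ≤ 2 := by rw [inv_le_comm₀ (by linarith) (by norm_num)]; linarith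
  calc M * q ^ m * (1 - q)⁻¹ ≤ M * q ^ m * 2 := by gcongr
    _ = _ := by ring

end Taylor

end

noncomputable section

/-! ### The distributions as derivatives of an analytic function -/

theorem hasDerivAt_re_line {E : Type*} [NormedAddCommGroup E] [NormedSpace ℂ E] {f : E → ℂ}
    (p v : E) (c t : ℝ) (h : AnalyticAt ℂ f (p + ((c * t : ℝ) : ℂ) • v)) :
    HasDerivAt (fun t : ℝ => (f (p + ((c * t : ℝ) : ℂ) • v)).re)
      (c * (dirDeriv v f (p + ((c * t : ℝ) : ℂ) • v)).re) t := by
  have hγ : HasDerivAt (fun t : ℂ => p + ((c : ℂ) * t) • v) ((c : ℂ) • v) t := by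
    simpa using (((hasDerivAt_id (t : ℂ)).const_mul (c : ℂ)).smul_const v).const_add p
  have h1 := (hasDerivAt_comp_of_analyticAt (f := f) (by push_cast at h; exact h) hγ).real_of_complex
  push_cast
  convert h1 using 1
  rw [dirDeriv, dirDeriv, map_smul, smul_eq_mul, Complex.re_ofReal_mul]

/-- Admissible unfolded endpoints. -/
def Admissible (N A₁ A₂ : ℝ) : Prop := A₁ < 0 ∧ 0 < A₂ ∧ A₂ - A₁ < Real.pi * |N|

/-- `f (ε, ·, ·)` is an analytic extension of the unfolded conditional Jánossy density. -/
def Extends (f : ℂ × ℂ × ℂ → ℂ) (ε : ℂ) (N : ℝ) : Prop :=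
  ∀ A₁ A₂ : ℝ, Admissible N A₁ A₂ → AnalyticAt ℂ f (ε, (A₁ : ℂ), (A₂ : ℂ)) ∧
    ((condJanossyUnf N A₁ A₂ : ℝ) : ℂ) = f (ε, (A₁ : ℂ), (A₂ : ℂ))

theorem extends_janossyC {N : ℝ} (hN : N ≠ 0) : Extends janossyC (1 / (N : ℂ) ^ 2) N :=
  fun _ _ h => ⟨analyticAt_janossyC (argsSatisfy_sincSqrt_ne_zero hN h.1.le h.2.1.le h.2.2),
    condJanossyUnf_eq hN h.1 h.2.1 h.2.2⟩

theorem extends_janossyInt {N : ℕ} (hN : N ≠ 0) (ε : ℂ) : Extends (janossyInt N) ε N :=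
  fun _ _ h => ⟨analyticAt_janossyInt N _, by
    rw [condJanossyUnf_eq (Nat.cast_ne_zero.mpr hN) h.1 h.2.1 h.2.2, Complex.ofReal_natCast]
    refine janossyC_eq_janossyInt hN h.1.le h.2.1.le ?_ ε
    simpa using h.2.2⟩

variable {f : ℂ × ℂ × ℂ → ℂ} {ε : ℂ} {N : ℝ}

theorem condJanossy_eq_unf (hN : N ≠ 0) (x y : ℝ) :
    condJanossy N x y = condJanossyUnf N (N / 2 * x) (N / 2 * y) := by
  rw [condJanossyUnf]
  congr 1 <;> field_simp

theorem Extends.condJanossy_eq (hf : Extends f ε N) (hN : N ≠ 0) {x y : ℝ}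
    (h : Admissible N (N / 2 * x) (N / 2 * y)) :
    condJanossy N x y = (f (ε, ((N / 2 * x : ℝ) : ℂ), ((N / 2 * y : ℝ) : ℂ))).re := by
  rw [← (hf _ _ h).2, Complex.ofReal_re, condJanossy_eq_unf hN]

theorem isOpen_admissible {X : Type*} [TopologicalSpace X] {u v : X → ℝ} (hu : Continuous u)
    (hv : Continuous v) : IsOpen {x | Admissible N (u x) (v x)} := by
  have h1 := isOpen_lt hu (continuous_const (y := (0 : ℝ)))
  have h2 := isOpen_lt (continuous_const (y := (0 : ℝ))) hv
  have h3 := isOpen_lt (hv.sub hu) (continuous_const (y := Real.pi * |N|))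
  exact h1.inter (h2.inter h3)

theorem Extends.deriv_right (hf : Extends f ε N) (hN : N ≠ 0) {x y : ℝ}
    (h : Admissible N (N / 2 * x) (N / 2 * y)) :
    deriv (fun y => condJanossy N x y) y = N / 2 *
      (dirDeriv (0, 0, 1) f (ε, ((N / 2 * x : ℝ) : ℂ), ((N / 2 * y : ℝ) : ℂ))).re := by
  have hev : (fun y => condJanossy N x y) =ᶠ[𝓝 y]
      fun y => (f (ε, ((N / 2 * x : ℝ) : ℂ), ((N / 2 * y : ℝ) : ℂ))).re := by
    filter_upwards [(isOpen_admissible (u := fun _ : ℝ => N / 2 * x) (v := fun y => N / 2 * y)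
      (by fun_prop) (by fun_prop)).mem_nhds h] with z hz using hf.condJanossy_eq hN hz
  rw [hev.deriv_eq]
  have h1 := hasDerivAt_re_line (f := f) (ε, ((N / 2 * x : ℝ) : ℂ), 0) (0, 0, 1) (N / 2) y
    (by simpa using (hf _ _ h).1)
  simpa using h1.deriv

/-- Each endpoint derivative produces a factor `N/2`, and the two Jacobians `2/N` cancel them.
Admissibility is an open condition, so the formulas hold near the point and may be differentiated.
-/
theorem Extends.PcUnf_eq (hf : Extends f ε N) (hN : N ≠ 0) {A₁ A₂ : ℝ} (h : Admissible N A₁ A₂) :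
    PcUnf N A₁ A₂ = -(mixedDeriv f (ε, (A₁ : ℂ), (A₂ : ℂ))).re := by
  have hA : ∀ A : ℝ, N / 2 * (2 / N * A) = A := fun A => by field_simp
  have hev : (fun x => deriv (fun y => condJanossy N x y) (2 / N * A₂)) =ᶠ[𝓝 (2 / N * A₁)]
      fun x => N / 2 * (dirDeriv (0, 0, 1) f (ε, ((N / 2 * x : ℝ) : ℂ), (A₂ : ℂ))).re := by
    filter_upwards [(isOpen_admissible (u := fun x : ℝ => N / 2 * x) (v := fun _ => A₂)
      (by fun_prop) (by fun_prop)).mem_nhds (by rw [Set.mem_ofPred_eq, hA]; exact h)] with z hz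
    have hz' : Admissible N (N / 2 * z) (N / 2 * (2 / N * A₂)) := by rw [hA]; exact hz
    rw [hf.deriv_right hN hz', hA]
  have h1 := hasDerivAt_re_line (f := dirDeriv (0, 0, 1) f) (ε, 0, (A₂ : ℂ)) (0, 1, 0) (N / 2)
    (2 / N * A₁) (by rw [hA]; simpa using analyticAt_dirDeriv (hf _ _ h).1 _)
  rw [hA] at h1
  simp only [Prod.smul_mk, smul_eq_mul, mul_one, mul_zero, Prod.mk_add_mk, add_zero,
    zero_add] at h1
  rw [PcUnf, Pc, hev.deriv_eq, (h1.const_mul (N / 2)).deriv, mixedDeriv]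
  field_simp

theorem Extends.PnnUnf_eq (hf : Extends f ε N) (hN : N ≠ 0) {T : ℝ} (h : Admissible N (-T) T) :
    PnnUnf N T = -(dirDeriv (0, -1, 1) f (ε, -(T : ℂ), (T : ℂ))).re := by
  have hA : ∀ A : ℝ, N / 2 * (2 / N * A) = A := fun A => by field_simp
  have hev : (fun s => condJanossy N (-s) s) =ᶠ[𝓝 (2 / N * T)]
      fun s => (f ((ε, 0, 0) + ((N / 2 * s : ℝ) : ℂ) • (0, -1, 1))).re := by
    filter_upwards [(isOpen_admissible (u := fun x : ℝ => N / 2 * -x) (v := fun x => N / 2 * x)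
      (by fun_prop) (by fun_prop)).mem_nhds
        (by rw [Set.mem_ofPred_eq, mul_neg, hA]; exact h)] with s hs
    rw [hf.condJanossy_eq hN hs]
    simp
  have h1 := hasDerivAt_re_line (f := f) (ε, 0, 0) (0, -1, 1) (N / 2)
    (2 / N * T) (by rw [hA]; simpa using (hf _ _ h).1)
  rw [PnnUnf, Pnn, hev.deriv_eq, h1.deriv, hA]
  simp only [Prod.smul_mk, smul_eq_mul, mul_one, mul_zero, Prod.mk_add_mk, add_zero, zero_add,
    mul_neg]
  field_simp

theorem Extends.contDiffAt (hf : Extends f ε N) (hN : N ≠ 0) {A₁ A₂ : ℝ} (h : Admissible N A₁ A₂) :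
    ContDiffAt ℝ 2 (fun a : ℝ × ℝ => condJanossy N a.1 a.2) (2 / N * A₁, 2 / N * A₂) := by
  have hA : ∀ A : ℝ, N / 2 * (2 / N * A) = A := fun A => by field_simp
  have hev : (fun a : ℝ × ℝ => condJanossy N a.1 a.2) =ᶠ[𝓝 (2 / N * A₁, 2 / N * A₂)]
      fun a => (f (ε, ((N / 2 * a.1 : ℝ) : ℂ), ((N / 2 * a.2 : ℝ) : ℂ))).re := by
    filter_upwards [(isOpen_admissible (u := fun a : ℝ × ℝ => N / 2 * a.1)
      (v := fun a : ℝ × ℝ => N / 2 * a.2) (by fun_prop) (by fun_prop)).mem_nhds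
        (by rw [Set.mem_ofPred_eq, hA, hA]; exact h)] with a ha using hf.condJanossy_eq hN ha
  refine ContDiffAt.congr_of_eventuallyEq ?_ hev
  have h1 : ContDiffAt ℝ 2 f (ε, (A₁ : ℂ), (A₂ : ℂ)) :=
    ((hf _ _ h).1.restrictScalars (𝕜 := ℝ)).contDiffAt
  refine Complex.reCLM.contDiff.contDiffAt.comp _ ?_
  refine ContDiffAt.comp (g := f) (f := fun a : ℝ × ℝ =>
    (ε, ((N / 2 * a.1 : ℝ) : ℂ), ((N / 2 * a.2 : ℝ) : ℂ))) _ (by simp only [hA]; exact h1) ?_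
  refine contDiffAt_const.prodMk (ContDiffAt.prodMk ?_ ?_)
  · exact Complex.ofRealCLM.contDiff.contDiffAt.comp _
      (contDiffAt_const.mul contDiffAt_fst)
  · exact Complex.ofRealCLM.contDiff.contDiffAt.comp _
      (contDiffAt_const.mul contDiffAt_snd)

theorem janossyUnf_eq (hN : N ≠ 0) (A₁ A₂ : ℝ) :
    janossyUnf N A₁ A₂ = 1 / Real.pi * condJanossyUnf N A₁ A₂ := by
  have h : cueKernel N 0 0 = N / (2 * Real.pi) := by simp [cueKernel]
  rw [janossyUnf, janossy, h, condJanossyUnf]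
  field_simp

/-- The Taylor coefficients of this function are those of the joint density. -/
def pcExt (ε A₁ A₂ : ℝ) : ℝ := -(mixedDeriv janossyC ((ε : ℂ), (A₁ : ℂ), (A₂ : ℂ))).re

theorem analyticAt_janossyC_zero (A₁ A₂ : ℂ) : AnalyticAt ℂ janossyC (0, A₁, A₂) :=
  analyticAt_janossyC ⟨fun _ _ => by simp [sincSqrt_zero], fun _ => by simp [sincSqrt_zero]⟩

theorem analyticAt_slice {f : ℂ × ℂ × ℂ → ℂ} {ε A₁ A₂ : ℂ} (h : AnalyticAt ℂ f (ε, A₁, A₂)) :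
    AnalyticAt ℂ (fun ε => f (ε, A₁, A₂)) ε :=
  h.comp (f := fun ε : ℂ => (ε, A₁, A₂))
    (analyticAt_id.prod (analyticAt_const.prod analyticAt_const))

theorem analyticAt_re_slice {f : ℂ × ℂ × ℂ → ℂ} {A₁ A₂ : ℂ} (h : AnalyticAt ℂ f (0, A₁, A₂)) :
    AnalyticAt ℝ (fun ε : ℝ => (f ((ε : ℂ), A₁, A₂)).re) 0 :=
  analyticAt_re_ofReal (φ := fun ε => f (ε, A₁, A₂)) (by simpa using analyticAt_slice h)

theorem ofReal_inv_sq (N : ℝ) : ((1 / N ^ 2 : ℝ) : ℂ) = 1 / (N : ℂ) ^ 2 := by push_cast; rfl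

theorem analyticInInvSq_condJanossyUnf {A₁ A₂ : ℝ} (h1 : A₁ < 0) (h2 : 0 < A₂) :
    AnalyticInInvSq (A₂ - A₁) (fun N => condJanossyUnf N A₁ A₂) := by
  refine ⟨_, analyticAt_re_slice (analyticAt_janossyC_zero A₁ A₂), fun N hN hL => ?_⟩
  rw [ofReal_inv_sq, ← (extends_janossyC hN A₁ A₂ ⟨h1, h2, hL⟩).2, Complex.ofReal_re]

theorem analyticInInvSq_janossyUnf {A₁ A₂ : ℝ} (h1 : A₁ < 0) (h2 : 0 < A₂) :
    AnalyticInInvSq (A₂ - A₁) (fun N => janossyUnf N A₁ A₂) := by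
  obtain ⟨F, hF, h⟩ := analyticInInvSq_condJanossyUnf h1 h2
  exact ⟨fun ε => 1 / Real.pi * F ε, analyticAt_const.fun_mul hF, fun N hN hL => by
    simp only [janossyUnf_eq hN]
    exact congrArg _ (h N hN hL)⟩

theorem analyticInInvSq_PnnUnf {T : ℝ} (hT : 0 < T) :
    AnalyticInInvSq (2 * T) (fun N => PnnUnf N T) := by
  refine ⟨_, (analyticAt_re_slice (analyticAt_dirDeriv
    (analyticAt_janossyC_zero (-(T : ℂ)) T) (0, -1, 1))).fun_neg, fun N hN hL => ?_⟩
  rw [ofReal_inv_sq]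
  exact (extends_janossyC hN).PnnUnf_eq hN ⟨by linarith, hT, by linarith⟩

theorem analyticAt_pcExt (A₁ A₂ : ℝ) : AnalyticAt ℝ (fun ε => pcExt ε A₁ A₂) 0 :=
  (analyticAt_re_slice (analyticAt_mixedDeriv (analyticAt_janossyC_zero A₁ A₂))).fun_neg

theorem PcUnf_eq_pcExt {N A₁ A₂ : ℝ} (hN : N ≠ 0) (h1 : A₁ < 0) (h2 : 0 < A₂)
    (hL : A₂ - A₁ < Real.pi * |N|) : PcUnf N A₁ A₂ = pcExt (1 / N ^ 2) A₁ A₂ := by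
  rw [pcExt, ofReal_inv_sq]
  exact (extends_janossyC hN).PcUnf_eq hN ⟨h1, h2, hL⟩

end

noncomputable section

/-! ### Bounds along the ray of constant gap ratio -/

/-- The endpoints `(-rb, b)` with the parameter `ε`. -/
def rayPoint (r : ℝ) (ε : ℂ) (b : ℝ) : ℂ × ℂ × ℂ := (ε, ((-(r * b) : ℝ) : ℂ), (b : ℂ))

theorem continuous_rayPoint (r : ℝ) (ε : ℂ) : Continuous (rayPoint r ε) := by
  unfold rayPoint; fun_prop

theorem polyRadius_antitone {r b B : ℝ} (hr : 0 < r) (hb : 0 ≤ b) (hB : b ≤ B) :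
    polyRadius r B ≤ polyRadius r b := by
  unfold polyRadius
  refine one_div_le_one_div_of_le (by positivity) ?_
  exact mul_le_mul_of_nonneg_left (pow_le_pow_left₀ (by positivity) (by linarith) 4) (by positivity)

variable {r : ℝ}

theorem nearEndpoints_of_norm_sub_le {b : ℝ} {a₁ a₂ : ℂ}
    (h1 : ‖a₁ - ((-(r * b) : ℝ) : ℂ)‖ ≤ polyRadius r b) (h2 : ‖a₂ - b‖ ≤ polyRadius r b) :
    NearEndpoints r b a₁ a₂ :=
  ⟨by rwa [Complex.ofReal_neg, sub_neg_eq_add] at h1, h2⟩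

theorem analyticAt_mixedDeriv_ray (hr : 0 < r) {b : ℝ} (hb : 0 ≤ b) {ε : ℂ}
    (hε : ‖ε‖ ≤ polyRadius r b) : AnalyticAt ℂ (mixedDeriv janossyC) (rayPoint r ε b) := by
  refine analyticAt_mixedDeriv (analyticAt_janossyC ?_)
  refine (nearEndpoints_of_norm_sub_le ?_ ?_ : NearEndpoints r b _ _).sincSqrt_ne_zero hr hb hε
  · simpa [rayPoint] using (polyRadius_pos hr hb).le
  · simpa [rayPoint] using (polyRadius_pos hr hb).le

/-- Each division by the polydisc radius costs four powers of `1 + b`, which are budgeted in advance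
in the decay exponent. -/
theorem div_polyRadius_pow (hr : 0 < r) {b : ℝ} (hb : 0 ≤ b) (C : ℝ) (m k : ℕ) :
    C / (1 + b) ^ (m + 4 * k) / polyRadius r b ^ k =
      C * (100 * (2 + r) ^ 3) ^ k / (1 + b) ^ m := by
  have h1 : 1 + b ≠ 0 := by positivity
  unfold polyRadius
  rw [one_div, inv_pow, div_inv_eq_mul, mul_pow, pow_add, pow_mul]
  field_simp

theorem exists_norm_mixedDeriv_janossyC_le (hr : 0 < r) (m : ℕ) :
    ∃ C : ℝ, 0 < C ∧ ∀ b : ℝ, 0 ≤ b → ∀ ε : ℂ, ‖ε‖ ≤ polyRadius r b →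
      ‖mixedDeriv janossyC (rayPoint r ε b)‖ ≤ C / (1 + b) ^ m := by
  obtain ⟨C, hC, h⟩ := exists_norm_janossyC_le hr (m + 4 * 2)
  refine ⟨C * (100 * (2 + r) ^ 3) ^ 2, by positivity, fun b hb ε hε => ?_⟩
  rw [← div_polyRadius_pow hr hb]
  refine norm_mixedDeriv_le (polyRadius_pos hr hb) (fun a₁ a₂ h1 h2 => ?_) fun a₁ a₂ h1 h2 => ?_
  · exact analyticAt_janossyC ((nearEndpoints_of_norm_sub_le h1 h2).sincSqrt_ne_zero hr hb hε)
  · exact h b hb ε a₁ a₂ hε (nearEndpoints_of_norm_sub_le h1 h2)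

/-- Near the edge of the range the polydisc leaves the admissible endpoints, so Cauchy's estimate is
applied to the entire extension `janossyInt`. -/
theorem exists_abs_PcUnf_le (hr : 0 < r) (m : ℕ) :
    ∃ C : ℝ, 0 < C ∧ ∀ N : ℕ, N ≠ 0 → ∀ b : ℝ, 0 < b → (1 + r) * b < Real.pi * N →
      |PcUnf N (-(r * b)) b| ≤ C / (1 + b) ^ m := by
  obtain ⟨C, hC, h⟩ := exists_norm_janossyInt_le hr (m + 4 * 2)
  refine ⟨C * (100 * (2 + r) ^ 3) ^ 2, by positivity, fun N hN b hb hbN => ?_⟩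
  have hrb : 0 < r * b := mul_pos hr hb
  rw [(extends_janossyInt hN 0).PcUnf_eq (Nat.cast_ne_zero.mpr hN)
    ⟨by linarith, hb, by rw [Nat.abs_cast]; linarith⟩, abs_neg, ← div_polyRadius_pow hr hb.le]
  refine (Complex.abs_re_le_norm _).trans ?_
  exact norm_mixedDeriv_le (polyRadius_pos hr hb.le) (fun a₁ a₂ _ _ => analyticAt_janossyInt N _)
    fun a₁ a₂ h1 h2 => h N hN b hb.le hbN.le _ a₁ a₂ (nearEndpoints_of_norm_sub_le h1 h2)

/-- The Taylor coefficients of the joint density along the ray, as complex numbers. -/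
def rayCoeffC (r : ℝ) (k : ℕ) (b : ℝ) : ℂ :=
  iteratedDeriv k (fun ε => mixedDeriv janossyC (rayPoint r ε b)) 0 / (k.factorial : ℂ)

/-- The Taylor coefficients of the joint density along the ray. -/
def rayCoeff (r : ℝ) (k : ℕ) (b : ℝ) : ℝ :=
  iteratedDeriv k (fun ε => pcExt ε (-(r * b)) b) 0 / (k.factorial : ℝ)

theorem analyticAt_mixedDeriv_zero (r b : ℝ) :
    AnalyticAt ℂ (mixedDeriv janossyC) (rayPoint r 0 b) :=
  analyticAt_mixedDeriv (analyticAt_janossyC_zero _ _)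

theorem rayCoeff_eq (r : ℝ) (k : ℕ) (b : ℝ) : rayCoeff r k b = -(rayCoeffC r k b).re := by
  have h1 : (fun ε => pcExt ε (-(r * b)) b) =
      -fun ε : ℝ => (mixedDeriv janossyC (rayPoint r ε b)).re := rfl
  have h2 := iteratedDeriv_re_ofReal (φ := fun ε => mixedDeriv janossyC (rayPoint r ε b)) k (x := 0)
    (by rw [Complex.ofReal_zero]; exact analyticAt_slice (analyticAt_mixedDeriv_zero r b))
  rw [rayCoeff, h1, iteratedDeriv_neg, h2, rayCoeffC, Complex.ofReal_zero, neg_div]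
  congr 1
  rw [← Complex.ofReal_natCast, Complex.div_ofReal_re]

theorem continuous_rayCoeff (r : ℝ) (k : ℕ) : Continuous (rayCoeff r k) := by
  have h1 : Continuous fun b => (dirDeriv (1, 0, 0))^[k] (mixedDeriv janossyC) (rayPoint r 0 b) := by
    rw [continuous_iff_continuousAt]
    intro b
    exact (analyticAt_iterate_dirDeriv (analyticAt_mixedDeriv_zero r b) _ k).continuousAt.comp
      (continuous_rayPoint r 0).continuousAt
  have h2 : rayCoeff r k = fun b =>
      -((dirDeriv (1, 0, 0))^[k] (mixedDeriv janossyC) (rayPoint r 0 b) / (k.factorial : ℂ)).re := by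
    funext b
    rw [rayCoeff_eq, rayCoeffC]
    congr 3
    exact iteratedDeriv_eq_iterate_dirDeriv k (analyticAt_mixedDeriv_zero r b)
  rw [h2]
  fun_prop

theorem abs_rayCoeff_le (hr : 0 < r) {b M : ℝ} (hb : 0 ≤ b)
    (hM : ∀ ε : ℂ, ‖ε‖ ≤ polyRadius r b → ‖mixedDeriv janossyC (rayPoint r ε b)‖ ≤ M) (k : ℕ) :
    |rayCoeff r k b| ≤ M / polyRadius r b ^ k := by
  rw [rayCoeff_eq, abs_neg]
  exact (Complex.abs_re_le_norm _).trans (norm_taylorCoeff_le (polyRadius_pos hr hb)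
    (fun ε hε => analyticAt_slice (analyticAt_mixedDeriv_ray hr hb hε)) hM k)

theorem abs_pcExt_sub_taylor_le (hr : 0 < r) {b M : ℝ} (hb : 0 ≤ b)
    (hM : ∀ ε : ℂ, ‖ε‖ ≤ polyRadius r b → ‖mixedDeriv janossyC (rayPoint r ε b)‖ ≤ M) (m : ℕ)
    {ε : ℝ} (hε0 : 0 ≤ ε) (hε : ε ≤ polyRadius r b / 2) :
    |pcExt ε (-(r * b)) b - ∑ k ∈ Finset.range m, rayCoeff r k b * ε ^ k| ≤
      2 * M * (ε / polyRadius r b) ^ m := by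
  have hn : ‖(ε : ℂ)‖ = ε := by rw [Complex.norm_real, Real.norm_of_nonneg hε0]
  have h1 := norm_sub_taylor_le (φ := fun ε => mixedDeriv janossyC (rayPoint r ε b))
    (polyRadius_pos hr hb)
    (fun ε hε => analyticAt_slice (analyticAt_mixedDeriv_ray hr hb hε)) hM m (z := ε)
    (by rw [hn]; exact hε)
  rw [hn] at h1
  refine le_trans ?_ h1
  refine le_trans (le_of_eq ?_) (Complex.abs_re_le_norm _)
  rw [← abs_neg, Complex.sub_re, Complex.re_sum]
  congr 1
  have h2 : ∀ k : ℕ, (rayCoeffC r k b * (ε : ℂ) ^ k).re = -(rayCoeff r k b * ε ^ k) := by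
    intro k
    rw [← Complex.ofReal_pow, Complex.re_mul_ofReal, rayCoeff_eq]
    ring
  have h3 : ∀ k : ℕ, (iteratedDeriv k (fun ε : ℂ => mixedDeriv janossyC (rayPoint r ε b)) 0 /
      (k.factorial : ℂ) * (ε : ℂ) ^ k).re = -(rayCoeff r k b * ε ^ k) := h2
  have h4 : pcExt ε (-(r * b)) b = -(mixedDeriv janossyC (rayPoint r ε b)).re := rfl
  rw [h4, Finset.sum_congr rfl fun k _ => h3 k, Finset.sum_neg_distrib]
  ring

theorem exists_abs_rayCoeff_le (hr : 0 < r) (k m : ℕ) :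
    ∃ C : ℝ, 0 < C ∧ ∀ b : ℝ, 0 ≤ b → |rayCoeff r k b| ≤ C / (1 + b) ^ m := by
  obtain ⟨C, hC, h⟩ := exists_norm_mixedDeriv_janossyC_le hr (m + 4 * k)
  refine ⟨C * (100 * (2 + r) ^ 3) ^ k, by positivity, fun b hb => ?_⟩
  rw [← div_polyRadius_pow hr hb]
  exact abs_rayCoeff_le hr hb (h b hb) k

/-- The Taylor remainder of the joint density, cut off at the edge of its range, decays
in the spacing. -/
theorem exists_abs_cutoff_sub_taylor_le (hr : 0 < r) (m p : ℕ) :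
    ∃ C : ℝ, 0 < C ∧ ∀ N : ℕ, N ≠ 0 → ∀ b : ℝ, 0 < b →
      |(if (1 + r) * b < Real.pi * N then PcUnf N (-(r * b)) b else 0) -
        ∑ k ∈ Finset.range m, rayCoeff r k b * (1 / (N : ℝ) ^ 2) ^ k| ≤
      C / (1 + b) ^ p * (1 / (N : ℝ) ^ 2) ^ m := by
  obtain ⟨C₁, hC₁, h1⟩ := exists_norm_mixedDeriv_janossyC_le hr (p + 4 * m)
  obtain ⟨C₂, hC₂, h2⟩ := exists_abs_PcUnf_le hr (p + 4 * m)
  refine ⟨((C₂ + m * C₁ + 2 * C₁) * 2 ^ m) * (100 * (2 + r) ^ 3) ^ m, by positivity,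
    fun N hN b hb => ?_⟩
  rw [← div_polyRadius_pow hr hb.le]
  set M := 1 / (1 + b) ^ (p + 4 * m) with hM
  have hM0 : 0 < M := by positivity
  set ρ := polyRadius r b with hρ
  have hρ0 : 0 < ρ := polyRadius_pos hr hb.le
  have hNR : (0 : ℝ) < N := by exact_mod_cast Nat.pos_of_ne_zero hN
  set ε := 1 / (N : ℝ) ^ 2 with hε
  have hε0 : 0 < ε := by positivity
  have h1' : ∀ z : ℂ, ‖z‖ ≤ ρ → ‖mixedDeriv janossyC (rayPoint r z b)‖ ≤ C₁ * M := fun z hz => by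
    rw [hM, mul_one_div]; exact h1 b hb.le z hz
  have hgoal : (C₂ + m * C₁ + 2 * C₁) * 2 ^ m / (1 + b) ^ (p + 4 * m) / ρ ^ m * ε ^ m =
      (C₂ * M + m * (C₁ * M) + 2 * (C₁ * M)) * (2 * (ε / ρ)) ^ m := by
    rw [hM, mul_pow, div_pow]; ring
  rw [hgoal]
  have hq0 : 0 < ε / ρ := by positivity
  -- Either the Taylor expansion is valid with geometric remainder, or `2ε/ρ ≥ 1` and `(2ε/ρ)^m`
  -- dominates every term separately.
  rcases le_total ε (ρ / 2) with h | h
  -- A small `ε` relative to the radius forces `(2+r)(1+b) < N`, so the cutoff is inactive.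
  · have hlt : (1 + r) * b < Real.pi * N := by
      have h3 : 1 ≤ ρ * (N : ℝ) ^ 2 := by
        rw [hε, div_le_iff₀ (by positivity)] at h
        nlinarith [sq_nonneg (N : ℝ)]
      have h4 : ρ * ((2 + r) * (1 + b)) ^ 2 < 1 := by
        rw [polyRadius_mul_sq hr hb.le]; linarith [argScale_le hr hb.le]
      have h5 : ((2 + r) * (1 + b)) ^ 2 < (N : ℝ) ^ 2 := lt_of_mul_lt_mul_left (h4.trans_le h3) hρ0.le
      have h6 : (2 + r) * (1 + b) < N := lt_of_pow_lt_pow_left₀ 2 hNR.le h5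
      have h7 : (N : ℝ) ≤ Real.pi * N :=
        le_mul_of_one_le_left hNR.le (by linarith [Real.pi_gt_three])
      nlinarith
    rw [if_pos hlt, PcUnf_eq_pcExt (Nat.cast_ne_zero.mpr hN) (by nlinarith) hb
      (by rw [Nat.abs_cast]; linarith)]
    refine (abs_pcExt_sub_taylor_le hr hb.le h1' m hε0.le h).trans ?_
    have h3 : (ε / ρ) ^ m ≤ (2 * (ε / ρ)) ^ m := pow_le_pow_left₀ hq0.le (by linarith) m
    refine mul_le_mul ?_ h3 (by positivity) (by positivity)
    have : 0 ≤ C₂ * M + m * (C₁ * M) := by positivity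
    linarith
  · have hq1 : 1 ≤ 2 * (ε / ρ) := by
      rw [← mul_div_assoc, one_le_div hρ0]; linarith
    have hqm : 1 ≤ (2 * (ε / ρ)) ^ m := one_le_pow₀ hq1
    have h3 : |if (1 + r) * b < Real.pi * N then PcUnf N (-(r * b)) b else 0| ≤ C₂ * M := by
      split_ifs with hlt
      · rw [hM, mul_one_div]; exact h2 N hN b hb hlt
      · rw [abs_zero]; positivity
    -- A Taylor term is at most a constant times `(ε/ρ)^k`; since `2ε/ρ ≥ 1` and `k < m`, the
    -- exponent may be raised to `m`.
    have h4 : ∀ k ∈ Finset.range m, |rayCoeff r k b * ε ^ k| ≤ C₁ * M * (2 * (ε / ρ)) ^ m := by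
      intro k hk
      rw [abs_mul, abs_of_pos (pow_pos hε0 k)]
      calc |rayCoeff r k b| * ε ^ k ≤ C₁ * M / ρ ^ k * ε ^ k :=
            mul_le_mul_of_nonneg_right (abs_rayCoeff_le hr hb.le h1' k) (by positivity)
        _ = C₁ * M * (ε / ρ) ^ k := by rw [div_pow]; ring
        _ ≤ C₁ * M * (2 * (ε / ρ)) ^ k := by gcongr; linarith
        _ ≤ C₁ * M * (2 * (ε / ρ)) ^ m := by
            gcongr
            · exact (Finset.mem_range.mp hk).le
    have h5 : |∑ k ∈ Finset.range m, rayCoeff r k b * ε ^ k| ≤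
        m * (C₁ * M * (2 * (ε / ρ)) ^ m) := by
      refine (Finset.abs_sum_le_sum_abs _ _).trans ((Finset.sum_le_sum h4).trans (le_of_eq ?_))
      simp
    refine (abs_sub _ _).trans ?_
    have h6 : C₂ * M ≤ C₂ * M * (2 * (ε / ρ)) ^ m := le_mul_of_one_le_right (by positivity) hqm
    have h7 : 0 ≤ 2 * (C₁ * M) * (2 * (ε / ρ)) ^ m := by positivity
    linarith

end

noncomputable section

/-! ### The gap-ratio density -/

/-- The elementary bound `b/(1+b)³ ≤ 1/(1+b²)` supplies an integrable majorant. -/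
theorem integrableOn_mul_of_decay {g : ℝ → ℝ} {C : ℝ}
    (hg : AEStronglyMeasurable g (volume.restrict (Set.Ioi 0)))
    (h : ∀ b, 0 < b → |g b| ≤ C / (1 + b) ^ 3) :
    IntegrableOn (fun b => b * g b) (Set.Ioi 0) ∧
      |∫ b in Set.Ioi 0, b * g b| ≤ C * ∫ b in Set.Ioi (0 : ℝ), (1 + b ^ 2)⁻¹ := by
  have hC : 0 ≤ C := by
    have := (abs_nonneg _).trans (h 1 one_pos)
    by_contra hC
    have h2 : C / (1 + 1) ^ 3 < 0 := div_neg_of_neg_of_pos (not_le.mp hC) (by norm_num)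
    linarith
  have hint : IntegrableOn (fun b : ℝ => C * (1 + b ^ 2)⁻¹) (Set.Ioi 0) :=
    (integrable_inv_one_add_sq.const_mul C).integrableOn
  have hb : ∀ᵐ b ∂volume.restrict (Set.Ioi (0 : ℝ)), ‖b * g b‖ ≤ C * (1 + b ^ 2)⁻¹ := by
    filter_upwards [ae_restrict_mem measurableSet_Ioi] with b hb
    have hb0 : 0 < b := hb
    rw [norm_mul, Real.norm_of_nonneg hb0.le, Real.norm_eq_abs]
    calc b * |g b| ≤ b * (C / (1 + b) ^ 3) := mul_le_mul_of_nonneg_left (h b hb0) hb0.le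
      _ = C * (b / (1 + b) ^ 3) := by ring
      _ ≤ C * (1 + b ^ 2)⁻¹ := by
          refine mul_le_mul_of_nonneg_left ?_ hC
          rw [div_le_iff₀ (by positivity), inv_mul_eq_div, le_div_iff₀ (by positivity)]
          nlinarith [pow_pos hb0 2, pow_pos hb0 3]
  refine ⟨hint.mono' (by fun_prop) hb, ?_⟩
  rw [← integral_const_mul, ← Real.norm_eq_abs]
  exact norm_integral_le_of_norm_le hint hb

variable {r : ℝ}

/-- Agreement is required only inside the interval, since the density is identified with its
analytic extension only at admissible, hence interior, endpoints. -/
theorem intervalIntegrable_of_eq_Ioo {f g : ℝ → ℝ} {B : ℝ} (hB : 0 ≤ B)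
    (hg : ContinuousOn g (Set.uIcc 0 B)) (h : ∀ b, 0 < b → b < B → f b = g b) :
    IntervalIntegrable f volume 0 B := by
  rw [intervalIntegrable_iff_integrableOn_Ioo_of_le hB]
  have := hg.intervalIntegrable (μ := volume)
  rw [intervalIntegrable_iff_integrableOn_Ioo_of_le hB] at this
  exact this.congr_fun (fun b hb => (h b hb.1 hb.2).symm) measurableSet_Ioo

theorem mul_PcUnf_ray_eq (hr : 0 < r) {N b : ℝ} (hN : N ≠ 0) (hb : 0 < b)
    (hbN : (1 + r) * b < Real.pi * |N|) :
    b * PcUnf N (-(r * b)) b =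
      -((b : ℂ) * mixedDeriv janossyC (rayPoint r (1 / (N : ℂ) ^ 2) b)).re := by
  have hrb : 0 < r * b := mul_pos hr hb
  rw [(extends_janossyC hN).PcUnf_eq hN ⟨by linarith, hb, by linarith⟩, Complex.re_ofReal_mul,
    mul_neg, rayPoint]

theorem continuousOn_ray {B : ℝ} (hB : 0 < B) {ε : ℂ}
    (h : ∀ b ∈ Set.Icc 0 B, AnalyticAt ℂ (mixedDeriv janossyC) (rayPoint r ε b)) :
    ContinuousOn (fun b : ℝ => (b : ℂ) * mixedDeriv janossyC (rayPoint r ε b)) (Set.uIcc 0 B) := by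
  rw [Set.uIcc_of_le hB.le]
  intro b hb
  refine ContinuousAt.continuousWithinAt (Complex.continuous_ofReal.continuousAt.mul ?_)
  exact (h b hb).continuousAt.comp (continuous_rayPoint r ε).continuousAt

theorem continuousOn_ray_inv_sq (hr : 0 < r) {N B : ℝ} (hN : N ≠ 0) (hB : 0 < B)
    (hBN : (1 + r) * B < Real.pi * |N|) :
    ContinuousOn (fun b : ℝ => (b : ℂ) * mixedDeriv janossyC (rayPoint r (1 / (N : ℂ) ^ 2) b))
      (Set.uIcc 0 B) := by
  refine continuousOn_ray hB fun b hb => analyticAt_mixedDeriv (analyticAt_janossyC ?_)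
  refine argsSatisfy_sincSqrt_ne_zero hN (by linarith [mul_nonneg hr.le hb.1]) hb.1 ?_
  nlinarith [hb.2]

theorem intervalIntegrable_mul_PcUnf (hr : 0 < r) {N B : ℝ} (hN : N ≠ 0) (hB : 0 < B)
    (hBN : (1 + r) * B < Real.pi * |N|) :
    IntervalIntegrable (fun b => b * PcUnf N (-(r * b)) b) volume 0 B := by
  refine intervalIntegrable_of_eq_Ioo hB.le
    (Complex.continuous_re.comp_continuousOn (continuousOn_ray_inv_sq hr hN hB hBN)).neg
    fun b hb hb' => mul_PcUnf_ray_eq hr hN hb ?_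
  nlinarith

/-- On `[0, B]` the radius at `B` works for all `b`. Cauchy's estimate on half that radius bounds
the `ε`-derivative uniformly, which allows differentiation under the integral. -/
theorem analyticAt_integral_ray (hr : 0 < r) {B : ℝ} (hB : 0 < B) :
    AnalyticAt ℂ (fun ε : ℂ => ∫ b in (0 : ℝ)..B,
      (b : ℂ) * mixedDeriv janossyC (rayPoint r ε b)) 0 := by
  obtain ⟨C, hC, hbound⟩ := exists_norm_mixedDeriv_janossyC_le hr 0
  set ρ := polyRadius r B with hρ
  have hρ0 : 0 < ρ := polyRadius_pos hr hB.le
  have han : ∀ ε : ℂ, ‖ε‖ ≤ ρ → ∀ b ∈ Set.Icc 0 B,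
      AnalyticAt ℂ (mixedDeriv janossyC) (rayPoint r ε b) := fun ε hε b hb =>
    analyticAt_mixedDeriv_ray hr hb.1 (hε.trans (polyRadius_antitone hr hb.1 hb.2))
  have hball : ∀ z ∈ Metric.ball (0 : ℂ) (ρ / 2), ∀ t : ℂ, ‖t‖ ≤ ρ / 2 → ‖z + t‖ ≤ ρ := by
    intro z hz t ht
    rw [mem_ball_zero_iff] at hz
    exact (norm_add_le _ _).trans (by linarith)
  have hball0 : ∀ z ∈ Metric.ball (0 : ℂ) (ρ / 2), ‖z‖ ≤ ρ := fun z hz => by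
    simpa using hball z hz 0 (by simpa using (half_pos hρ0).le)
  refine DifferentiableOn.analyticAt (s := Metric.ball 0 (ρ / 2)) (fun z hz => ?_)
    (Metric.ball_mem_nhds _ (half_pos hρ0))
  refine DifferentiableAt.differentiableWithinAt ?_
  have hmem : ∀ b ∈ Set.uIoc 0 B, b ∈ Set.Icc 0 B := fun b hb => by
    rw [Set.uIoc_of_le hB.le] at hb
    exact Set.Ioc_subset_Icc_self hb
  refine (intervalIntegral.hasDerivAt_integral_of_dominated_loc_of_deriv_le
    (s := Metric.ball 0 (ρ / 2)) (bound := fun _ => B * (C / (ρ / 2)))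
    (F' := fun ε b => (b : ℂ) * dirDeriv (1, 0, 0) (mixedDeriv janossyC) (rayPoint r ε b))
    (Metric.isOpen_ball.mem_nhds hz) ?_ (continuousOn_ray hB (han z (hball0 z hz))).intervalIntegrable
    ?_ ?_ intervalIntegrable_const ?_).2.differentiableAt
  · filter_upwards [Metric.isOpen_ball.mem_nhds hz] with w hw
    exact (continuousOn_ray hB (han w (hball0 w hw))).intervalIntegrable.def'.1
  · have hc : ContinuousOn (fun b : ℝ => (b : ℂ) *
        dirDeriv (1, 0, 0) (mixedDeriv janossyC) (rayPoint r z b)) (Set.uIcc 0 B) := by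
      rw [Set.uIcc_of_le hB.le]
      intro b hb
      refine ContinuousAt.continuousWithinAt (Complex.continuous_ofReal.continuousAt.mul ?_)
      exact (analyticAt_dirDeriv (han z (hball0 z hz) b hb) _).continuousAt.comp
        (continuous_rayPoint r z).continuousAt
    exact hc.intervalIntegrable.def'.1
  · refine Eventually.of_forall fun b hb w hw => ?_
    have hb' := hmem b hb
    rw [norm_mul, Complex.norm_real, Real.norm_of_nonneg hb'.1]
    refine mul_le_mul hb'.2 ?_ (norm_nonneg _) hB.le
    have hpt : ∀ t : ℂ, rayPoint r w b + t • ((1 : ℂ), (0 : ℂ), (0 : ℂ)) = rayPoint r (w + t) b := by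
      intro t; simp [rayPoint]
    refine norm_dirDeriv_le (half_pos hρ0) (fun t ht => ?_) fun t ht => ?_
    · rw [hpt]; exact han _ (hball w hw t ht) b hb'
    · rw [hpt]
      simpa using hbound b hb'.1 _ ((hball w hw t ht).trans (polyRadius_antitone hr hb'.1 hb'.2))
  · refine Eventually.of_forall fun b hb w hw => ?_
    refine HasDerivAt.const_mul _ (hasDerivAt_comp_of_analyticAt (γ := fun w => rayPoint r w b)
      (han w (hball0 w hw) b (hmem b hb)) ?_)
    exact (hasDerivAt_id w).prodMk ((hasDerivAt_const _ _).prodMk (hasDerivAt_const _ _))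

theorem analyticInInvSq_integral_mul_PcUnf (hr : 0 < r) {B : ℝ} (hB : 0 < B) :
    AnalyticInInvSq ((1 + r) * B) (fun N => ∫ b in (0 : ℝ)..B, b * PcUnf N (-(r * b)) b) := by
  refine ⟨_, (analyticAt_re_ofReal (x := 0) (by
    rw [Complex.ofReal_zero]; exact analyticAt_integral_ray hr hB)).fun_neg, fun N hN hBN => ?_⟩
  have hint := (continuousOn_ray_inv_sq hr hN hB hBN).intervalIntegrable (μ := volume)
  rw [ofReal_inv_sq]
  have h1 := Complex.reCLM.intervalIntegral_comp_comm hint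
  simp only [Complex.reCLM_apply] at h1
  rw [← h1, ← intervalIntegral.integral_neg]
  refine intervalIntegral.integral_congr_ae (Eventually.of_forall fun b hb => ?_)
  rw [Set.uIoc_of_le hB.le] at hb
  exact mul_PcUnf_ray_eq hr hN hb.1 (by nlinarith [hb.2])

/-- The interval reaches the edge where the denominator of `S_ε` can vanish; the entire extension
for integer `N` stays continuous there. -/
theorem intervalIntegrable_mul_PcUnf_nat (hr : 0 < r) {N : ℕ} (hN : N ≠ 0) :
    IntervalIntegrable (fun b => b * PcUnf N (-(r * b)) b) volume 0 (Real.pi * N / (1 + r)) := by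
  have hNR : (0 : ℝ) < N := by exact_mod_cast Nat.pos_of_ne_zero hN
  have hc : Continuous fun b : ℝ => b * -(mixedDeriv (janossyInt N) (rayPoint r 0 b)).re := by
    refine continuous_id.mul (Complex.continuous_re.comp ?_).neg
    rw [continuous_iff_continuousAt]
    intro b
    exact (analyticAt_mixedDeriv (analyticAt_janossyInt N _)).continuousAt.comp
      (continuous_rayPoint r 0).continuousAt
  have := Real.pi_pos
  refine intervalIntegrable_of_eq_Ioo (by positivity) hc.continuousOn fun b hb hb' => ?_
  rw [lt_div_iff₀ (by positivity)] at hb'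
  have hrb : 0 < r * b := mul_pos hr hb
  rw [(extends_janossyInt hN 0).PcUnf_eq (Nat.cast_ne_zero.mpr hN)
    ⟨by linarith, hb, by rw [Nat.abs_cast]; linarith⟩, rayPoint]

theorem intervalIntegrable_mul_Pc_nat (hr : 0 < r) {N : ℕ} (hN : N ≠ 0) :
    IntervalIntegrable (fun b => b * Pc N (-(r * b)) b) volume 0 (2 * Real.pi / (1 + r)) := by
  have hNR : (0 : ℝ) < N := by exact_mod_cast Nat.pos_of_ne_zero hN
  have h1 := ((intervalIntegrable_mul_PcUnf_nat hr hN).comp_mul_left (c := (N : ℝ) / 2)).const_mul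
    ((N : ℝ) / 2)
  have h2 : (0 : ℝ) / ((N : ℝ) / 2) = 0 := zero_div _
  have h3 : Real.pi * N / (1 + r) / ((N : ℝ) / 2) = 2 * Real.pi / (1 + r) := by field_simp
  rw [h2, h3] at h1
  refine h1.congr fun b _ => ?_
  simp only [PcUnf]
  have h4 : (2 : ℝ) / N * (N / 2 * b) = b := by field_simp
  have h5 : (2 : ℝ) / N * -(r * (N / 2 * b)) = -(r * b) := by field_simp
  rw [h4, h5]
  field_simp

theorem Pr_eq_integral_PcUnf {N : ℝ} (hN : N ≠ 0) (r : ℝ) :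
    Pr N r = ∫ b in (0 : ℝ)..(Real.pi * N / (1 + r)), b * PcUnf N (-(r * b)) b := by
  have h1 := intervalIntegral.smul_integral_comp_mul_left (a := 0) (b := Real.pi * N / (1 + r))
    (fun b => b * Pc N (-(r * b)) b) (2 / N)
  have h2 : 2 / N * (Real.pi * N / (1 + r)) = 2 * Real.pi / (1 + r) := by field_simp
  rw [mul_zero, h2, smul_eq_mul, ← intervalIntegral.integral_const_mul] at h1
  rw [Pr, ← h1]
  refine intervalIntegral.integral_congr fun b _ => ?_
  simp only [PcUnf]
  have h5 : 2 / N * -(r * b) = -(r * (2 / N * b)) := by ring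
  rw [h5]
  ring

theorem integrableOn_mul_rayCoeff (hr : 0 < r) (k : ℕ) :
    IntegrableOn (fun b => b * rayCoeff r k b) (Set.Ioi 0) := by
  obtain ⟨C, -, h⟩ := exists_abs_rayCoeff_le hr k 3
  exact (integrableOn_mul_of_decay (continuous_rayCoeff r k).aestronglyMeasurable
    fun b hb => h b hb.le).1

theorem mul_ite_eq_indicator (hr : 0 < r) (N : ℕ) (b : ℝ) :
    b * (if (1 + r) * b < Real.pi * N then PcUnf N (-(r * b)) b else 0) =
      (Set.Iio (Real.pi * N / (1 + r))).indicator (fun b => b * PcUnf N (-(r * b)) b) b := by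
  have h1 : b ∈ Set.Iio (Real.pi * N / (1 + r)) ↔ (1 + r) * b < Real.pi * N := by
    rw [Set.mem_Iio, lt_div_iff₀ (by positivity), mul_comm]
  by_cases h : (1 + r) * b < Real.pi * N
  · rw [if_pos h, Set.indicator_of_mem (h1.mpr h)]
  · rw [if_neg h, Set.indicator_of_notMem (fun h' => h (h1.mp h')), mul_zero]

/-- The range depending on `N` becomes an indicator on the fixed half-line, where the Taylor terms
are integrated as well. -/
theorem integral_cutoff (hr : 0 < r) {N : ℕ} (hN : N ≠ 0) :
    IntegrableOn (fun b : ℝ => b * (if (1 + r) * b < Real.pi * N then PcUnf N (-(r * b)) b else 0))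
      (Set.Ioi 0) ∧
    Pr N r = ∫ b in Set.Ioi (0 : ℝ),
      b * (if (1 + r) * b < Real.pi * N then PcUnf N (-(r * b)) b else 0) := by
  have hX : 0 ≤ Real.pi * N / (1 + r) := by
    have := Real.pi_pos
    positivity
  have h1 := intervalIntegrable_mul_PcUnf_nat hr hN
  have hset : Set.Ioi (0 : ℝ) ∩ Set.Iio (Real.pi * N / (1 + r)) =
      Set.Ioo 0 (Real.pi * N / (1 + r)) := Set.Ioi_inter_Iio
  rw [intervalIntegrable_iff_integrableOn_Ioo_of_le hX, ← hset, Set.inter_comm] at h1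
  constructor
  · refine IntegrableOn.congr_fun ?_ (fun b _ => (mul_ite_eq_indicator hr N b).symm)
      measurableSet_Ioi
    rw [IntegrableOn, integrable_indicator_iff measurableSet_Iio, IntegrableOn,
      Measure.restrict_restrict measurableSet_Iio]
    exact h1
  · rw [Pr_eq_integral_PcUnf (Nat.cast_ne_zero.mpr hN), intervalIntegral.integral_of_le hX,
      integral_Ioc_eq_integral_Ioo, ← hset, ← setIntegral_indicator measurableSet_Iio]
    exact (setIntegral_congr_fun measurableSet_Ioi fun b _ => mul_ite_eq_indicator hr N b).symm

/-- The pointwise remainder carries the factor `N^(-2m)` and decays like `(1+b)^(-3)`. It can thus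
be integrated against `b` over the whole half-line, including the tails of the Taylor terms beyond
the range of the density. -/
theorem Pr_isBigO (hr : 0 < r) (m : ℕ) :
    Asymptotics.IsBigO atTop
      (fun N : ℕ => Pr (N : ℝ) r - ∑ k ∈ Finset.range m,
        (∫ b in Set.Ioi (0 : ℝ), b * rayCoeff r k b) * (1 / (N : ℝ) ^ 2) ^ k)
      (fun N : ℕ => (1 / (N : ℝ) ^ 2) ^ m) := by
  obtain ⟨C, hC, h⟩ := exists_abs_cutoff_sub_taylor_le hr m 3
  refine Asymptotics.IsBigO.of_bound (C * ∫ b in Set.Ioi (0 : ℝ), (1 + b ^ 2)⁻¹) ?_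
  filter_upwards [eventually_ne_atTop 0] with N hN
  obtain ⟨hi, he⟩ := integral_cutoff hr hN
  have hterm : ∀ k ∈ Finset.range m, IntegrableOn
      (fun b => b * rayCoeff r k b * (1 / (N : ℝ) ^ 2) ^ k) (Set.Ioi 0) :=
    fun k _ => (integrableOn_mul_rayCoeff hr k).mul_const _
  have hsum : Pr (N : ℝ) r - ∑ k ∈ Finset.range m,
      (∫ b in Set.Ioi (0 : ℝ), b * rayCoeff r k b) * (1 / (N : ℝ) ^ 2) ^ k =
      ∫ b in Set.Ioi (0 : ℝ),
        b * ((if (1 + r) * b < Real.pi * N then PcUnf N (-(r * b)) b else 0) -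
          ∑ k ∈ Finset.range m, rayCoeff r k b * (1 / (N : ℝ) ^ 2) ^ k) := by
    simp only [mul_sub, Finset.mul_sum, ← mul_assoc]
    rw [integral_sub hi (integrable_finsetSum _ hterm), integral_finsetSum _ hterm, he]
    simp only [integral_mul_const]
  have hm : AEStronglyMeasurable (fun b =>
      (if (1 + r) * b < Real.pi * N then PcUnf N (-(r * b)) b else 0) -
          ∑ k ∈ Finset.range m, rayCoeff r k b * (1 / (N : ℝ) ^ 2) ^ k)
      (volume.restrict (Set.Ioi 0)) := by
    -- Measurability of the cut-off density is recovered from integrability of its product with `b`,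
    -- dividing by `b > 0`.
    have h1 : AEStronglyMeasurable (fun b : ℝ => b⁻¹ * (b *
        (if (1 + r) * b < Real.pi * N then PcUnf N (-(r * b)) b else 0)))
        (volume.restrict (Set.Ioi 0)) :=
      (measurable_inv.aestronglyMeasurable).mul hi.1
    refine AEStronglyMeasurable.sub (h1.congr ?_) ?_
    · filter_upwards [ae_restrict_mem measurableSet_Ioi] with b hb
      have hb0 : b ≠ 0 := ne_of_gt hb
      rw [inv_mul_cancel_left₀ hb0]
    · refine Continuous.aestronglyMeasurable ?_
      exact continuous_finsetSum _ fun k _ => (continuous_rayCoeff r k).mul continuous_const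
  rw [hsum, Real.norm_eq_abs]
  have hfin := (integrableOn_mul_of_decay hm (C := C * (1 / (N : ℝ) ^ 2) ^ m) fun b hb => by
    refine (h N hN b hb).trans (le_of_eq ?_)
    ring).2
  refine hfin.trans (le_of_eq ?_)
  rw [Real.norm_of_nonneg (by positivity)]
  ring

end

end CUEJanossy

theorem mainTheorem6 :
    -- invariance of the unfolded system and of its boundary conditions under `N ↦ -N`
    (∀ (N : ℝ), N ≠ 0 → ∀ D ⊆ CUEJanossy.unfoldedEndpoints N, ∀ X : CUEJanossy.TWFields,
      (CUEJanossy.UnfoldedTWSystem N D X ↔ CUEJanossy.UnfoldedTWSystem (-N) D X.flip) ∧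
      (CUEJanossy.UnfoldedTWBoundary N D X ↔ CUEJanossy.UnfoldedTWBoundary (-N) D X.flip)) ∧
    -- the density is smooth in the endpoints, so that the derivatives below are genuine
    (∀ A₁ A₂ N : ℝ, A₁ < 0 → 0 < A₂ → N ≠ 0 → A₂ - A₁ < Real.pi * |N| →
      ContDiffAt ℝ 2 (fun a : ℝ × ℝ => CUEJanossy.condJanossy N a.1 a.2)
        (2 / N * A₁, 2 / N * A₂)) ∧
    -- the Jánossy densities
    (∀ A₁ A₂ : ℝ, A₁ < 0 → 0 < A₂ →
      CUEJanossy.AnalyticInInvSq (A₂ - A₁) (fun N => CUEJanossy.condJanossyUnf N A₁ A₂) ∧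
      CUEJanossy.AnalyticInInvSq (A₂ - A₁) (fun N => CUEJanossy.janossyUnf N A₁ A₂)) ∧
    -- the nearest-neighbour spacing density
    (∀ T : ℝ, 0 < T →
      CUEJanossy.AnalyticInInvSq (2 * T) (fun N => CUEJanossy.PnnUnf N T)) ∧
    -- the joint density of consecutive spacings, and the gap-ratio density
    (∃ G : ℝ → ℝ → ℝ → ℝ,
      (∀ A₁ A₂ : ℝ, A₁ < 0 → 0 < A₂ →
        AnalyticAt ℝ (fun ε => G ε A₁ A₂) 0 ∧
        ∀ N : ℝ, N ≠ 0 → A₂ - A₁ < Real.pi * |N| →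
          CUEJanossy.PcUnf N A₁ A₂ = G (1 / N ^ 2) A₁ A₂) ∧
      (∀ r : ℝ, 0 < r →
        (∀ B : ℝ, 0 < B →
          (∀ N : ℝ, N ≠ 0 → (1 + r) * B < Real.pi * |N| →
            IntervalIntegrable (fun b => b * CUEJanossy.PcUnf N (-(r * b)) b)
              MeasureTheory.volume 0 B) ∧
          CUEJanossy.AnalyticInInvSq ((1 + r) * B)
            (fun N => ∫ b in (0 : ℝ)..B, b * CUEJanossy.PcUnf N (-(r * b)) b)) ∧
        (∀ N : ℕ, 1 ≤ N →
          IntervalIntegrable (fun b => b * CUEJanossy.Pc (N : ℝ) (-(r * b)) b)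
            MeasureTheory.volume 0 (2 * Real.pi / (1 + r))) ∧
        (∀ k : ℕ, MeasureTheory.IntegrableOn
          (fun b => b * (iteratedDeriv k (fun ε => G ε (-(r * b)) b) 0 / (k.factorial : ℝ)))
          (Set.Ioi 0)) ∧
        (∀ m : ℕ, Asymptotics.IsBigO Filter.atTop
          (fun N : ℕ => CUEJanossy.Pr (N : ℝ) r -
            ∑ k ∈ Finset.range m,
              (∫ b in Set.Ioi (0 : ℝ),
                b * (iteratedDeriv k (fun ε => G ε (-(r * b)) b) 0 / (k.factorial : ℝ))) *
              (1 / (N : ℝ) ^ 2) ^ k)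
          (fun N : ℕ => (1 / (N : ℝ) ^ 2) ^ m)))) := by
  refine ⟨fun N _ D _ X => ⟨CUEJanossy.unfoldedTWSystem_iff_flip N D X,
    CUEJanossy.unfoldedTWBoundary_iff_flip N D X⟩,
    fun A₁ A₂ N h1 h2 hN hL =>
      (CUEJanossy.extends_janossyC hN).contDiffAt hN ⟨h1, h2, hL⟩,
    fun A₁ A₂ h1 h2 => ⟨CUEJanossy.analyticInInvSq_condJanossyUnf h1 h2,
      CUEJanossy.analyticInInvSq_janossyUnf h1 h2⟩,
    fun T hT => CUEJanossy.analyticInInvSq_PnnUnf hT,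
    -- The same extension serves all endpoints and all `N`, so its Taylor coefficients at `ε = 0`
    -- are those integrated term by term.
    CUEJanossy.pcExt,
    fun A₁ A₂ h1 h2 => ⟨CUEJanossy.analyticAt_pcExt A₁ A₂, fun N hN hL =>
      CUEJanossy.PcUnf_eq_pcExt hN h1 h2 hL⟩,
    fun r hr => ⟨fun B hB => ⟨fun N hN hBN => CUEJanossy.intervalIntegrable_mul_PcUnf hr hN hB hBN,
      CUEJanossy.analyticInInvSq_integral_mul_PcUnf hr hB⟩,
      fun N hN => CUEJanossy.intervalIntegrable_mul_Pc_nat hr (Nat.one_le_iff_ne_zero.mp hN),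
      CUEJanossy.integrableOn_mul_rayCoeff hr, CUEJanossy.Pr_isBigO hr⟩⟩
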